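/- Let $\mathrm{QSym}\subset\mathbb Z[[x_1,x_2,\dots]]$ be the ring of quasisymmetric functions, with monomial and fundamental quasisymmetric functions $M_\alpha=\sum_{i_1<\dots<i_r}x_{i_1}^{\alpha_1}\cdots x_{i_r}^{\alpha_r}$ and $F_\alpha=\sum_{D(\beta)\supseteq D(\alpha)}M_\beta$, where $D(\alpha)=\{\alpha_1,\alpha_1+\alpha_2,\dots,\alpha_1+\cdots+\alpha_{r-1}\}$. For $n\ge 1$ call $P\subseteq[2,n-1]$ a peak subset of $[n-1]$ if $i\in P$ implies $i-1\notin P$, and let $$K_P=2^{|P|+1}\sum_{\alpha\vDash n,\ P\subseteq D(\alpha)\,\triangle\,(D(\alpha)+1)}F_\alpha .$$ Let $\mathrm{PQSym}$ be the ring of peak quasisymmetric functions, i.e. the ring generated by all the $K_P$. For a composition $\alpha$ of $n$ let $P(\alpha)=\{i\in D(\alpha)\cap[2,n-1]: i-1\notin D(\alpha)\}$, and for $k\ge1$ let $k\cdot\alpha=(k\alpha_1,\dots,k\alpha_r)$. The Adams operations $\Psi^n$ ($n\ge 1$) of a $\lambda$-ring are defined by $\frac{d}{dt}\log\lambda_t(a)=\sum_{n\ge0}(-1)^n\Psi^{n+1}(a)t^n$,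 where $\lambda_t(a)=\sum_{n\ge0}\lambda^n(a)t^n$. Theorem. $\mathrm{QSym}$ has a $\lambda$-ring structure whose Adams operations satisfy $\Psi^k(M_\alpha)=M_{k\cdot\alpha}$ for all $k\ge1$ and all compositions $\alpha$, and there is a surjective ring homomorphism $\vartheta:\mathrm{QSym}\to\mathrm{PQSym}$ (Stembridge's descent-to-peak map) with $\vartheta(F_\alpha)=K_{P(\alpha)}$ for every non-empty composition $\alpha$. There exists a $\lambda$-ring structure on $\mathrm{PQSym}$ such that $\vartheta$ is a morphism of $\lambda$-rings, i.e. $\vartheta\circ\lambda^i=\lambda^i\circ\vartheta$ for all $i$. Its Adams operations are ring endomorphisms $\Phi^k$ ($k\ge1$) of $\mathrm{PQSym}$ such that, with $L_\alpha=\vartheta(M_\alpha)$, for every non-empty composition $\alpha$ all of whose parts are odd, $$\Phi^k(L_\alpha)=\begin{cases}L_{k\cdot\alpha},&k\text{ odd},\\0,&k\text{ even.}\end{cases}$$ In particular, the ring $\Gamma$ of Schur's $Q$-functions, generated by the $q_n$ $(n\ge1)$ with $\sum_{n\ge0}q_nz^n=\prod_{i\ge1}\frac{1+x_iz}{1-x_iz}$,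 is contained in $\mathrm{PQSym}$ and is stable under all the operations $\lambda^i$ of this structure, i.e. it is a $\lambda$-subring of $\mathrm{PQSym}$. -/

import Mathlib

noncomputable section

namespace PeakQSym

/-! ### Lambda rings -/

/-- `P` is the universal polynomial `P_n` expressing `λⁿ(xy)`: writing `e_i` for the elementary
symmetric polynomials, `P (e_1(x), …, e_n(x); e_1(y), …, e_n(y))` is the coefficient of `tⁿ` in
`∏_{i,j} (1 + x_i y_j t)`, where `x = (x_1, …, x_n)` and `y = (y_1, …, y_n)`. -/
def IsUniversalMul (n : ℕ) (P : MvPolynomial (Fin n ⊕ Fin n) ℤ) : Prop :=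
  MvPolynomial.aeval (R := ℤ) (S₁ := MvPolynomial (Fin n ⊕ Fin n) ℤ)
      (Sum.elim
        (fun i : Fin n => MvPolynomial.rename Sum.inl (MvPolynomial.esymm (Fin n) ℤ (i + 1)))
        (fun i : Fin n => MvPolynomial.rename Sum.inr (MvPolynomial.esymm (Fin n) ℤ (i + 1)))) P
    = (∏ i : Fin n, ∏ j : Fin n,
        (1 + Polynomial.C (MvPolynomial.X (Sum.inl i) * MvPolynomial.X (Sum.inr j) :
          MvPolynomial (Fin n ⊕ Fin n) ℤ) * Polynomial.X)).coeff n

/-- `P` is the universal polynomial `P_{m,n}` expressing `λᵐ(λⁿ(x))`: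
`P (e_1(x), …, e_{mn}(x))` is the coefficient of `tᵐ` in `∏_S (1 + t ∏_{i ∈ S} x_i)`, where
`S` runs over the `n`-element subsets of the index set of `x = (x_1, …, x_{mn})`. -/
def IsUniversalComp (m n : ℕ) (P : MvPolynomial (Fin (m * n)) ℤ) : Prop :=
  MvPolynomial.aeval (R := ℤ) (S₁ := MvPolynomial (Fin (m * n)) ℤ)
      (fun i : Fin (m * n) => MvPolynomial.esymm (Fin (m * n)) ℤ (i + 1)) P
    = (∏ S ∈ Finset.powersetCard n (Finset.univ : Finset (Fin (m * n))),
        (1 + Polynomial.C (∏ i ∈ S, MvPolynomial.X i :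
          MvPolynomial (Fin (m * n)) ℤ) * Polynomial.X)).coeff m

/-- A λ-ring structure on a commutative ring `R`. The universal polynomials in the last
two laws exist and are unique by the fundamental theorem on symmetric polynomials. -/
structure LambdaStructure (R : Type*) [CommRing R] where
  /-- the operation `λⁿ : R → R` -/
  lam : ℕ → R → R
  lam_zero : ∀ x, lam 0 x = 1
  lam_one : ∀ x, lam 1 x = x
  lam_add : ∀ n x y, lam n (x + y) = ∑ ij ∈ Finset.HasAntidiagonal.antidiagonal n, lam ij.1 x * lam ij.2 y
  lam_of_one : ∀ n, 2 ≤ n → lam n 1 = 0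
  lam_mul : ∀ n, ∃ P, IsUniversalMul n P ∧ ∀ x y,
    lam n (x * y) =
      MvPolynomial.aeval (Sum.elim (fun i : Fin n => lam (i + 1) x) (fun i : Fin n => lam (i + 1) y)) P
  lam_comp : ∀ m n, ∃ P, IsUniversalComp m n P ∧ ∀ x,
    lam m (lam n x) = MvPolynomial.aeval (fun i : Fin (m * n) => lam (i + 1) x) P

namespace LambdaStructure

variable {R : Type*} [CommRing R] (L : LambdaStructure R)

/-- The generating series `λ_t(a) = 1 + λ¹(a) t + λ²(a) t² + ⋯`. -/
def series (a : R) : PowerSeries R := PowerSeries.mk fun n => L.lam n a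

/-- The Adams operation `Ψⁿ` for `n ≥ 1`, defined by
`d/dt log λ_t(a) = ∑_{n ≥ 0} (-1)ⁿ Ψ^{n+1}(a) tⁿ`, the logarithmic derivative being
`λ_t'(a) / λ_t(a)`. (The value at `n = 0` has no meaning.) -/
def adams (n : ℕ) (a : R) : R :=
  (-1) ^ (n - 1) *
    PowerSeries.coeff (n - 1)
      (PowerSeries.derivative R (L.series a) * PowerSeries.invOfUnit (L.series a) 1)

/-- A subring is a λ-subring if it is stable under all the operations `λⁿ`. -/
def IsLambdaSubring (S : Subring R) : Prop := ∀ n, ∀ x ∈ S, L.lam n x ∈ S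

/-- A ring homomorphism is a morphism of λ-rings if it commutes with all the `λⁿ`. -/
def IsLambdaHom {R' : Type*} [CommRing R'] (L' : LambdaStructure R') (f : R →+* R') : Prop :=
  ∀ n x, f (L.lam n x) = L'.lam n (f x)

end LambdaStructure

/-! ### Quasisymmetric functions

The variables `x_1, x_2, …` are indexed by `ℕ` with its usual order. -/

/-- Power series with integer coefficients in the variables `x_1, x_2, …`. -/
abbrev Series : Type := MvPowerSeries ℕ ℤ

/-- A series is quasisymmetric if, for all exponents `a_1, …, a_r`, the monomials
`x_{i_1}^{a_1} ⋯ x_{i_r}^{a_r}` with `i_1 < ⋯ < i_r` all have the same coefficient.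
(Exponents equal to zero may be dropped, so this is the same as for positive exponents.) -/
def IsQuasisymmetric (f : Series) : Prop :=
  ∀ (r : ℕ) (a : Fin r →₀ ℕ) (i j : Fin r ↪o ℕ),
    MvPowerSeries.coeff (a.mapDomain i) f = MvPowerSeries.coeff (a.mapDomain j) f

/-- The degrees of the monomials of `f` are bounded. -/
def IsBoundedDegree (f : Series) : Prop :=
  ∃ N : ℕ, ∀ d : ℕ →₀ ℕ, N < d.degree → MvPowerSeries.coeff d f = 0

theorem coeff_mapDomain_mul {r : ℕ} (a : Fin r →₀ ℕ) (i : Fin r ↪o ℕ) (f g : Series) :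
    MvPowerSeries.coeff (a.mapDomain i) (f * g) =
      ∑ p ∈ Finset.HasAntidiagonal.antidiagonal a,
        MvPowerSeries.coeff (p.1.mapDomain i) f * MvPowerSeries.coeff (p.2.mapDomain i) g := by
  classical
  rw [MvPowerSeries.coeff_mul]
  symm
  refine Finset.sum_bij (fun p _ => (p.1.mapDomain i, p.2.mapDomain i)) ?_ ?_ ?_ ?_
  · intro p hp
    rw [Finset.HasAntidiagonal.mem_antidiagonal] at hp ⊢
    rw [← hp, Finsupp.mapDomain_add]
  · intro p _ q _ h
    have hi := Finsupp.mapDomain_injective (M := ℕ) i.injective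
    exact Prod.ext (hi (Prod.mk.inj h).1) (hi (Prod.mk.inj h).2)
  · intro q hq
    rw [Finset.HasAntidiagonal.mem_antidiagonal] at hq
    have key : ∀ u : ℕ →₀ ℕ, u ≤ a.mapDomain i →
        (u.comapDomain i i.injective.injOn).mapDomain i = u := by
      intro u hu
      refine Finsupp.mapDomain_comapDomain i i.injective u ?_
      intro k hk
      have h1 : u k ≠ 0 := by simpa using hk
      have h2 : a.mapDomain i k ≠ 0 := by
        have := hu k
        omega
      obtain ⟨b, hb⟩ := Finsupp.mem_range_of_mapDomain_ne_zero h2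
      exact ⟨b, by simpa using hb⟩
    have h1 := key q.1 (hq ▸ le_self_add)
    have h2 := key q.2 (hq ▸ le_add_self)
    refine ⟨(q.1.comapDomain i i.injective.injOn, q.2.comapDomain i i.injective.injOn), ?_, ?_⟩
    · rw [Finset.HasAntidiagonal.mem_antidiagonal]
      apply Finsupp.mapDomain_injective (M := ℕ) i.injective
      rw [Finsupp.mapDomain_add, h1, h2, hq]
    · exact Prod.ext h1 h2
  · intros
    rfl

/-- The ring `QSym` of quasisymmetric functions over the integers. -/
def QSym : Subring Series where
  carrier := {f | IsBoundedDegree f ∧ IsQuasisymmetric f}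
  zero_mem' := ⟨⟨0, fun _ _ => by simp⟩, fun _ _ _ _ => by simp⟩
  one_mem' := by
    classical
    refine ⟨⟨0, fun d hd => ?_⟩, fun r a i j => ?_⟩
    · rw [MvPowerSeries.coeff_one, if_neg]
      rintro rfl
      simp at hd
    · have key : ∀ i : Fin r ↪o ℕ, a.mapDomain i = 0 ↔ a = 0 := fun i => by
        rw [← Finsupp.mapDomain_zero (f := i),
          (Finsupp.mapDomain_injective (M := ℕ) i.injective).eq_iff]
      simp only [MvPowerSeries.coeff_one, key]
  add_mem' := by
    rintro f g ⟨⟨N, hN⟩, hf⟩ ⟨⟨N', hN'⟩, hg⟩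
    refine ⟨⟨max N N', fun d hd => ?_⟩, fun r a i j => ?_⟩
    · rw [map_add, hN d (lt_of_le_of_lt (le_max_left _ _) hd),
        hN' d (lt_of_le_of_lt (le_max_right _ _) hd), add_zero]
    · rw [map_add, map_add, hf r a i j, hg r a i j]
  neg_mem' := by
    rintro f ⟨⟨N, hN⟩, hf⟩
    refine ⟨⟨N, fun d hd => ?_⟩, fun r a i j => ?_⟩
    · rw [map_neg, hN d hd, neg_zero]
    · rw [map_neg, map_neg, hf r a i j]
  mul_mem' := by
    classical
    rintro f g ⟨⟨N, hN⟩, hf⟩ ⟨⟨N', hN'⟩, hg⟩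
    refine ⟨⟨N + N', fun d hd => ?_⟩, fun r a i j => ?_⟩
    · rw [MvPowerSeries.coeff_mul]
      refine Finset.sum_eq_zero fun p hp => ?_
      rw [Finset.HasAntidiagonal.mem_antidiagonal] at hp
      have hdeg : p.1.degree + p.2.degree = d.degree := by rw [← hp, map_add]
      by_cases h : N < p.1.degree
      · rw [hN _ h, zero_mul]
      · rw [hN' _ (by omega), mul_zero]
    · rw [coeff_mapDomain_mul, coeff_mapDomain_mul]
      exact Finset.sum_congr rfl fun p _ => by rw [hf r p.1 i j, hg r p.2 i j]

/-- The exponent vector of the monomial `x_{i_1}^{α_1} ⋯ x_{i_r}^{α_r}`. -/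
def expo {n : ℕ} (α : Composition n) (i : Fin α.length ↪o ℕ) : ℕ →₀ ℕ :=
  ∑ k, Finsupp.single (i k) (α.blocksFun k)

open Classical in
/-- The monomial quasisymmetric function
`M_α = ∑_{i_1 < ⋯ < i_r} x_{i_1}^{α_1} ⋯ x_{i_r}^{α_r}`; distinct index sequences give distinct
monomials, so its coefficients are `0` or `1`. -/
def M {n : ℕ} (α : Composition n) : Series :=
  fun d => if ∃ i : Fin α.length ↪o ℕ, d = expo α i then 1 else 0

theorem coeff_M {n : ℕ} (α : Composition n) (d : ℕ →₀ ℕ) [Decidable (∃ i, d = expo α i)] :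
    MvPowerSeries.coeff d (M α) = if ∃ i, d = expo α i then 1 else 0 := by
  rw [MvPowerSeries.coeff_apply]
  unfold M
  congr

theorem exists_expo_of_mapDomain {n : ℕ} (α : Composition n) {r : ℕ} (a : Fin r →₀ ℕ)
    (i j : Fin r ↪o ℕ) (h : ∃ u, a.mapDomain i = expo α u) :
    ∃ u, a.mapDomain j = expo α u := by
  classical
  obtain ⟨u, hu⟩ := h
  have hr : ∀ k, ∃ l, i l = u k := by
    intro k
    have : a.mapDomain i (u k) ≠ 0 := by
      rw [hu, expo, Finsupp.finsetSum_apply]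
      have h1 : α.blocksFun k ≤ ∑ x, (Finsupp.single (u x) (α.blocksFun x)) (u k) := by
        refine le_trans (le_of_eq ?_) (Finset.single_le_sum (fun _ _ => Nat.zero_le _)
          (Finset.mem_univ k))
        simp
      have h2 := α.one_le_blocksFun k
      omega
    obtain ⟨b, hb⟩ := Finsupp.mem_range_of_mapDomain_ne_zero this
    exact ⟨b, by simpa using hb⟩
  choose g hg using hr
  have hgm : StrictMono g := fun k l hkl => by
    rw [← i.lt_iff_lt, hg, hg]
    exact u.strictMono hkl
  have ha : a = ∑ k, Finsupp.single (g k) (α.blocksFun k) := by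
    apply Finsupp.mapDomain_injective (M := ℕ) i.injective
    rw [hu, expo, Finsupp.mapDomain_finsetSum]
    refine Finset.sum_congr rfl fun k _ => ?_
    rw [Finsupp.mapDomain_single, hg]
  refine ⟨(OrderEmbedding.ofStrictMono g hgm).trans j, ?_⟩
  rw [ha, expo, Finsupp.mapDomain_finsetSum]
  refine Finset.sum_congr rfl fun k _ => ?_
  rw [Finsupp.mapDomain_single]
  rfl

theorem M_mem {n : ℕ} (α : Composition n) : M α ∈ QSym := by
  classical
  refine ⟨⟨n, fun d hd => ?_⟩, fun r a i j => ?_⟩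
  · rw [coeff_M, if_neg]
    rintro ⟨i, rfl⟩
    have : (expo α i).degree = n := by
      rw [expo, map_sum]
      simp [α.sum_blocksFun]
    omega
  · rw [coeff_M, coeff_M]
    refine if_congr ⟨exists_expo_of_mapDomain α a i j, exists_expo_of_mapDomain α a j i⟩ rfl rfl

/-- The composition `k · α = (k α_1, …, k α_r)`. -/
def dilate (k : ℕ) (hk : 0 < k) {n : ℕ} (α : Composition n) : Composition (k * n) where
  blocks := α.blocks.map (k * ·)
  blocks_pos := by
    intro i hi
    obtain ⟨b, hb, rfl⟩ := List.mem_map.1 hi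
    exact Nat.mul_pos hk (α.blocks_pos hb)
  blocks_sum := by
    rw [List.sum_map_mul_left, List.map_id', α.blocks_sum]

/-- The composition `α` has only odd parts. -/
def IsOdd {n : ℕ} (α : Composition n) : Prop := ∀ b ∈ α.blocks, Odd b

/-- The descent set `D(α) = {α_1, α_1 + α_2, …, α_1 + ⋯ + α_{r-1}}`. -/
def D {n : ℕ} (α : Composition n) : Finset ℕ :=
  (Finset.Ico 1 α.length).image α.sizeUpTo

/-- The fundamental quasisymmetric function `F_α = ∑_{D(α) ⊆ D(β)} M_β`, that is, the sum of the
monomials `x_{i_1} ⋯ x_{i_n}` with `i_1 ≤ ⋯ ≤ i_n` and `i_k < i_{k+1}` for `k ∈ D(α)`. -/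
def F {n : ℕ} (α : Composition n) : Series :=
  ∑ β : Composition n with D α ⊆ D β, M β

theorem F_mem {n : ℕ} (α : Composition n) : F α ∈ QSym :=
  QSym.sum_mem fun β _ => M_mem β

/-- `M_α` as an element of `QSym`. -/
def MQ {n : ℕ} (α : Composition n) : QSym := ⟨M α, M_mem α⟩

/-- `F_α` as an element of `QSym`. -/
def FQ {n : ℕ} (α : Composition n) : QSym := ⟨F α, F_mem α⟩

/-! ### Peak quasisymmetric functions -/

/-- `P` is a peak subset of `[n-1]`: `P ⊆ [2, n-1]`, and `i ∈ P` implies `i - 1 ∉ P`. -/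
def IsPeakSubset (n : ℕ) (P : Finset ℕ) : Prop :=
  P ⊆ Finset.Icc 2 (n - 1) ∧ ∀ i ∈ P, i - 1 ∉ P

/-- The peak subset `P(α) = {i ∈ D(α) ∩ [2, n-1] : i - 1 ∉ D(α)}`. -/
def peakSet {n : ℕ} (α : Composition n) : Finset ℕ :=
  {i ∈ D α ∩ Finset.Icc 2 (n - 1) | i - 1 ∉ D α}

/-- Stembridge's peak function
`K_P = 2^{|P|+1} ∑ F_α`, the sum over the compositions `α` of `n` with
`P ⊆ D(α) △ (D(α) + 1)`. -/
def K (n : ℕ) (P : Finset ℕ) : Series :=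
  2 ^ (P.card + 1) *
    ∑ α : Composition n with P ⊆ symmDiff (D α) ((D α).image (· + 1)), F α

/-- The ring `PQSym` of peak quasisymmetric functions: the subring of power series generated
by the peak functions `K_P`, for `P` a peak subset of `[n-1]` and `n ≥ 1`. -/
def PQSym : Subring Series :=
  Subring.closure {f | ∃ n P, 1 ≤ n ∧ IsPeakSubset n P ∧ f = K n P}

/-- The elementary symmetric function `e_n`: the sum of all squarefree monomials of degree `n`. -/
def elemSym (n : ℕ) : Series :=
  open Classical in fun d => if d.degree = n ∧ ∀ i, d i ≤ 1 then 1 else 0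

/-- The complete symmetric function `h_n`: the sum of all monomials of degree `n`. -/
def complSym (n : ℕ) : Series :=
  fun d => if d.degree = n then 1 else 0

/-- The symmetric function `q_n = ∑_{i + j = n} h_i e_j`, that is, the coefficient of `zⁿ` in
`∏_i (1 + x_i z) / (1 - x_i z)`. -/
def schurq (n : ℕ) : Series :=
  ∑ ij ∈ Finset.HasAntidiagonal.antidiagonal n, complSym ij.1 * elemSym ij.2

/-- The ring `Γ` of Schur's `Q`-functions, generated by the `q_n` with `n ≥ 1`. -/
def Γ : Subring Series := Subring.closure {f | ∃ n, 1 ≤ n ∧ f = schurq n}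

end PeakQSym

end

/-!
# The λ-ring of peak quasisymmetric functions

*λ-rings from Adams operations.* On a torsion-free ring, commuting ring endomorphisms `Ψ^k` with
`Ψ^k Ψ^l = Ψ^{kl}` define a λ-ring as soon as Newton's recursion
`n λ^n = ∑_{i ≥ 1} (-1)^{i-1} λ^{n-i} Ψ^i` can be solved in the ring (`AdamsStructure.toLambda`). The
universal laws for `λ^n(xy)` and `λ^m(λ^n(x))` need only be checked on the `Ψ^k`, where they are
identities between power sums. For power series in `x_0, x_1, …` and `Ψ^k : x_i ↦ x_i^k` the recursion is
solvable: up to a given exponent a series is an integral combination of monomials, and a monomial `u` has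
`λ_t(u) = 1 + ut` (`newton_lamSer`). Since `QSym` is stable under the `Ψ^k` and under exact division by
integers, it is a λ-ring, and `Ψ^k(M_α) = M_{k·α}`.

*The descent-to-peak map.* Let `D_n` be the operator on `QSym` taking the coefficient of the `n`-th power
of the first variable. Then `D(t) = ∑ D_n t^n` is a ring homomorphism to power series in `t`, it extends
to an automorphism of `QSym[[t]]`, and the coefficients of `f` are the constant terms of the iterates
`⋯ D_{d_1} D_{d_0} f`. The map `ϑ` is obtained by using `D(t) D(-t)⁻¹` in place of `D(t)` (`peakDer`,
`thetaHom`), so it is a ring homomorphism by construction. A computation of `D(t) D(-t)⁻¹` on `F_α`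
(`peakDer_descQ`) gives the coefficients of `ϑ(F_α)`, and they agree with those of `K_{P(α)}`
(`coeff_thetaFun_FQ`, `coeff_K`): at a monomial in `s` variables both are `2^s` or zero.

*Descent of the operations.* As `D(t) Ψ^k` is `Ψ^k D(t)` with `t` replaced by `t^k`, the map `ϑ` commutes
with `Ψ^k` for odd `k`. For even `k` the sign of `t` is lost, so `D(t) D(-t)⁻¹` fixes the image of `Ψ^k`,
and `ϑ(Ψ^k(f))` is the constant term of `f` (`thetaHom_psi_of_odd`, `thetaHom_psi_of_even`). In both cases
the kernel of `ϑ` is preserved, and all operations descend to `PQSym` (`AdamsStructure.ofSurjective`).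

*Schur's `Q`-functions.* The Adams operations send `q_1 = 2 ∑ x_i` to `2 ∑ x_i^k` or `0`, for `k` odd or
even, and these are the coefficients of the logarithmic derivative of `∏ (1 + x_i z) / (1 - x_i z)`. So
`q_n = λ^n(q_1)` (`coe_lam_theta_FQ_ones`), and a subring generated by the `λ^n` of a single element is a
λ-subring (`LambdaStructure.isLambdaSubring_closure_range`).
-/

noncomputable section

namespace PeakQSym

open Finset.HasAntidiagonal (antidiagonal mem_antidiagonal)

/-! ### Newton's recursion -/

/-- The sequences `ψ` and `l` satisfy Newton's recursion
`(n + 1) l_{n+1} = ∑_{i + j = n} (-1)^j l_i ψ_{j+1}` for `n < N`, with `l_0 = 1`. This is the relation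
between power sums and elementary symmetric functions, hence between Adams operations and
λ-operations. -/
def IsNewton {R : Type*} [CommRing R] (N : ℕ) (ψ l : ℕ → R) : Prop :=
  l 0 = 1 ∧ ∀ n < N, ((n + 1 : ℕ) : R) * l (n + 1) =
    ∑ ij ∈ antidiagonal n, (-1) ^ ij.2 * l ij.1 * ψ (ij.2 + 1)

section Newton

variable {R : Type*} [CommRing R]

theorem IsNewton.congr {N : ℕ} {ψ ψ' l l' : ℕ → R} (h : IsNewton N ψ l)
    (hψ : ∀ k, 0 < k → k ≤ N → ψ k = ψ' k) (hl : ∀ k ≤ N, l k = l' k) : IsNewton N ψ' l' := by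
  refine ⟨(hl 0 (Nat.zero_le _)).symm.trans h.1, fun n hn => ?_⟩
  rw [← hl _ hn, h.2 n hn]
  refine Finset.sum_congr rfl fun ij hij => ?_
  have := mem_antidiagonal.1 hij
  rw [hl _ (by omega), hψ _ (by omega) (by omega)]

theorem IsNewton.map {S : Type*} [CommRing S] (f : R →+* S) {N : ℕ} {ψ l : ℕ → R}
    (h : IsNewton N ψ l) : IsNewton N (fun k => f (ψ k)) (fun k => f (l k)) := by
  refine ⟨by simp [h.1], fun n hn => ?_⟩
  simpa using congrArg f (h.2 n hn)

theorem IsNewton.of_map {S : Type*} [CommRing S] (f : R →+* S) (hf : Function.Injective f) {N : ℕ}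
    {ψ l : ℕ → R} (h : IsNewton N (fun k => f (ψ k)) (fun k => f (l k))) : IsNewton N ψ l := by
  refine ⟨hf (by simpa using h.1), fun n hn => hf ?_⟩
  simpa using h.2 n hn

theorem eq_of_natCast_succ_mul_eq [IsAddTorsionFree R] (n : ℕ) {x y : R}
    (h : ((n + 1 : ℕ) : R) * x = ((n + 1 : ℕ) : R) * y) : x = y := by
  rw [← nsmul_eq_mul, ← nsmul_eq_mul] at h
  exact nsmul_right_injective (Nat.succ_ne_zero n) h

/-- In a torsion-free ring the sequence `ψ` determines `l`. -/
theorem IsNewton.unique [IsAddTorsionFree R] {N : ℕ} {ψ l ψ' l' : ℕ → R} (h : IsNewton N ψ l)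
    (h' : IsNewton N ψ' l') (hψ : ∀ k, 0 < k → k ≤ N → ψ k = ψ' k) : ∀ n ≤ N, l n = l' n := by
  intro n
  induction n using Nat.strong_induction_on with
  | _ n ih =>
    intro hn
    cases n with
    | zero => rw [h.1, h'.1]
    | succ n =>
      apply eq_of_natCast_succ_mul_eq n
      rw [h.2 n hn, h'.2 n hn]
      refine Finset.sum_congr rfl fun ij hij => ?_
      have := mem_antidiagonal.1 hij
      rw [ih _ (by omega) (by omega), hψ _ (by omega) (by omega)]

/-- The sequence `l` determines `ψ`, without any assumption on torsion. -/
theorem IsNewton.unique_psi {N : ℕ} {ψ l ψ' l' : ℕ → R} (h : IsNewton N ψ l)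
    (h' : IsNewton N ψ' l') (hl : ∀ k ≤ N, l k = l' k) : ∀ n, 0 < n → n ≤ N → ψ n = ψ' n := by
  intro n
  induction n using Nat.strong_induction_on with
  | _ n ih =>
    intro hn0 hn
    obtain ⟨n, rfl⟩ := Nat.exists_eq_succ_of_ne_zero hn0.ne'
    have e := h.2 n hn
    have hmem : (0, n) ∈ antidiagonal n := by simp
    rw [hl _ hn, h'.2 n hn, ← Finset.sum_erase_add _ _ hmem,
      ← Finset.sum_erase_add (f := fun ij => (-1) ^ ij.2 * l ij.1 * ψ (ij.2 + 1)) _ hmem] at e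
    have e2 : ∑ ij ∈ (antidiagonal n).erase (0, n), (-1) ^ ij.2 * l' ij.1 * ψ' (ij.2 + 1) =
        ∑ ij ∈ (antidiagonal n).erase (0, n), (-1) ^ ij.2 * l ij.1 * ψ (ij.2 + 1) := by
      refine Finset.sum_congr rfl fun ij hij => ?_
      obtain ⟨h1, h2⟩ := Finset.mem_erase.1 hij
      have h3 := mem_antidiagonal.1 h2
      have h4 : ij.1 ≠ 0 := fun h0 => h1 (Prod.ext h0 (by simpa [h0] using h3))
      rw [ih _ (by omega) (by omega) (by omega), hl _ (by omega)]
    rw [e2] at e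
    have e3 := add_left_cancel e
    simp only [h.1, h'.1, mul_one] at e3
    rcases neg_one_pow_eq_or R n with h5 | h5 <;> rw [h5] at e3
    · simpa using e3.symm
    · simpa using e3.symm

/-- Newton's identities for a finite family of elements. -/
theorem isNewton_esymm {σ : Type*} [Fintype σ] [Algebra ℤ R] (a : σ → R) (N : ℕ) :
    IsNewton N (fun k => ∑ i, a i ^ k) (fun k => MvPolynomial.aeval a (MvPolynomial.esymm σ ℤ k)) := by
  refine ⟨by simp, fun n _ => ?_⟩
  have h := congrArg (MvPolynomial.aeval a) (MvPolynomial.mul_esymm_eq_sum σ ℤ (n + 1))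
  rw [Finset.sum_filter, Finset.Nat.sum_antidiagonal_succ', if_neg (lt_irrefl _), zero_add,
    Finset.sum_congr rfl fun ij hij => if_pos (by have := mem_antidiagonal.1 hij; omega)] at h
  simp only [map_mul, map_natCast, map_pow, map_neg, map_one, map_sum,
    MvPolynomial.psum, MvPolynomial.aeval_X] at h
  rw [h, Finset.mul_sum]
  refine Finset.sum_congr rfl fun ij hij => ?_
  rw [← mem_antidiagonal.1 hij, ← mul_assoc, ← mul_assoc, ← pow_add]
  congr 2
  rw [show ij.1 + ij.2 + 1 + 1 + ij.1 = 2 * (ij.1 + 1) + ij.2 by ring, pow_add, pow_mul]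
  simp

/-- The generating series `∑_j (-1)^j ψ_{j+1} t^j`. -/
def psiSeries (ψ : ℕ → R) : PowerSeries R := PowerSeries.mk fun j => (-1) ^ j * ψ (j + 1)

/-- Newton's recursion for all `n` says that `∑_j (-1)^j ψ_{j+1} t^j` is the logarithmic derivative of
`∑_n l_n t^n`. -/
theorem isNewton_iff_derivative {ψ l : ℕ → R} :
    (∀ N, IsNewton N ψ l) ↔ l 0 = 1 ∧
      PowerSeries.derivative R (PowerSeries.mk l) = PowerSeries.mk l * psiSeries ψ := by
  have key : ∀ n, (((n + 1 : ℕ) : R) * l (n + 1) =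
        ∑ ij ∈ antidiagonal n, (-1) ^ ij.2 * l ij.1 * ψ (ij.2 + 1)) ↔
      PowerSeries.coeff n (PowerSeries.derivative R (PowerSeries.mk l)) =
        PowerSeries.coeff n (PowerSeries.mk l * psiSeries ψ) := by
    intro n
    rw [PowerSeries.coeff_derivative, PowerSeries.coeff_mul]
    simp only [PowerSeries.coeff_mk, psiSeries]
    rw [mul_comm, Nat.cast_succ]
    refine Eq.congr_right (Finset.sum_congr rfl fun ij _ => by ring)
  constructor
  · intro h
    exact ⟨(h 0).1, PowerSeries.ext fun n => (key n).1 ((h (n + 1)).2 n (Nat.lt_succ_self n))⟩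
  · rintro ⟨h0, h⟩ N
    exact ⟨h0, fun n _ => (key n).2 (by rw [h])⟩

theorem psiSeries_add (ψ ψ' : ℕ → R) :
    psiSeries (fun k => ψ k + ψ' k) = psiSeries ψ + psiSeries ψ' := by
  ext n
  simp [psiSeries, mul_add]

theorem psiSeries_neg (ψ : ℕ → R) : psiSeries (fun k => -ψ k) = -psiSeries ψ := by
  ext n
  simp [psiSeries]

/-- Logarithmic derivatives turn products into sums, so adding the `ψ` multiplies the generating series
of the `l`. -/
theorem isNewton_add {ψ l ψ' l' : ℕ → R} (h : ∀ N, IsNewton N ψ l) (h' : ∀ N, IsNewton N ψ' l')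
    (N : ℕ) : IsNewton N (fun k => ψ k + ψ' k)
      (fun n => ∑ ij ∈ antidiagonal n, l ij.1 * l' ij.2) := by
  obtain ⟨h0, h1⟩ := isNewton_iff_derivative.1 h
  obtain ⟨h0', h1'⟩ := isNewton_iff_derivative.1 h'
  refine isNewton_iff_derivative.2 ⟨by simp [h0, h0'], ?_⟩ N
  have e : (PowerSeries.mk fun n => ∑ ij ∈ antidiagonal n, l ij.1 * l' ij.2) =
      PowerSeries.mk l * PowerSeries.mk l' := by
    ext n
    simp [PowerSeries.coeff_mul]
  rw [e, Derivation.leibniz, h1, h1', psiSeries_add, smul_eq_mul, smul_eq_mul]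
  ring

theorem exists_isNewton_neg {ψ l : ℕ → R} (h : ∀ N, IsNewton N ψ l) :
    ∃ l' : ℕ → R, ∀ N, IsNewton N (fun k => -ψ k) l' := by
  obtain ⟨h0, h1⟩ := isNewton_iff_derivative.1 h
  set L := PowerSeries.mk l with hL
  have hc : PowerSeries.constantCoeff L = ((1 : Rˣ) : R) := by
    rw [← PowerSeries.coeff_zero_eq_constantCoeff_apply]; simp [hL, h0]
  set L' := PowerSeries.invOfUnit L 1 with hL'
  have hm : L * L' = 1 := PowerSeries.mul_invOfUnit L 1 hc
  refine ⟨fun n => PowerSeries.coeff n L', isNewton_iff_derivative.2 ⟨?_, ?_⟩⟩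
  · simp [hL', PowerSeries.coeff_zero_eq_constantCoeff_apply]
  · have e : (PowerSeries.mk fun n => PowerSeries.coeff n L') = L' := by ext n; simp
    rw [e, psiSeries_neg]
    have hd := congrArg (PowerSeries.derivative R) hm
    rw [Derivation.leibniz, h1, smul_eq_mul, smul_eq_mul, Derivation.map_one_eq_zero] at hd
    have : L' * (L * PowerSeries.derivative R L' + L' * (L * psiSeries ψ)) = 0 := by
      rw [hd, mul_zero]
    linear_combination this - (PowerSeries.derivative R L' + L' * psiSeries ψ) * hm

/-- An element all of whose Adams operations are its powers has `λ_t(x) = 1 + x t`. -/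
theorem isNewton_pow (x : R) (N : ℕ) :
    IsNewton N (fun k => x ^ k) (fun n => if n = 0 then 1 else if n = 1 then x else 0) := by
  refine ⟨by simp, fun n _ => ?_⟩
  cases n with
  | zero => simp
  | succ n =>
    rw [Finset.Nat.sum_antidiagonal_succ]
    cases n with
    | zero => simp; ring
    | succ n =>
      rw [Finset.Nat.sum_antidiagonal_succ]
      simp
      ring

end Newton

/-! ### The universal polynomials -/

section Universal

open MvPolynomial

theorem aeval_esymm_eq_sum {σ R : Type*} [Fintype σ] [CommRing R] [Algebra ℤ R] (a : σ → R) (k : ℕ) :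
    aeval a (esymm σ ℤ k) = ∑ t ∈ Finset.powersetCard k Finset.univ, ∏ i ∈ t, a i := by
  simp [esymm]

theorem coeff_prod_one_add_C_mul_X {σ R : Type*} [CommRing R] (s : Finset σ) (a : σ → R) (k : ℕ) :
    (∏ i ∈ s, (1 + Polynomial.C (a i) * Polynomial.X)).coeff k =
      ∑ t ∈ Finset.powersetCard k s, ∏ i ∈ t, a i := by
  classical
  rw [Finset.prod_one_add, Polynomial.finsetSum_coeff,
    ← Finset.sum_filter_add_sum_filter_not _ (fun t => t.card = k),
    ← Finset.powersetCard_eq_filter, Finset.sum_eq_zero (s := Finset.filter _ _), add_zero]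
  · refine Finset.sum_congr rfl fun t ht => ?_
    rw [Finset.prod_mul_distrib, Finset.prod_const, ← map_prod, (Finset.mem_powersetCard.1 ht).2,
      Polynomial.coeff_C_mul, Polynomial.coeff_X_pow_self, mul_one]
  · intro t ht
    rw [Finset.prod_mul_distrib, Finset.prod_const, ← map_prod, Polynomial.coeff_C_mul,
      Polynomial.coeff_X_pow, if_neg, mul_zero]
    exact fun h => (Finset.mem_filter.1 ht).2 h.symm

theorem coeff_prod_univ_one_add_C_mul_X {σ R : Type*} [Fintype σ] [CommRing R] [Algebra ℤ R]
    (a : σ → R) (k : ℕ) :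
    (∏ i, (1 + Polynomial.C (a i) * Polynomial.X)).coeff k = aeval a (esymm σ ℤ k) := by
  rw [coeff_prod_one_add_C_mul_X, aeval_esymm_eq_sum]

/-- The sequence `1, a_1, …, a_n, 0, 0, …`. -/
def extendSeq {R : Type*} [CommRing R] {n : ℕ} (a : Fin n → R) : ℕ → R
  | 0 => 1
  | k + 1 => if h : k < n then a ⟨k, h⟩ else 0

theorem map_extendSeq {R S : Type*} [CommRing R] [CommRing S] (f : R →+* S) {n : ℕ} (a : Fin n → R)
    (k : ℕ) : f (extendSeq a k) = extendSeq (fun i => f (a i)) k := by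
  cases k with
  | zero => simp [extendSeq]
  | succ k => by_cases h : k < n <;> simp [extendSeq, h]

theorem esymm_eq_zero_of_card_lt {σ R : Type*} [Fintype σ] [CommRing R] {k : ℕ}
    (h : Fintype.card σ < k) : esymm σ R k = 0 := by
  rw [esymm, Finset.powersetCard_eq_empty.2 (by simpa using h), Finset.sum_empty]

theorem extendSeq_esymm {R : Type*} [CommRing R] (n k : ℕ) :
    extendSeq (fun i : Fin n => esymm (Fin n) R (i + 1)) k = esymm (Fin n) R k := by
  cases k with
  | zero => simp [extendSeq]
  | succ k =>
    by_cases h : k < n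
    · simp [extendSeq, h]
    · simp only [extendSeq, h, dif_neg, not_false_eq_true]
      rw [esymm_eq_zero_of_card_lt (by simp; omega)]

theorem extendSeq_apply {R : Type*} [CommRing R] {l : ℕ → R} (h0 : l 0 = 1) {n k : ℕ} (hk : k ≤ n) :
    extendSeq (fun i : Fin n => l (i + 1)) k = l k := by
  cases k with
  | zero => simp [extendSeq, h0]
  | succ k => simp [extendSeq, Nat.lt_of_succ_le hk]

/-- Every symmetric polynomial in `n` variables is a polynomial in `e_1, …, e_n`. -/
theorem exists_aeval_esymm_eq {R : Type*} [CommRing R] {n : ℕ} {p : MvPolynomial (Fin n) R}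
    (hp : p.IsSymmetric) :
    ∃ q : MvPolynomial (Fin n) R, aeval (fun i : Fin n => esymm (Fin n) R (i + 1)) q = p := by
  obtain ⟨q, hq⟩ := esymmAlgHom_surjective (σ := Fin n) R (n := n) (by simp) ⟨p, hp⟩
  exact ⟨q, by rw [← esymmAlgHom_apply, hq]⟩

theorem algebraicIndependent_esymm (R : Type*) [CommRing R] (n : ℕ) :
    AlgebraicIndependent R fun i : Fin n => esymm (Fin n) R (i + 1) := by
  intro p q h
  apply esymmAlgHom_injective (σ := Fin n) R (n := n) (by simp)
  exact Subtype.ext (by rw [esymmAlgHom_apply, esymmAlgHom_apply]; exact h)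

/-- The elementary symmetric polynomials in two sets of variables. -/
abbrev esymmSum (n : ℕ) : Fin n ⊕ Fin n → MvPolynomial (Fin n ⊕ Fin n) ℤ :=
  Sum.elim
    (fun i : Fin n => rename Sum.inl (esymm (Fin n) ℤ (i + 1)))
    (fun i : Fin n => rename Sum.inr (esymm (Fin n) ℤ (i + 1)))

theorem algebraicIndependent_esymmSum (n : ℕ) : AlgebraicIndependent ℤ (esymmSum n) := by
  have h := (algebraicIndependent_esymm ℤ n).sumElim_comp
    (algebraicIndependent_esymm (MvPolynomial (Fin n) ℤ) n)
  have h' := h.map' (f := (sumAlgEquiv ℤ (Fin n) (Fin n)).symm.toAlgHom)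
    (sumAlgEquiv ℤ (Fin n) (Fin n)).symm.injective
  convert h' using 1
  have e1 : ∀ p : MvPolynomial (Fin n) ℤ,
      (sumAlgEquiv ℤ (Fin n) (Fin n)).symm (C p) = rename Sum.inr p := by
    intro p
    rw [AlgEquiv.symm_apply_eq]
    induction p using MvPolynomial.induction_on with
    | C a => simp
    | add p q hp hq => rw [map_add, map_add, map_add, hp, hq]
    | mul_X p i hp => rw [map_mul, map_mul, map_mul, ← hp]; simp
  have e2 : ∀ i : Fin n, (sumAlgEquiv ℤ (Fin n) (Fin n)).symm (X i) = X (Sum.inl i) := by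
    intro i
    rw [AlgEquiv.symm_apply_eq]
    simp
  funext i
  rcases i with i | i
  · simp only [Sum.elim_inl, Function.comp_apply, esymm, map_sum, map_prod, rename_X]
    simp [e2]
  · simp only [Sum.elim_inr, Function.comp_apply, algebraMap_eq]
    exact (e1 _).symm

/-- **Cauchy's expansion**: the coefficients of `∏_{i,j} (1 + x_i y_j t)` are polynomials in the
elementary symmetric functions of `x` and of `y`. -/
theorem exists_aeval_esymmSum_eq (n k : ℕ) :
    ∃ P : MvPolynomial (Fin n ⊕ Fin n) ℤ, aeval (esymmSum n) P = aeval (fun ij : Fin n × Fin n =>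
      (X (Sum.inl ij.1) * X (Sum.inr ij.2) : MvPolynomial (Fin n ⊕ Fin n) ℤ))
        (esymm (Fin n × Fin n) ℤ k) := by
  -- in `∏_i (∑_j b_j x_i^j t^j)` the elementary symmetric functions of `y` are replaced by variables
  let G : Polynomial (MvPolynomial (Fin n) (MvPolynomial (Fin n) ℤ)) := ∏ i : Fin n, ∑ j ∈ Finset.range (n + 1),
    Polynomial.monomial j (C (extendSeq X j) * X i ^ j)
  have hsym : (G.coeff k).IsSymmetric := by
    intro e
    have h1 : rename e (G.coeff k) = (G.map (rename e).toRingHom).coeff k :=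
      (Polynomial.coeff_map _ _).symm
    rw [h1]
    congr 1
    simp only [G, Polynomial.map_prod, Polynomial.map_sum, Polynomial.map_monomial]
    rw [← Equiv.prod_comp e fun i => ∑ j ∈ Finset.range (n + 1),
      Polynomial.monomial j ((C (extendSeq X j) * X i ^ j :
        MvPolynomial (Fin n) (MvPolynomial (Fin n) ℤ)))]
    simp
  obtain ⟨q, hq⟩ := exists_aeval_esymm_eq hsym
  -- `H` puts the elementary symmetric functions of `y` back in place of the coefficient variables
  let h : MvPolynomial (Fin n) ℤ →+* MvPolynomial (Fin n ⊕ Fin n) ℤ :=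
    (aeval fun i : Fin n => rename Sum.inr (esymm (Fin n) ℤ (i + 1))).toRingHom
  let H : MvPolynomial (Fin n) (MvPolynomial (Fin n) ℤ) →+* MvPolynomial (Fin n ⊕ Fin n) ℤ :=
    eval₂Hom h fun i => X (Sum.inl i)
  refine ⟨(sumRingEquiv ℤ (Fin n) (Fin n)).symm q, ?_⟩
  have h1 : aeval (esymmSum n) ((sumRingEquiv ℤ (Fin n) (Fin n)).symm q) =
      eval₂Hom h (fun i : Fin n => rename Sum.inl (esymm (Fin n) ℤ (i + 1))) q := by
    clear hq
    obtain ⟨p, rfl⟩ := (sumRingEquiv ℤ (Fin n) (Fin n)).surjective q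
    rw [RingEquiv.symm_apply_apply]
    induction p using MvPolynomial.induction_on with
    | C a => simp [h]
    | add p q hp hq => rw [map_add, map_add, map_add, hp, hq]
    | mul_X p i hp =>
      rw [map_mul, map_mul, map_mul, ← hp]
      rcases i with i | i <;> simp [h]
  have h2 : eval₂Hom h (fun i : Fin n => rename Sum.inl (esymm (Fin n) ℤ (i + 1))) q =
      H (aeval (fun i : Fin n => esymm (Fin n) (MvPolynomial (Fin n) ℤ) (i + 1)) q) := by
    rw [aeval_def, ← coe_eval₂Hom, ← RingHom.comp_apply]
    congr 1
    apply MvPolynomial.ringHom_ext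
    · intro r
      simp [H]
    · intro i
      simp [H, esymm]
  rw [h1, h2, hq]
  have h3 : H (G.coeff k) = (G.map H).coeff k := (Polynomial.coeff_map _ _).symm
  rw [h3, ← coeff_prod_univ_one_add_C_mul_X, Fintype.prod_prod_type]
  congr 1
  simp only [G, Polynomial.map_prod, Polynomial.map_sum, Polynomial.map_monomial]
  refine Finset.prod_congr rfl fun i _ => ?_
  ext1 m
  have h4 : ∀ j : ℕ, H (C (extendSeq X j) * X i ^ j) =
      rename Sum.inr (esymm (Fin n) ℤ j) * X (Sum.inl i) ^ j := by
    intro j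
    rw [map_mul, map_pow]
    congr 1
    · simp only [H, coe_eval₂Hom, eval₂_C]
      rw [map_extendSeq, ← extendSeq_esymm, ← AlgHom.coe_toRingHom, map_extendSeq]
      simp [h]
    · simp [H]
  simp only [h4]
  rw [coeff_prod_univ_one_add_C_mul_X, Polynomial.finsetSum_coeff]
  simp only [Polynomial.coeff_monomial]
  have h5 : aeval (fun j : Fin n => (X (Sum.inl i) * X (Sum.inr j) :
      MvPolynomial (Fin n ⊕ Fin n) ℤ)) (esymm (Fin n) ℤ m) =
        rename Sum.inr (esymm (Fin n) ℤ m) * X (Sum.inl i) ^ m := by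
    rw [aeval_esymm_eq_sum, esymm, map_sum, Finset.sum_mul]
    refine Finset.sum_congr rfl fun t ht => ?_
    rw [Finset.prod_mul_distrib, Finset.prod_const, (Finset.mem_powersetCard.1 ht).2, map_prod,
      mul_comm]
    simp
  rw [h5]
  by_cases hm : m < n + 1
  · rw [Finset.sum_eq_single m]
    · simp
    · intro j _ hj
      rw [if_neg hj]
    · intro h
      exact absurd (Finset.mem_range.2 hm) h
  · rw [esymm_eq_zero_of_card_lt (k := m) (by simp; omega), map_zero, zero_mul]
    refine Finset.sum_eq_zero fun j hj => if_neg ?_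
    have := Finset.mem_range.1 hj
    omega

end Universal

/-! ### λ-rings from Adams operations -/

/-- Commuting ring endomorphisms `Ψ^k`, for `k ≥ 1`, of a commutative ring, together with operations
`λ^n` related to them by Newton's recursion. (The endomorphism at `k = 0` has no meaning.) -/
structure AdamsStructure (R : Type*) [CommRing R] where
  /-- the ring endomorphism `Ψ^k` -/
  psi : ℕ → R →+* R
  psi_one : ∀ x, psi 1 x = x
  psi_psi : ∀ k l, 0 < k → 0 < l → ∀ x, psi k (psi l x) = psi (k * l) x
  /-- the operation `λ^n` -/
  lam : ℕ → R → R
  newton : ∀ N x, IsNewton N (fun k => psi k x) (fun n => lam n x)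

namespace AdamsStructure

variable {R : Type*} [CommRing R] (A : AdamsStructure R)

theorem lam_zero (x : R) : A.lam 0 x = 1 := (A.newton 0 x).1

section TorsionFree

variable [IsAddTorsionFree R]

theorem psi_lam (k : ℕ) (hk : 0 < k) (n : ℕ) (x : R) :
    A.psi k (A.lam n x) = A.lam n (A.psi k x) := by
  refine IsNewton.unique ((A.newton n x).map (A.psi k)) (A.newton n (A.psi k x)) ?_ n le_rfl
  intro l hl _
  rw [A.psi_psi k l hk hl, A.psi_psi l k hl hk, mul_comm]

section Mul

open MvPolynomial

/-- The product law. Newton's recursion expresses both sides through `Ψ^k(x y) = Ψ^k(x) Ψ^k(y)`; for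
the universal polynomials this is the multiplicativity of power sums, which can be checked after
evaluating at elementary symmetric polynomials, as these are algebraically independent. -/
theorem lam_mul (n : ℕ) : ∃ P, IsUniversalMul n P ∧ ∀ x y, A.lam n (x * y) =
    aeval (Sum.elim (fun i : Fin n => A.lam (i + 1) x) (fun i : Fin n => A.lam (i + 1) y)) P := by
  choose P hP using exists_aeval_esymmSum_eq n
  choose p hp using fun k => exists_aeval_esymm_eq (psum_isSymmetric (Fin n) ℤ k)
  have hinj : Function.Injective (aeval (esymmSum n) : _ →ₐ[ℤ] MvPolynomial (Fin n ⊕ Fin n) ℤ) :=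
    algebraicIndependent_esymmSum n
  refine ⟨P n, ?_, fun x y => ?_⟩
  · unfold IsUniversalMul
    rw [hP, ← Fintype.prod_prod_type', coeff_prod_univ_one_add_C_mul_X]
  have hpl : ∀ k, aeval (esymmSum n) (rename Sum.inl (p k)) = rename Sum.inl (psum (Fin n) ℤ k) := by
    intro k
    rw [aeval_rename, ← hp k, ← AlgHom.comp_apply, comp_aeval]
    rfl
  have hpr : ∀ k, aeval (esymmSum n) (rename Sum.inr (p k)) = rename Sum.inr (psum (Fin n) ℤ k) := by
    intro k
    rw [aeval_rename, ← hp k, ← AlgHom.comp_apply, comp_aeval]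
    rfl
  -- Newton's recursion for each set of variables, expressed in the elementary symmetric functions
  have newton_esymm : ∀ ι : Fin n → Fin n ⊕ Fin n, IsNewton n
      (fun k => rename ι (psum (Fin n) ℤ k)) (fun k => rename ι (esymm (Fin n) ℤ k)) := by
    intro ι
    refine (isNewton_esymm (fun i => (X (ι i) : MvPolynomial (Fin n ⊕ Fin n) ℤ)) n).congr
      (fun k _ _ => ?_) (fun k _ => ?_)
    · simp [psum]
    · rw [aeval_esymm_eq_sum]
      simp [esymm]
  have hl : IsNewton n (fun k => rename Sum.inl (p k))
      (extendSeq fun i : Fin n => (X (Sum.inl i) : MvPolynomial (Fin n ⊕ Fin n) ℤ)) := by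
    refine IsNewton.of_map (aeval (esymmSum n)).toRingHom hinj ?_
    refine (newton_esymm Sum.inl).congr (fun k _ _ => (hpl k).symm) (fun k _ => ?_)
    rw [map_extendSeq, ← extendSeq_esymm, ← AlgHom.coe_toRingHom, map_extendSeq]
    simp
  have hr : IsNewton n (fun k => rename Sum.inr (p k))
      (extendSeq fun i : Fin n => (X (Sum.inr i) : MvPolynomial (Fin n ⊕ Fin n) ℤ)) := by
    refine IsNewton.of_map (aeval (esymmSum n)).toRingHom hinj ?_
    refine (newton_esymm Sum.inr).congr (fun k _ _ => (hpr k).symm) (fun k _ => ?_)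
    rw [map_extendSeq, ← extendSeq_esymm, ← AlgHom.coe_toRingHom, map_extendSeq]
    simp
  have hlr : IsNewton n (fun k => rename Sum.inl (p k) * rename Sum.inr (p k)) P := by
    refine IsNewton.of_map (aeval (esymmSum n)).toRingHom hinj ?_
    refine (isNewton_esymm (fun ij : Fin n × Fin n =>
      (X (Sum.inl ij.1) * X (Sum.inr ij.2) : MvPolynomial (Fin n ⊕ Fin n) ℤ)) n).congr
      (fun k _ _ => ?_) (fun k _ => (hP k).symm)
    change _ = aeval (esymmSum n) _
    rw [map_mul, hpl, hpr]
    simp [psum, Fintype.sum_prod_type, Finset.sum_mul_sum, mul_pow]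
  set ev := aeval (R := ℤ) (Sum.elim (fun i : Fin n => A.lam (i + 1) x)
    (fun i : Fin n => A.lam (i + 1) y)) with hev
  have el := (hl.map ev.toRingHom).unique_psi (A.newton n x) fun k hk => by
    simp only [map_extendSeq]
    simpa [hev] using extendSeq_apply (l := fun k => A.lam k x) (A.lam_zero x) hk
  have er := (hr.map ev.toRingHom).unique_psi (A.newton n y) fun k hk => by
    simp only [map_extendSeq]
    simpa [hev] using extendSeq_apply (l := fun k => A.lam k y) (A.lam_zero y) hk
  refine IsNewton.unique (A.newton n (x * y)) (hlr.map ev.toRingHom) (fun k hk hkn => ?_) n le_rfl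
  rw [map_mul, map_mul, el k hk hkn, er k hk hkn]

/-- The composition law. As in `lam_mul`, it is checked on Adams operations: `Ψ^i(λ^n(x))` is obtained
from the `Ψ^{i j}(x)` by Newton's recursion, just as the `n`-th elementary symmetric polynomial of the
`i`-th powers of the variables is obtained from the power sums of degrees `i j`. -/
theorem lam_comp (m n : ℕ) : ∃ P, IsUniversalComp m n P ∧ ∀ x,
    A.lam m (A.lam n x) = aeval (fun i : Fin (m * n) => A.lam (i + 1) x) P := by
  set N := m * n with hN
  let Z := MvPolynomial (Fin N) ℤ
  let a : Finset.powersetCard n (Finset.univ : Finset (Fin N)) → Z := fun S => ∏ i ∈ S.1, X i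
  have hinj : Function.Injective
      (aeval (fun i : Fin N => esymm (Fin N) ℤ (i + 1)) : _ →ₐ[ℤ] Z) :=
    algebraicIndependent_esymm ℤ N
  set E := (aeval (fun i : Fin N => esymm (Fin N) ℤ (i + 1)) : Z →ₐ[ℤ] Z) with hE
  have hsymP : ∀ k, ((∏ S ∈ Finset.powersetCard n (Finset.univ : Finset (Fin N)),
      (1 + Polynomial.C (∏ i ∈ S, X i : Z) * Polynomial.X)).coeff k).IsSymmetric := by
    intro k e
    refine (Polynomial.coeff_map (rename e).toRingHom k).symm.trans ?_
    congr 1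
    rw [Polynomial.map_prod]
    refine Finset.prod_bij (fun S _ => S.map e.toEmbedding) ?_ ?_ ?_ ?_
    · intro S hS
      simpa [Finset.mem_powersetCard] using hS
    · intro S _ S' _ h
      exact Finset.map_injective _ h
    · intro S hS
      refine ⟨S.map e.symm.toEmbedding, by simpa [Finset.mem_powersetCard] using hS, ?_⟩
      ext i
      simp
    · intro S _
      simp [Polynomial.map_prod]
  have hsymG : ∀ i j, (aeval (fun t => (X t ^ i : Z)) (esymm (Fin N) ℤ j)).IsSymmetric := by
    intro i j e
    rw [aeval_esymm_eq_sum, ← coeff_prod_one_add_C_mul_X]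
    refine (Polynomial.coeff_map (rename e).toRingHom j).symm.trans ?_
    congr 1
    rw [Polynomial.map_prod]
    refine Fintype.prod_equiv e _ _ fun t => ?_
    simp
  choose P hP using fun k => exists_aeval_esymm_eq (hsymP k)
  choose G hG using fun i j => exists_aeval_esymm_eq (hsymG i j)
  choose p hp using fun k => exists_aeval_esymm_eq (psum_isSymmetric (Fin N) ℤ k)
  refine ⟨P m, hP m, fun x => ?_⟩
  -- `p k` expresses the power sum `p_k`, and `G i j` the polynomial `e_j` of the `i`-th powers
  have hx : IsNewton N p (extendSeq X) := by
    refine IsNewton.of_map E.toRingHom hinj ?_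
    refine (isNewton_esymm (fun i => (X i : Z)) N).congr
      (fun k _ _ => (hp k).symm) (fun k _ => ?_)
    rw [map_extendSeq]
    simp only [AlgHom.toRingHom_eq_coe, RingHom.coe_coe, hE, aeval_X]
    rw [extendSeq_esymm, aeval_X_left_apply]
  have hGn : ∀ i, IsNewton n (fun j => p (i * j)) (G i) := by
    intro i
    refine IsNewton.of_map E.toRingHom hinj ?_
    refine (isNewton_esymm (fun t => (X t ^ i : Z)) n).congr
      (fun k _ _ => ?_) (fun k _ => (hG i k).symm)
    refine Eq.trans ?_ (hp (i * k)).symm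
    simp [psum, pow_mul]
  have hPn : IsNewton m (fun i => G i n) P := by
    refine IsNewton.of_map E.toRingHom hinj ?_
    refine (isNewton_esymm a m).congr (fun k _ _ => ?_) (fun k _ => ?_)
    · refine Eq.trans ?_ (hG k n).symm
      rw [aeval_esymm_eq_sum]
      simp only [a, Finset.prod_pow]
      exact Finset.sum_coe_sort _ fun S : Finset (Fin N) => (∏ i ∈ S, X i : Z) ^ k
    · refine Eq.trans ?_ (hP k).symm
      rw [← coeff_prod_univ_one_add_C_mul_X]
      exact congrArg (Polynomial.coeff · k) (Finset.prod_coe_sort _ fun S : Finset (Fin N) =>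
        1 + Polynomial.C (∏ i ∈ S, X i : Z) * Polynomial.X)
  set ev := aeval (R := ℤ) (fun i : Fin N => A.lam (i + 1) x) with hev
  have e1 := (hx.map ev.toRingHom).unique_psi (A.newton N x) fun k hk => by
    simp only [map_extendSeq]
    simpa [hev] using extendSeq_apply (l := fun k => A.lam k x) (A.lam_zero x) hk
  have e2 : ∀ i, 0 < i → i ≤ m → ev (G i n) = A.psi i (A.lam n x) := by
    intro i hi him
    rw [A.psi_lam i hi]
    refine IsNewton.unique ((hGn i).map ev.toRingHom) (A.newton n (A.psi i x))
      (fun j hj hjn => ?_) n le_rfl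
    rw [e1 _ (Nat.mul_pos hi hj) (Nat.mul_le_mul him hjn), A.psi_psi j i hj hi, mul_comm]
  exact IsNewton.unique (A.newton m (A.lam n x)) (hPn.map ev.toRingHom)
    (fun k hk hkm => (e2 k hk hkm).symm) m le_rfl

end Mul

/-- The λ-ring structure on a torsion-free ring defined by Adams operations. -/
def toLambda : LambdaStructure R where
  lam := A.lam
  lam_zero := A.lam_zero
  lam_one x := by
    have := (A.newton 1 x).2 0 zero_lt_one
    simpa [A.psi_one, A.lam_zero] using this
  lam_add n x y := by
    refine IsNewton.unique (A.newton n (x + y))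
      (isNewton_add (fun N => A.newton N x) (fun N => A.newton N y) n) ?_ n le_rfl
    intro k _ _
    exact map_add _ _ _
  lam_of_one n hn := by
    have h := IsNewton.unique (A.newton n 1) (isNewton_pow 1 n) (fun k _ _ => by simp) n le_rfl
    rw [if_neg (by omega), if_neg (by omega)] at h
    exact h
  lam_mul := A.lam_mul
  lam_comp := A.lam_comp

theorem adams_toLambda (k : ℕ) (hk : 0 < k) (x : R) : A.toLambda.adams k x = A.psi k x := by
  obtain ⟨k, rfl⟩ := Nat.exists_eq_add_of_lt hk
  obtain ⟨h0, h1⟩ := isNewton_iff_derivative.1 fun N => A.newton N x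
  have hs : A.toLambda.series x = PowerSeries.mk fun n => A.lam n x := rfl
  have hc : PowerSeries.constantCoeff (A.toLambda.series x) = ((1 : Rˣ) : R) := by
    rw [← PowerSeries.coeff_zero_eq_constantCoeff_apply]
    simp [hs, A.lam_zero]
  rw [LambdaStructure.adams, hs, h1, ← hs, mul_right_comm, PowerSeries.mul_invOfUnit _ _ hc, one_mul]
  simp only [zero_add, Nat.add_sub_cancel, psiSeries, PowerSeries.coeff_mk, ← mul_assoc, ← mul_pow]
  simp

end TorsionFree

end AdamsStructure

/-! ### λ-subrings -/

namespace LambdaStructure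

variable {R : Type*} [CommRing R] (L : LambdaStructure R)

theorem lam_succ_zero (m : ℕ) : L.lam (m + 1) 0 = 0 := by
  induction m using Nat.strong_induction_on with
  | _ m ih =>
    have e := L.lam_add (m + 1) 0 0
    rw [add_zero, Finset.Nat.sum_antidiagonal_succ, L.lam_zero, one_mul,
      Finset.sum_eq_single (m, 0)] at e
    · simpa [L.lam_zero] using e
    · rintro ⟨i, j⟩ hij hne
      have h := mem_antidiagonal.1 hij
      simp only [ne_eq, Prod.mk.injEq] at h hne
      rw [ih i (by omega), zero_mul]
    · simp

/-- The recursion `∑ λ^i(x) λ^j(-x) = 0` expresses `λ^n(-x)` through the `λ^i(x)`. -/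
theorem lam_neg_mem {S : Subring R} {x : R} (h : ∀ n, L.lam n x ∈ S) (n : ℕ) :
    L.lam n (-x) ∈ S := by
  induction n using Nat.strong_induction_on with
  | _ n ih =>
    cases n with
    | zero => rw [L.lam_zero]; exact S.one_mem
    | succ n =>
      have e := L.lam_add (n + 1) x (-x)
      rw [add_neg_cancel, lam_succ_zero, Finset.Nat.sum_antidiagonal_succ, L.lam_zero, one_mul] at e
      rw [eq_neg_of_add_eq_zero_left e.symm]
      refine S.neg_mem (S.sum_mem fun ij hij => S.mul_mem (h _) (ih _ ?_))
      have := mem_antidiagonal.1 hij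
      omega

theorem aeval_mem_subring {σ : Type*} {S : Subring R} {a : σ → R} (h : ∀ i, a i ∈ S)
    (P : MvPolynomial σ ℤ) : MvPolynomial.aeval a P ∈ S := by
  induction P using MvPolynomial.induction_on with
  | C z => rw [MvPolynomial.aeval_C]; exact intCast_mem S z
  | add p q hp hq => rw [map_add]; exact S.add_mem hp hq
  | mul_X p i hp => rw [map_mul, MvPolynomial.aeval_X]; exact S.mul_mem hp (h i)

/-- It suffices to test on generators whether a subring is a λ-subring. -/
theorem isLambdaSubring_closure {s : Set R} (h : ∀ n, ∀ x ∈ s, L.lam n x ∈ Subring.closure s) :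
    L.IsLambdaSubring (Subring.closure s) := by
  intro n x hx
  induction hx using Subring.closure_induction generalizing n with
  | mem x hx => exact h n x hx
  | zero =>
    cases n with
    | zero => rw [L.lam_zero]; exact one_mem _
    | succ n => rw [lam_succ_zero]; exact zero_mem _
  | one =>
    rcases n with _ | _ | n
    · rw [L.lam_zero]; exact one_mem _
    · rw [zero_add, L.lam_one]; exact one_mem _
    · rw [L.lam_of_one _ (by omega)]; exact zero_mem _
  | add x y _ _ hx hy =>
    rw [L.lam_add]
    exact sum_mem fun ij _ => mul_mem (hx _) (hy _)
  | neg x _ hx => exact L.lam_neg_mem hx n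
  | mul x y _ _ hx hy =>
    obtain ⟨P, -, hP⟩ := L.lam_mul n
    rw [hP]
    exact aeval_mem_subring (by rintro (i | i); exacts [hx _, hy _]) P

/-- The subring generated by the `λ^n(x)` is a λ-subring, because `λ^m(λ^n(x))` is a polynomial in
the `λ^i(x)`. -/
theorem isLambdaSubring_closure_range (x : R) :
    L.IsLambdaSubring (Subring.closure {y | ∃ n, 1 ≤ n ∧ y = L.lam n x}) := by
  refine L.isLambdaSubring_closure ?_
  rintro m _ ⟨n, -, rfl⟩
  obtain ⟨P, -, hP⟩ := L.lam_comp m n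
  rw [hP]
  refine aeval_mem_subring (fun i => ?_) P
  exact Subring.subset_closure ⟨i + 1, by omega, rfl⟩

end LambdaStructure

/-! ### The λ-ring structure on power series and on `QSym` -/

/-- The substitution `x_i ↦ x_i^k` for `k ≥ 1`; the value at `k = 0` is the identity. -/
def psiSer (k : ℕ) : Series →+* Series :=
  if h : k ≠ 0 then (MvPowerSeries.expand k h : Series →ₐ[ℤ] Series).toRingHom else RingHom.id _

theorem psiSer_of_pos {k : ℕ} (hk : 0 < k) (f : Series) :
    psiSer k f = MvPowerSeries.expand k hk.ne' f := by
  rw [psiSer, dif_pos hk.ne']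
  rfl

theorem coeff_smul_psiSer {k : ℕ} (hk : 0 < k) (d : ℕ →₀ ℕ) (f : Series) :
    MvPowerSeries.coeff (k • d) (psiSer k f) = MvPowerSeries.coeff d f := by
  rw [psiSer_of_pos hk, MvPowerSeries.coeff_expand_smul]

theorem coeff_psiSer_of_not_dvd {k : ℕ} (hk : 0 < k) {d : ℕ →₀ ℕ} {i : ℕ} (h : ¬ k ∣ d i)
    (f : Series) : MvPowerSeries.coeff d (psiSer k f) = 0 := by
  rw [psiSer_of_pos hk, MvPowerSeries.coeff_expand_of_not_dvd k hk.ne' f h]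

theorem exists_eq_smul_of_dvd {k : ℕ} {σ : Type*} {d : σ →₀ ℕ} (h : ∀ i, k ∣ d i) :
    ∃ e : σ →₀ ℕ, d = k • e :=
  ⟨d.mapRange (· / k) (Nat.zero_div k), by ext i; simp [Nat.mul_div_cancel' (h i)]⟩

theorem psiSer_one (f : Series) : psiSer 1 f = f := by
  rw [psiSer_of_pos one_pos, MvPowerSeries.expand_one_apply]

theorem psiSer_psiSer (k l : ℕ) (hk : 0 < k) (hl : 0 < l) (f : Series) :
    psiSer k (psiSer l f) = psiSer (k * l) f := by
  rw [psiSer_of_pos hk, psiSer_of_pos hl, psiSer_of_pos (Nat.mul_pos hk hl),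
    MvPowerSeries.expand_mul k hk.ne' l hl.ne']

/-- `f` and `g` have the same coefficients at the exponents `e ≤ d`. -/
def EqUpTo (d : ℕ →₀ ℕ) (f g : Series) : Prop :=
  ∀ e ≤ d, MvPowerSeries.coeff e f = MvPowerSeries.coeff e g

theorem EqUpTo.mul {d : ℕ →₀ ℕ} {f f' g g' : Series} (hf : EqUpTo d f f') (hg : EqUpTo d g g') :
    EqUpTo d (f * g) (f' * g') := by
  classical
  intro e he
  rw [MvPowerSeries.coeff_mul, MvPowerSeries.coeff_mul]
  refine Finset.sum_congr rfl fun p hp => ?_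
  have h := mem_antidiagonal.1 hp
  rw [hf _ ((le_self_add.trans h.le).trans he), hg _ ((le_add_self.trans h.le).trans he)]

theorem EqUpTo.psiSer {d : ℕ →₀ ℕ} {f g : Series} (h : EqUpTo d f g) {k : ℕ} (hk : 0 < k) :
    EqUpTo d (psiSer k f) (psiSer k g) := by
  intro e he
  by_cases hd : ∀ i, k ∣ e i
  · obtain ⟨e, rfl⟩ := exists_eq_smul_of_dvd hd
    rw [coeff_smul_psiSer hk, coeff_smul_psiSer hk]
    exact h e (le_trans (fun i => Nat.le_mul_of_pos_left _ hk) he)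
  · obtain ⟨i, hi⟩ := not_forall.1 hd
    rw [coeff_psiSer_of_not_dvd hk hi, coeff_psiSer_of_not_dvd hk hi]

/-- The operations `λ^n` on power series, obtained from `Ψ^k` by Newton's recursion; the division by
`n + 1` is carried out on each coefficient, and is shown to be exact in `newton_lamSer`. -/
def lamSer (f : Series) : ℕ → Series
  | 0 => 1
  | n + 1 => fun d => MvPowerSeries.coeff d
      (∑ i : Fin (n + 1), (-1) ^ (n - i) * lamSer f i * psiSer (n - i + 1) f) / ((n + 1 : ℕ) : ℤ)

theorem coeff_lamSer_succ (f : Series) (n : ℕ) (d : ℕ →₀ ℕ) :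
    MvPowerSeries.coeff d (lamSer f (n + 1)) = MvPowerSeries.coeff d
      (∑ ij ∈ antidiagonal n, (-1) ^ ij.2 * lamSer f ij.1 * psiSer (ij.2 + 1) f) /
        ((n + 1 : ℕ) : ℤ) := by
  rw [Finset.Nat.sum_antidiagonal_eq_sum_range_succ_mk, ← Fin.sum_univ_eq_sum_range
    (fun i => (-1) ^ (n - i) * lamSer f i * psiSer (n - i + 1) f), MvPowerSeries.coeff_apply, lamSer]

theorem EqUpTo.lamSer_sum {d : ℕ →₀ ℕ} {f g : Series} (h : EqUpTo d f g) {n : ℕ}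
    (hl : ∀ i ≤ n, EqUpTo d (lamSer f i) (lamSer g i)) :
    EqUpTo d (∑ ij ∈ antidiagonal n, (-1) ^ ij.2 * lamSer f ij.1 * PeakQSym.psiSer (ij.2 + 1) f)
      (∑ ij ∈ antidiagonal n, (-1) ^ ij.2 * lamSer g ij.1 * PeakQSym.psiSer (ij.2 + 1) g) := by
  intro e he
  rw [map_sum, map_sum]
  refine Finset.sum_congr rfl fun ij hij => ?_
  have := mem_antidiagonal.1 hij
  exact EqUpTo.mul (EqUpTo.mul (fun _ _ => rfl) (hl _ (by omega))) (h.psiSer (Nat.succ_pos _)) e he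

theorem EqUpTo.lamSer {d : ℕ →₀ ℕ} {f g : Series} (h : EqUpTo d f g) (n : ℕ) :
    EqUpTo d (lamSer f n) (lamSer g n) := by
  induction n using Nat.strong_induction_on with
  | _ n ih =>
    cases n with
    | zero => rw [PeakQSym.lamSer, PeakQSym.lamSer]; exact fun _ _ => rfl
    | succ n =>
      intro e he
      rw [coeff_lamSer_succ, coeff_lamSer_succ,
        h.lamSer_sum (fun i hi => ih i (Nat.lt_succ_of_le hi)) e he]

theorem coeff_natCast_mul (n : ℕ) (d : ℕ →₀ ℕ) (f : Series) :
    MvPowerSeries.coeff d ((n : Series) * f) = n * MvPowerSeries.coeff d f := by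
  rw [← nsmul_eq_mul, map_nsmul, nsmul_eq_mul]

theorem lamSer_eq_of_isNewton {f : Series} {l : ℕ → Series}
    (h : ∀ N, IsNewton N (fun k => psiSer k f) l) (n : ℕ) : lamSer f n = l n := by
  induction n using Nat.strong_induction_on with
  | _ n ih =>
    cases n with
    | zero => rw [(h 0).1, lamSer]
    | succ n =>
      ext d
      have e : ∑ ij ∈ antidiagonal n, (-1) ^ ij.2 * lamSer f ij.1 * psiSer (ij.2 + 1) f =
          ∑ ij ∈ antidiagonal n, (-1) ^ ij.2 * l ij.1 * psiSer (ij.2 + 1) f := by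
        refine Finset.sum_congr rfl fun ij hij => ?_
        have := mem_antidiagonal.1 hij
        rw [ih _ (by omega)]
      rw [coeff_lamSer_succ, e, ← (h (n + 1)).2 n (Nat.lt_succ_self n), coeff_natCast_mul,
        Int.mul_ediv_cancel_left]
      exact_mod_cast Nat.succ_ne_zero n

/-- The power series on which Newton's recursion can be solved; by `newton_lamSer` these are in fact
all power series. -/
def newtonSubgroup : AddSubgroup Series where
  carrier := {f | ∃ l : ℕ → Series, ∀ N, IsNewton N (fun k => psiSer k f) l}
  zero_mem' := ⟨fun n => if n = 0 then 1 else 0, fun N => by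
    refine (isNewton_pow 0 N).congr (fun k hk _ => ?_) (fun k _ => ?_)
    · rw [map_zero, zero_pow hk.ne']
    · rcases k with _ | _ | k <;> simp⟩
  add_mem' := by
    rintro f g ⟨l, hl⟩ ⟨l', hl'⟩
    refine ⟨_, fun N => (isNewton_add hl hl' N).congr (fun k _ _ => ?_) (fun _ _ => rfl)⟩
    rw [map_add]
  neg_mem' := by
    rintro f ⟨l, hl⟩
    obtain ⟨l', hl'⟩ := exists_isNewton_neg hl
    refine ⟨l', fun N => (hl' N).congr (fun k _ _ => ?_) (fun _ _ => rfl)⟩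
    rw [map_neg]

/-- Polynomials are sums of monomials and negatives of monomials, and on a monomial `Ψ^k` is the `k`-th
power. -/
theorem coe_mem_newtonSubgroup (p : MvPolynomial ℕ ℤ) : (p : Series) ∈ newtonSubgroup := by
  induction p using MvPolynomial.induction_on' with
  | monomial d c =>
    have h : ((MvPolynomial.monomial d c : MvPolynomial ℕ ℤ) : Series) =
        c • MvPowerSeries.monomial d (1 : ℤ) := by
      rw [MvPolynomial.coe_monomial, ← map_zsmul, smul_eq_mul, mul_one]
    rw [h]
    refine zsmul_mem ?_ c
    refine ⟨_, fun N => (isNewton_pow (MvPowerSeries.monomial d (1 : ℤ) : Series) N).congr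
      (fun k hk _ => ?_) (fun _ _ => rfl)⟩
    rw [psiSer_of_pos hk, MvPowerSeries.expand_monomial, MvPowerSeries.monomial_pow, one_pow]
  | add p q hp hq => rw [MvPolynomial.coe_add]; exact add_mem hp hq

/-- Newton's recursion can be solved over the integers for every power series. -/
theorem newton_lamSer (N : ℕ) (f : Series) : IsNewton N (fun k => psiSer k f) (lamSer f) := by
  refine ⟨by rw [lamSer], fun n hn => ?_⟩
  ext d
  -- up to `d`, the series `f` is a polynomial, and there the division is exact
  have h : EqUpTo d f (MvPowerSeries.trunc' ℤ d f : MvPolynomial ℕ ℤ) := by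
    intro e he
    rw [MvPolynomial.coeff_coe, MvPowerSeries.coeff_trunc', if_pos he]
  obtain ⟨l, hl⟩ := coe_mem_newtonSubgroup (MvPowerSeries.trunc' ℤ d f)
  have hl' := funext (lamSer_eq_of_isNewton hl)
  rw [coeff_natCast_mul, h.lamSer _ d le_rfl, ← coeff_natCast_mul,
    h.lamSer_sum (fun i _ => h.lamSer i) d le_rfl, hl', (hl N).2 n hn]

instance : IsAddTorsionFree Series where
  nsmul_right_injective n hn f g h := by
    ext d
    have := congrArg (MvPowerSeries.coeff d) h
    simp only [map_nsmul] at this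
    exact nsmul_right_injective hn this

instance (S : Subring Series) : IsAddTorsionFree S :=
  Subtype.val_injective.isAddTorsionFree S.subtype.toAddMonoidHom

theorem psiSer_mem_QSym {k : ℕ} {f : Series} (hf : f ∈ QSym) : psiSer k f ∈ QSym := by
  rcases Nat.eq_zero_or_pos k with rfl | hk
  · simpa [psiSer] using hf
  obtain ⟨⟨N, hN⟩, hq⟩ := hf
  refine ⟨⟨k * N, fun d hd => ?_⟩, fun r a i j => ?_⟩
  · by_cases h : ∀ i, k ∣ d i
    · obtain ⟨e, rfl⟩ := exists_eq_smul_of_dvd h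
      rw [coeff_smul_psiSer hk]
      refine hN e ?_
      rw [map_nsmul, smul_eq_mul] at hd
      exact lt_of_mul_lt_mul_left hd (Nat.zero_le k)
    · obtain ⟨i, hi⟩ := not_forall.1 h
      rw [coeff_psiSer_of_not_dvd hk hi]
  · by_cases h : ∀ t, k ∣ a t
    · obtain ⟨b, rfl⟩ := exists_eq_smul_of_dvd h
      have e : ∀ i : Fin r ↪o ℕ, (k • b).mapDomain i = k • b.mapDomain i := fun i =>
        map_nsmul (Finsupp.mapDomain.addMonoidHom i) k b
      rw [e, e, coeff_smul_psiSer hk, coeff_smul_psiSer hk, hq]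
    · obtain ⟨t, ht⟩ := not_forall.1 h
      have e : ∀ i : Fin r ↪o ℕ, ¬ k ∣ (a.mapDomain i) (i t) := fun i => by
        rwa [Finsupp.mapDomain_apply i.injective]
      rw [coeff_psiSer_of_not_dvd hk (e i), coeff_psiSer_of_not_dvd hk (e j)]

theorem mem_QSym_of_natCast_mul {n : ℕ} {f : Series} (h : ((n + 1 : ℕ) : Series) * f ∈ QSym) :
    f ∈ QSym := by
  have hn : ((n + 1 : ℕ) : ℤ) ≠ 0 := by exact_mod_cast Nat.succ_ne_zero n
  obtain ⟨⟨N, hN⟩, hq⟩ := h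
  refine ⟨⟨N, fun d hd => ?_⟩, fun r a i j => ?_⟩
  · have := hN d hd
    rw [coeff_natCast_mul] at this
    exact (mul_eq_zero.1 this).resolve_left hn
  · have := hq r a i j
    rw [coeff_natCast_mul, coeff_natCast_mul] at this
    exact mul_left_cancel₀ hn this

theorem lamSer_mem_QSym {f : Series} (hf : f ∈ QSym) (n : ℕ) : lamSer f n ∈ QSym := by
  induction n using Nat.strong_induction_on with
  | _ n ih =>
    cases n with
    | zero => rw [lamSer]; exact one_mem _
    | succ n =>
      refine mem_QSym_of_natCast_mul (n := n) ?_
      rw [(newton_lamSer (n + 1) f).2 n (Nat.lt_succ_self n)]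
      refine sum_mem fun ij hij => mul_mem (mul_mem ?_ (ih _ ?_)) (psiSer_mem_QSym hf)
      · exact pow_mem (neg_mem (one_mem _)) _
      · have := mem_antidiagonal.1 hij
        omega

/-- The Adams operations and λ-operations of `QSym`. -/
def adamsQSym : AdamsStructure QSym where
  psi k := (psiSer k).restrict QSym QSym fun _ hf => psiSer_mem_QSym hf
  psi_one f := Subtype.ext (psiSer_one f)
  psi_psi k l hk hl f := Subtype.ext (psiSer_psiSer k l hk hl f)
  lam n f := ⟨lamSer f n, lamSer_mem_QSym f.2 n⟩
  newton N f := IsNewton.of_map QSym.subtype Subtype.val_injective (newton_lamSer N f)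

/-! ### Splitting off the first variable -/

/-- The exponent vector `(n, d_0, d_1, …)`. -/
def consE (n : ℕ) (d : ℕ →₀ ℕ) : ℕ →₀ ℕ := Finsupp.single 0 n + d.mapDomain Nat.succ

theorem consE_zero_apply (n : ℕ) (d : ℕ →₀ ℕ) : consE n d 0 = n := by
  rw [consE, Finsupp.add_apply, Finsupp.single_eq_same, Finsupp.mapDomain_of_notMem_range, add_zero]
  rintro ⟨k, hk⟩
  exact Nat.succ_ne_zero k hk

theorem consE_succ_apply (n : ℕ) (d : ℕ →₀ ℕ) (k : ℕ) : consE n d (k + 1) = d k := by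
  rw [consE, Finsupp.add_apply, Finsupp.single_eq_of_ne (Nat.succ_ne_zero k), zero_add]
  exact Finsupp.mapDomain_apply Nat.succ_injective d k

/-- The exponent vector `(d_1, d_2, …)`. -/
def tailE (d : ℕ →₀ ℕ) : ℕ →₀ ℕ := d.comapDomain Nat.succ Nat.succ_injective.injOn

theorem tailE_apply (d : ℕ →₀ ℕ) (k : ℕ) : tailE d k = d (k + 1) :=
  Finsupp.comapDomain_apply _ _ _ _

theorem consE_tailE (d : ℕ →₀ ℕ) : consE (d 0) (tailE d) = d := by
  ext k
  cases k with
  | zero => exact consE_zero_apply _ _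
  | succ k => rw [consE_succ_apply, tailE_apply]

theorem consE_inj {n n' : ℕ} {d d' : ℕ →₀ ℕ} : consE n d = consE n' d' ↔ n = n' ∧ d = d' := by
  refine ⟨fun h => ⟨?_, ?_⟩, fun h => by rw [h.1, h.2]⟩
  · rw [← consE_zero_apply n d, h, consE_zero_apply]
  · ext k
    rw [← consE_succ_apply n d, h, consE_succ_apply]

theorem consE_add (n n' : ℕ) (d d' : ℕ →₀ ℕ) :
    consE n d + consE n' d' = consE (n + n') (d + d') := by
  rw [consE, consE, consE, Finsupp.single_add, Finsupp.mapDomain_add]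
  abel

theorem consE_zero_zero : consE 0 0 = 0 := by simp [consE]

theorem smul_consE (k n : ℕ) (d : ℕ →₀ ℕ) : k • consE n d = consE (k * n) (k • d) := by
  ext i
  cases i with
  | zero => simp [consE_zero_apply]
  | succ i => simp [consE_succ_apply]

theorem degree_consE (n : ℕ) (d : ℕ →₀ ℕ) : (consE n d).degree = n + d.degree := by
  rw [consE, map_add, Finsupp.degree_single, Finsupp.degree_mapDomain]

/-- An exponent vector is built from `0` by finitely many applications of `consE`. -/
theorem consE_induction {p : (ℕ →₀ ℕ) → Prop} (h0 : p 0) (h : ∀ n d, p d → p (consE n d))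
    (d : ℕ →₀ ℕ) : p d := by
  have key : ∀ N : ℕ, ∀ d : ℕ →₀ ℕ, (∀ i, N ≤ i → d i = 0) → p d := by
    intro N
    induction N with
    | zero =>
      intro d hd
      rwa [show d = 0 from Finsupp.ext fun i => hd i (Nat.zero_le _)]
    | succ N ih =>
      intro d hd
      rw [← consE_tailE d]
      exact h _ _ (ih _ fun i hi => by rw [tailE_apply]; exact hd _ (Nat.succ_le_succ hi))
  refine key (d.support.sup id + 1) d fun i hi => ?_
  by_contra hne
  have : i ≤ d.support.sup id := Finset.le_sup (f := id) (Finsupp.mem_support_iff.2 hne)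
  omega

theorem sum_antidiagonal_consE {A : Type*} [AddCommMonoid A] (n : ℕ) (d : ℕ →₀ ℕ)
    (G : (ℕ →₀ ℕ) → (ℕ →₀ ℕ) → A) :
    ∑ p ∈ antidiagonal (consE n d), G p.1 p.2 =
      ∑ ij ∈ antidiagonal n, ∑ uv ∈ antidiagonal d, G (consE ij.1 uv.1) (consE ij.2 uv.2) := by
  rw [Finset.sum_sigma']
  symm
  refine Finset.sum_nbij' (fun x => (consE x.1.1 x.2.1, consE x.1.2 x.2.2))
    (fun p => ⟨(p.1 0, p.2 0), (tailE p.1, tailE p.2)⟩) ?_ ?_ ?_ ?_ ?_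
  · rintro ⟨⟨i, j⟩, ⟨u, v⟩⟩ h
    obtain ⟨h1, h2⟩ := Finset.mem_sigma.1 h
    rw [mem_antidiagonal] at h1 h2 ⊢
    simp only at h1 h2 ⊢
    rw [consE_add, h1, h2]
  · rintro ⟨u, v⟩ h
    rw [mem_antidiagonal] at h
    rw [Finset.mem_sigma, mem_antidiagonal, mem_antidiagonal]
    simp only at h ⊢
    rw [← consE_tailE u, ← consE_tailE v, consE_add, consE_inj] at h
    exact h
  · rintro ⟨⟨i, j⟩, ⟨u, v⟩⟩ _
    have e : ∀ n d, tailE (consE n d) = d := fun n d => by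
      ext k; rw [tailE_apply, consE_succ_apply]
    simp only [consE_zero_apply, e]
  · rintro ⟨u, v⟩ _
    simp only [consE_tailE]
  · intros
    rfl

/-- The coefficient of `x_0^n` in `f`, as a series in `x_1, x_2, …` with the variables renumbered. -/
def shift (n : ℕ) : Series →+ Series where
  toFun f := fun d => MvPowerSeries.coeff (consE n d) f
  map_zero' := rfl
  map_add' _ _ := rfl

theorem coeff_shift (n : ℕ) (d : ℕ →₀ ℕ) (f : Series) :
    MvPowerSeries.coeff d (shift n f) = MvPowerSeries.coeff (consE n d) f := rfl

theorem shift_mul (n : ℕ) (f g : Series) :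
    shift n (f * g) = ∑ ij ∈ antidiagonal n, shift ij.1 f * shift ij.2 g := by
  classical
  ext d
  rw [coeff_shift, MvPowerSeries.coeff_mul, map_sum, sum_antidiagonal_consE n d fun u v =>
    MvPowerSeries.coeff u f * MvPowerSeries.coeff v g]
  refine Finset.sum_congr rfl fun ij _ => ?_
  rw [MvPowerSeries.coeff_mul]
  rfl

theorem shift_psiSer {k : ℕ} (hk : 0 < k) (n : ℕ) (f : Series) :
    shift n (psiSer k f) = if k ∣ n then psiSer k (shift (n / k) f) else 0 := by
  ext d
  rw [coeff_shift]
  split_ifs with h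
  · obtain ⟨n, rfl⟩ := h
    rw [Nat.mul_div_cancel_left _ hk]
    by_cases hd : ∀ i, k ∣ d i
    · obtain ⟨d, rfl⟩ := exists_eq_smul_of_dvd hd
      rw [← smul_consE, coeff_smul_psiSer hk, coeff_smul_psiSer hk, coeff_shift]
    · obtain ⟨i, hi⟩ := not_forall.1 hd
      rw [coeff_psiSer_of_not_dvd hk hi, coeff_psiSer_of_not_dvd hk (i := i + 1)]
      rwa [consE_succ_apply]
  · rw [coeff_psiSer_of_not_dvd hk (i := 0), map_zero]
    rwa [consE_zero_apply]

theorem coeff_mapDomain_of_mem_QSym {f : Series} (hf : f ∈ QSym) {σ : ℕ → ℕ} (hσ : StrictMono σ)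
    (d : ℕ →₀ ℕ) : MvPowerSeries.coeff (d.mapDomain σ) f = MvPowerSeries.coeff d f := by
  have hN : ∃ N, ∀ i, N ≤ i → d i = 0 := by
    refine ⟨d.support.sup id + 1, fun i hi => ?_⟩
    by_contra hne
    have : i ≤ d.support.sup id := Finset.le_sup (f := id) (Finsupp.mem_support_iff.2 hne)
    omega
  obtain ⟨N, hN⟩ := hN
  have e : (d.comapDomain (Fin.val : Fin N → ℕ) Fin.val_injective.injOn).mapDomain Fin.val = d := by
    refine Finsupp.mapDomain_comapDomain _ Fin.val_injective d ?_
    intro i hi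
    refine ⟨⟨i, ?_⟩, rfl⟩
    by_contra h
    exact Finsupp.mem_support_iff.1 hi (hN i (not_lt.1 h))
  have h := hf.2 N (d.comapDomain (Fin.val : Fin N → ℕ) Fin.val_injective.injOn)
    (Fin.valOrderEmb N) ((Fin.valOrderEmb N).trans (OrderEmbedding.ofStrictMono σ hσ))
  have e1 : ((Fin.valOrderEmb N : Fin N ↪o ℕ) : Fin N → ℕ) = Fin.val := rfl
  have e2 : (((Fin.valOrderEmb N).trans (OrderEmbedding.ofStrictMono σ hσ) : Fin N ↪o ℕ) :
    Fin N → ℕ) = σ ∘ Fin.val := rfl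
  rw [e1, e2, Finsupp.mapDomain_comp, e] at h
  exact h.symm

theorem shift_zero_of_mem_QSym {f : Series} (hf : f ∈ QSym) : shift 0 f = f := by
  ext d
  rw [coeff_shift, consE, Finsupp.single_zero, zero_add,
    coeff_mapDomain_of_mem_QSym hf fun a b h => Nat.succ_lt_succ h]

theorem shift_mem_QSym (n : ℕ) {f : Series} (hf : f ∈ QSym) : shift n f ∈ QSym := by
  obtain ⟨⟨N, hN⟩, hq⟩ := hf
  refine ⟨⟨N, fun d hd => ?_⟩, fun r a i j => ?_⟩
  · rw [coeff_shift]
    refine hN _ ?_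
    rw [degree_consE]
    omega
  · rw [coeff_shift, coeff_shift]
    have key : ∀ i : Fin r ↪o ℕ, ∃ i' : Fin (r + 1) ↪o ℕ, consE n (a.mapDomain i) =
        (Finsupp.single 0 n + a.mapDomain Fin.succ).mapDomain i' := by
      intro i
      have hm : StrictMono (Fin.cons 0 (fun k => i k + 1) : Fin (r + 1) → ℕ) := by
        intro u v
        refine Fin.cases ?_ (fun u => ?_) u <;> refine Fin.cases ?_ (fun v => ?_) v
        · simp
        · simp
        · simp
        · simp
      refine ⟨OrderEmbedding.ofStrictMono _ hm, ?_⟩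
      rw [Finsupp.mapDomain_add, Finsupp.mapDomain_single, ← Finsupp.mapDomain_comp, consE,
        ← Finsupp.mapDomain_comp]
      rfl
    obtain ⟨i', hi⟩ := key i
    obtain ⟨j', hj⟩ := key j
    rw [hi, hj]
    exact hq (r + 1) _ i' j'

/-! ### Higher derivations -/

section HigherDerivation

open PowerSeries

variable {R : Type*} [CommRing R]

/-- A Hasse–Schmidt derivation: a sequence of additive maps `D_0 = id, D_1, D_2, …` of a ring satisfying the Leibniz rule
`D_n(f g) = ∑_{i + j = n} D_i(f) D_j(g)`. -/
structure IsHigherDerivation (D : ℕ → R →+ R) : Prop where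
  zero : ∀ f, D 0 f = f
  mul : ∀ n f g, D n (f * g) = ∑ ij ∈ antidiagonal n, D ij.1 f * D ij.2 g

/-- The `t`-linear extension `D(t)` of `f ↦ ∑_n D_n(f) t^n` to power series. -/
def hsAct (D : ℕ → R →+ R) (F : PowerSeries R) : PowerSeries R :=
  mk fun n => ∑ ij ∈ antidiagonal n, D ij.1 (coeff ij.2 F)

theorem coeff_hsAct (D : ℕ → R →+ R) (F : PowerSeries R) (n : ℕ) :
    coeff n (hsAct D F) = ∑ ij ∈ antidiagonal n, D ij.1 (coeff ij.2 F) := coeff_mk _ _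

theorem IsHigherDerivation.hsAct_mul {D : ℕ → R →+ R} (hD : IsHigherDerivation D)
    (F G : PowerSeries R) : hsAct D (F * G) = hsAct D F * hsAct D G := by
  ext n
  rw [coeff_hsAct, coeff_mul]
  simp only [coeff_hsAct, coeff_mul, map_sum, hD.mul, Finset.sum_mul_sum]
  simp only [Finset.sum_sigma']
  refine Finset.sum_nbij'
    (fun x => ⟨(x.2.2.1 + x.2.1.1, x.2.2.2 + x.2.1.2), ⟨(x.2.2.1, x.2.1.1), (x.2.2.2, x.2.1.2)⟩⟩)
    (fun y => ⟨(y.2.1.1 + y.2.2.1, y.2.1.2 + y.2.2.2), ⟨(y.2.1.2, y.2.2.2), (y.2.1.1, y.2.2.1)⟩⟩)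
    ?_ ?_ ?_ ?_ ?_
  · rintro ⟨⟨i, j⟩, ⟨⟨k, l⟩, ⟨a, b⟩⟩⟩ h
    simp only [Finset.mem_sigma, mem_antidiagonal] at h ⊢
    exact ⟨by omega, trivial, trivial⟩
  · rintro ⟨⟨i, j⟩, ⟨⟨k, l⟩, ⟨a, b⟩⟩⟩ h
    simp only [Finset.mem_sigma, mem_antidiagonal] at h ⊢
    exact ⟨by omega, trivial, trivial⟩
  · rintro ⟨⟨i, j⟩, ⟨⟨k, l⟩, ⟨a, b⟩⟩⟩ h
    simp only [Finset.mem_sigma, mem_antidiagonal] at h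
    obtain ⟨-, rfl, rfl⟩ := h
    rfl
  · rintro ⟨⟨i, j⟩, ⟨⟨k, l⟩, ⟨a, b⟩⟩⟩ h
    simp only [Finset.mem_sigma, mem_antidiagonal] at h
    obtain ⟨-, rfl, rfl⟩ := h
    rfl
  · intros
    rfl

theorem coeff_hsAct_eq_add {D : ℕ → R →+ R} (hD : IsHigherDerivation D) (n : ℕ) :
    ∃ S : (ℕ → R) → R, (∀ a b : ℕ → R, (∀ i < n, a i = b i) → S a = S b) ∧
      ∀ F : PowerSeries R, coeff n (hsAct D F) = coeff n F + S fun i => coeff i F := by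
  refine ⟨fun a => ∑ ij ∈ (antidiagonal n).erase (0, n), D ij.1 (a ij.2), ?_, ?_⟩
  · intro a b hab
    refine Finset.sum_congr rfl fun ij hij => ?_
    obtain ⟨h1, h2⟩ := Finset.mem_erase.1 hij
    have h3 := mem_antidiagonal.1 h2
    rw [hab]
    by_contra h4
    have h5 : ij.2 = n := by omega
    exact h1 (Prod.ext (by simp only; omega) h5)
  · intro F
    rw [coeff_hsAct, ← Finset.add_sum_erase _ _ (show (0, n) ∈ antidiagonal n by simp)]
    simp only [hD.zero]

theorem IsHigherDerivation.hsAct_bijective {D : ℕ → R →+ R} (hD : IsHigherDerivation D) :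
    Function.Bijective (hsAct D) := by
  -- the coefficients of a preimage are determined recursively, as `D_0 = id`
  choose S hS hS' using coeff_hsAct_eq_add hD
  constructor
  · intro F G h
    ext n
    induction n using Nat.strong_induction_on with
    | _ n ih =>
      have e := congrArg (coeff n) h
      rw [hS', hS', hS n _ _ ih] at e
      exact add_right_cancel e
  · intro G
    let a : ℕ → R := Nat.strongRec fun n ih => coeff n G - S n fun i => if h : i < n then ih i h else 0
    have ha : ∀ n, a n = coeff n G - S n a := by
      intro n
      have e : a n = coeff n G - S n fun i => if _ : i < n then a i else 0 := by
        simp only [a]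
        rw [Nat.strongRec]
      rw [e, hS n _ a fun i hi => dif_pos hi]
    refine ⟨PowerSeries.mk a, ?_⟩
    ext n
    rw [hS']
    simp only [coeff_mk]
    rw [ha n]
    exact sub_add_cancel _ _

/-- A higher derivation gives an automorphism of the ring of power series. -/
def hsEquiv {D : ℕ → R →+ R} (hD : IsHigherDerivation D) : PowerSeries R ≃+* PowerSeries R :=
  { Equiv.ofBijective _ hD.hsAct_bijective with
    map_mul' := hD.hsAct_mul
    map_add' := fun F G => by
      ext n
      simp [coeff_hsAct, Finset.sum_add_distrib] }

theorem hsEquiv_apply {D : ℕ → R →+ R} (hD : IsHigherDerivation D) (F : PowerSeries R) :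
    hsEquiv hD F = hsAct D F := rfl

/-- If `D(t)` is the automorphism given by a higher derivation, this is
`f ↦ D(t) D(-t)⁻¹ f`, the supersymmetrization of `D`. -/
def superHom {D : ℕ → R →+ R} (hD : IsHigherDerivation D) : R →+* PowerSeries R :=
  (hsEquiv hD : PowerSeries R →+* PowerSeries R).comp
    ((rescale (-1 : R)).comp (((hsEquiv hD).symm : PowerSeries R →+* PowerSeries R).comp C))

theorem superHom_apply {D : ℕ → R →+ R} (hD : IsHigherDerivation D) (f : R) :
    superHom hD f = hsEquiv hD (rescale (-1 : R) ((hsEquiv hD).symm (C f))) := rfl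

/-- The coefficients of `superHom`. -/
def superDer {D : ℕ → R →+ R} (hD : IsHigherDerivation D) (n : ℕ) : R →+ R :=
  (coeff n : PowerSeries R →ₗ[R] R).toAddMonoidHom.comp (superHom hD).toAddMonoidHom

theorem superDer_apply {D : ℕ → R →+ R} (hD : IsHigherDerivation D) (n : ℕ) (f : R) :
    superDer hD n f = coeff n (superHom hD f) := rfl

theorem coeff_zero_hsAct {D : ℕ → R →+ R} (hD : IsHigherDerivation D) (F : PowerSeries R) :
    coeff 0 (hsAct D F) = coeff 0 F := by
  simp [coeff_hsAct, hD.zero]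

theorem isHigherDerivation_superDer {D : ℕ → R →+ R} (hD : IsHigherDerivation D) :
    IsHigherDerivation (superDer hD) where
  zero f := by
    rw [superDer_apply, superHom_apply, hsEquiv_apply, coeff_zero_hsAct hD, coeff_rescale, pow_zero,
      one_mul, ← coeff_zero_hsAct hD, ← hsEquiv_apply hD, RingEquiv.apply_symm_apply, coeff_zero_C]
  mul n f g := by
    rw [superDer_apply, map_mul, coeff_mul]
    rfl

/-- If `D(-t)⁻¹ f` has the coefficients `a_n`, then `superDer` can be computed from `D` and `a`. -/
theorem superDer_eq_sum {D : ℕ → R →+ R} (hD : IsHigherDerivation D) {f : R} {a : ℕ → R}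
    (h0 : a 0 = f)
    (ha : ∀ n, ∑ ij ∈ antidiagonal (n + 1), (-1) ^ ij.2 * D ij.1 (a ij.2) = 0) (n : ℕ) :
    superDer hD n f = ∑ ij ∈ antidiagonal n, D ij.1 (a ij.2) := by
  have hneg : ∀ i j (x : R), D i ((-1) ^ j * x) = (-1) ^ j * D i x := by
    intro i j x
    rcases neg_one_pow_eq_or R j with h | h <;> simp [h]
  have e : hsEquiv hD (mk fun j => (-1) ^ j * a j) = C f := by
    ext n
    rw [hsEquiv_apply, coeff_hsAct]
    simp only [coeff_mk, hneg]
    cases n with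
    | zero => simp [hD.zero, h0]
    | succ n => rw [ha, coeff_C, if_neg (Nat.succ_ne_zero n)]
  rw [superDer_apply, superHom_apply, ← e, RingEquiv.symm_apply_apply, hsEquiv_apply, coeff_hsAct]
  refine Finset.sum_congr rfl fun ij _ => ?_
  rw [coeff_rescale, coeff_mk, ← mul_assoc, ← mul_pow]
  simp

/-- The map `∑_n F_n t^n ↦ ∑_n ψ(F_n) t^{kn}`. -/
def expandMap (ψ : R →+* R) (k : ℕ) (F : PowerSeries R) : PowerSeries R :=
  mk fun n => if k ∣ n then ψ (coeff (n / k) F) else 0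

theorem coeff_expandMap (ψ : R →+* R) (k : ℕ) (F : PowerSeries R) (n : ℕ) :
    coeff n (expandMap ψ k F) = if k ∣ n then ψ (coeff (n / k) F) else 0 := coeff_mk _ _

theorem expandMap_C (ψ : R →+* R) {k : ℕ} (hk : 0 < k) (f : R) :
    expandMap ψ k (C f) = C (ψ f) := by
  ext n
  rw [coeff_expandMap, coeff_C, coeff_C]
  by_cases hn : n = 0
  · simp [hn]
  · rw [if_neg hn]
    split_ifs with h1 h2
    · rw [Nat.div_eq_zero_iff_lt hk] at h2
      exact absurd (Nat.le_of_dvd (Nat.pos_of_ne_zero hn) h1) (not_le.2 h2)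
    · exact map_zero ψ
    · rfl

/-- If `D_n ψ = ψ D_{n/k}` for `k ∣ n` and `D_n ψ = 0` otherwise,
then `D(t)` commutes with `expandMap ψ k`. -/
theorem hsAct_expandMap {D : ℕ → R →+ R} {ψ : R →+* R} {k : ℕ} (hk : 0 < k)
    (h : ∀ n f, D n (ψ f) = if k ∣ n then ψ (D (n / k) f) else 0) (F : PowerSeries R) :
    hsAct D (expandMap ψ k F) = expandMap ψ k (hsAct D F) := by
  ext n
  rw [coeff_hsAct, coeff_expandMap]
  simp only [coeff_expandMap]
  split_ifs with hn
  · obtain ⟨n, rfl⟩ := hn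
    rw [Nat.mul_div_cancel_left _ hk, coeff_hsAct, map_sum]
    symm
    refine Finset.sum_of_injOn (fun ij : ℕ × ℕ => (k * ij.1, k * ij.2)) ?_ ?_ ?_ ?_
    · rintro ⟨i, j⟩ _ ⟨i', j'⟩ _ he
      simp only [Prod.mk.injEq, Nat.mul_right_inj hk.ne'] at he
      exact Prod.ext he.1 he.2
    · rintro ⟨i, j⟩ hij
      have := mem_antidiagonal.1 hij
      simp only at this
      simp [← this, mul_add]
    · rintro ⟨i, j⟩ hij hne
      have hs := mem_antidiagonal.1 hij
      simp only at hs ⊢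
      split_ifs with hj
      · rw [h, if_neg]
        intro hi
        apply hne
        obtain ⟨i, rfl⟩ := hi
        obtain ⟨j, rfl⟩ := hj
        rw [← mul_add, Nat.mul_right_inj hk.ne'] at hs
        exact ⟨(i, j), by simpa using hs, rfl⟩
      · exact map_zero _
    · rintro ⟨i, j⟩ _
      simp only
      rw [if_pos (dvd_mul_right k j), h, if_pos (dvd_mul_right k i), Nat.mul_div_cancel_left _ hk,
        Nat.mul_div_cancel_left _ hk]
  · refine Finset.sum_eq_zero fun ij hij => ?_
    have hs := mem_antidiagonal.1 hij
    split_ifs with hj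
    · rw [h, if_neg]
      intro hi
      exact hn (hs ▸ dvd_add hi hj)
    · exact map_zero _

theorem hsEquiv_symm_expandMap {D : ℕ → R →+ R} (hD : IsHigherDerivation D) {ψ : R →+* R} {k : ℕ}
    (hk : 0 < k) (h : ∀ n f, D n (ψ f) = if k ∣ n then ψ (D (n / k) f) else 0) (F : PowerSeries R) :
    (hsEquiv hD).symm (expandMap ψ k F) = expandMap ψ k ((hsEquiv hD).symm F) := by
  rw [RingEquiv.symm_apply_eq, hsEquiv_apply, hsAct_expandMap hk h, ← hsEquiv_apply hD,
    RingEquiv.apply_symm_apply]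

/-- For odd `k`, the substitution `t ↦ -t` commutes with `expandMap ψ k`. -/
theorem superDer_of_odd {D : ℕ → R →+ R} (hD : IsHigherDerivation D) {ψ : R →+* R} {k : ℕ}
    (hk : Odd k) (h : ∀ n f, D n (ψ f) = if k ∣ n then ψ (D (n / k) f) else 0) (n : ℕ) (f : R) :
    superDer hD n (ψ f) = if k ∣ n then ψ (superDer hD (n / k) f) else 0 := by
  have e : ∀ F : PowerSeries R,
      rescale (-1 : R) (expandMap ψ k F) = expandMap ψ k (rescale (-1 : R) F) := by
    intro F
    ext n
    rw [coeff_rescale, coeff_expandMap, coeff_expandMap]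
    split_ifs with hn
    · obtain ⟨n, rfl⟩ := hn
      rw [Nat.mul_div_cancel_left _ hk.pos, coeff_rescale, pow_mul, hk.neg_one_pow]
      simp
    · rw [mul_zero]
  rw [superDer_apply, superHom_apply, ← expandMap_C ψ hk.pos, hsEquiv_symm_expandMap hD hk.pos h, e,
    hsEquiv_apply, hsAct_expandMap hk.pos h, coeff_expandMap]
  rfl

/-- For even `k`, the image of `expandMap ψ k` is invariant under `t ↦ -t`, so the two factors of
`D(t) D(-t)⁻¹` cancel on the image of `ψ`. -/
theorem superDer_of_even {D : ℕ → R →+ R} (hD : IsHigherDerivation D) {ψ : R →+* R} {k : ℕ}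
    (hk0 : 0 < k) (hk : Even k) (h : ∀ n f, D n (ψ f) = if k ∣ n then ψ (D (n / k) f) else 0)
    (n : ℕ) (f : R) : superDer hD n (ψ f) = if n = 0 then ψ f else 0 := by
  have e : ∀ F : PowerSeries R, rescale (-1 : R) (expandMap ψ k F) = expandMap ψ k F := by
    intro F
    ext n
    rw [coeff_rescale, coeff_expandMap]
    split_ifs with hn
    · rw [(hk.trans_dvd hn).neg_one_pow, one_mul]
    · rw [mul_zero]
  rw [superDer_apply, superHom_apply, ← expandMap_C ψ hk0, hsEquiv_symm_expandMap hD hk0 h, e,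
    ← hsEquiv_symm_expandMap hD hk0 h, RingEquiv.apply_symm_apply, expandMap_C ψ hk0, coeff_C]

end HigherDerivation

/-! ### The descent-to-peak map -/

/-- `shift` as an operator on `QSym`. -/
def shiftQ (n : ℕ) : QSym →+ QSym where
  toFun f := ⟨shift n f, shift_mem_QSym n f.2⟩
  map_zero' := rfl
  map_add' _ _ := rfl

theorem coe_shiftQ (n : ℕ) (f : QSym) : (shiftQ n f : Series) = shift n f := rfl

theorem isHigherDerivation_shiftQ : IsHigherDerivation shiftQ where
  zero f := Subtype.ext (shift_zero_of_mem_QSym f.2)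
  mul n f g := Subtype.ext (by
    rw [coe_shiftQ, Subring.coe_mul, shift_mul, AddSubmonoidClass.coe_finsetSum]
    rfl)

theorem shiftQ_psi {k : ℕ} (hk : 0 < k) (n : ℕ) (f : QSym) :
    shiftQ n (adamsQSym.psi k f) = if k ∣ n then adamsQSym.psi k (shiftQ (n / k) f) else 0 := by
  apply Subtype.ext
  rw [coe_shiftQ]
  refine (shift_psiSer hk n f).trans ?_
  split_ifs <;> rfl

/-- The coefficient of `t^n` in the operator `D(t) D(-t)⁻¹` on `QSym`, where `D(t) = ∑_n shiftQ n t^n`.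
A quasisymmetric function satisfies `f(x_0, x_1, …) = (D(x_0) f)(x_1, x_2, …)`, and its image under the
descent-to-peak map arises in the same way from `D(t) D(-t)⁻¹`. -/
def peakDer (n : ℕ) : QSym →+ QSym := superDer isHigherDerivation_shiftQ n

theorem isHigherDerivation_peakDer : IsHigherDerivation peakDer :=
  isHigherDerivation_superDer isHigherDerivation_shiftQ

/-- The constant term of `peakDer_{d_{N-1}} ⋯ peakDer_{d_0} f`. -/
def thetaCoeff : ℕ → QSym → (ℕ → ℕ) → ℤ
  | 0, f, _ => MvPowerSeries.constantCoeff (f : Series)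
  | N + 1, f, d => thetaCoeff N (peakDer (d 0) f) fun i => d (i + 1)

theorem thetaCoeff_succ {N : ℕ} {d : ℕ → ℕ} (hd : ∀ i, N ≤ i → d i = 0) (f : QSym) :
    thetaCoeff (N + 1) f d = thetaCoeff N f d := by
  induction N generalizing d f with
  | zero => rw [thetaCoeff, thetaCoeff, thetaCoeff, hd 0 le_rfl, isHigherDerivation_peakDer.zero]
  | succ N ih =>
    rw [thetaCoeff, ih fun i hi => hd _ (Nat.succ_le_succ hi), thetaCoeff]

theorem thetaCoeff_eq {N N' : ℕ} {d : ℕ → ℕ} (hd : ∀ i, N ≤ i → d i = 0)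
    (hd' : ∀ i, N' ≤ i → d i = 0) (f : QSym) : thetaCoeff N f d = thetaCoeff N' f d := by
  wlog h : N ≤ N' generalizing N N'
  · exact (this hd' hd (le_of_not_ge h)).symm
  induction N', h using Nat.le_induction with
  | base => rfl
  | succ N' hN ih =>
    rw [thetaCoeff_succ fun i hi => hd i (hN.trans hi), ih fun i hi => hd i (hN.trans hi)]

/-- The descent-to-peak map as a map to power series: the coefficient of `x^d` in the image of `f` is
the constant term of `⋯ peakDer_{d_1} peakDer_{d_0} f`. -/
def thetaFun (f : QSym) : Series := fun d => thetaCoeff (d.support.sup id + 1) f d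

theorem apply_eq_zero_of_sup_lt {d : ℕ →₀ ℕ} {i : ℕ} (hi : d.support.sup id + 1 ≤ i) : d i = 0 := by
  by_contra hne
  have : i ≤ d.support.sup id := Finset.le_sup (f := id) (Finsupp.mem_support_iff.2 hne)
  omega

theorem coeff_thetaFun {N : ℕ} {d : ℕ →₀ ℕ} (hd : ∀ i, N ≤ i → d i = 0) (f : QSym) :
    MvPowerSeries.coeff d (thetaFun f) = thetaCoeff N f d :=
  thetaCoeff_eq (fun _ hi => apply_eq_zero_of_sup_lt hi) hd f

theorem coeff_zero_thetaFun (f : QSym) :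
    MvPowerSeries.coeff 0 (thetaFun f) = MvPowerSeries.constantCoeff (f : Series) :=
  coeff_thetaFun (N := 0) (fun _ _ => rfl) f

theorem shift_thetaFun (n : ℕ) (f : QSym) : shift n (thetaFun f) = thetaFun (peakDer n f) := by
  ext d
  have h : ∀ i, d.support.sup id + 1 + 1 ≤ i → consE n d i = 0 := by
    intro i hi
    obtain ⟨i, rfl⟩ : ∃ j, i = j + 1 := ⟨i - 1, by omega⟩
    rw [consE_succ_apply]
    exact apply_eq_zero_of_sup_lt (by omega)
  rw [coeff_shift, coeff_thetaFun h, thetaCoeff, consE_zero_apply,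
    coeff_thetaFun fun i hi => apply_eq_zero_of_sup_lt hi]
  simp only [consE_succ_apply]

theorem coeff_consE_thetaFun (n : ℕ) (d : ℕ →₀ ℕ) (f : QSym) :
    MvPowerSeries.coeff (consE n d) (thetaFun f) =
      MvPowerSeries.coeff d (thetaFun (peakDer n f)) := by
  rw [← shift_thetaFun, coeff_shift]

theorem thetaFun_zero : thetaFun 0 = 0 := by
  ext d
  induction d using consE_induction with
  | h0 => rw [coeff_zero_thetaFun]; simp
  | h n d ih => rw [coeff_consE_thetaFun, map_zero, ih]; simp

theorem thetaFun_add (f g : QSym) : thetaFun (f + g) = thetaFun f + thetaFun g := by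
  ext d
  induction d using consE_induction generalizing f g with
  | h0 => rw [map_add]; simp only [coeff_zero_thetaFun]; simp
  | h n d ih => rw [map_add]; simp only [coeff_consE_thetaFun]; rw [map_add, ih, map_add]

theorem thetaFun_mul (f g : QSym) : thetaFun (f * g) = thetaFun f * thetaFun g := by
  ext d
  induction d using consE_induction generalizing f g with
  | h0 =>
    have h : MvPowerSeries.coeff 0 (thetaFun f * thetaFun g) =
        MvPowerSeries.coeff 0 (thetaFun f) * MvPowerSeries.coeff 0 (thetaFun g) := by
      simp only [MvPowerSeries.coeff_zero_eq_constantCoeff_apply, map_mul]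
    rw [h, coeff_zero_thetaFun, coeff_zero_thetaFun, coeff_zero_thetaFun, ← map_mul]
    rfl
  | h n d ih =>
    have hsum : ∀ (s : Finset (ℕ × ℕ)) (F : ℕ × ℕ → QSym),
        thetaFun (∑ x ∈ s, F x) = ∑ x ∈ s, thetaFun (F x) := fun s F =>
      map_sum (AddMonoidHom.mk' thetaFun thetaFun_add) F s
    rw [coeff_consE_thetaFun, ← coeff_shift, shift_mul, isHigherDerivation_peakDer.mul, hsum,
      map_sum, map_sum]
    refine Finset.sum_congr rfl fun ij _ => ?_
    rw [ih, shift_thetaFun, shift_thetaFun]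

theorem thetaFun_one : thetaFun 1 = 1 := by
  have h1 : ∀ n, peakDer n 1 = if n = 0 then 1 else 0 := by
    intro n
    rw [peakDer, superDer_apply, map_one, PowerSeries.coeff_one]
  ext d
  induction d using consE_induction with
  | h0 => rw [coeff_zero_thetaFun]; simp
  | h n d ih =>
    rw [coeff_consE_thetaFun, h1]
    split_ifs with hn
    · classical
      rw [ih, hn, MvPowerSeries.coeff_one, MvPowerSeries.coeff_one]
      refine if_congr ?_ rfl rfl
      rw [← consE_zero_zero, consE_inj, consE_zero_zero]
      simp
    · classical
      rw [thetaFun_zero, map_zero, MvPowerSeries.coeff_one, if_neg]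
      intro h
      apply hn
      rw [← consE_zero_apply n d, h, Finsupp.zero_apply]

/-- The descent-to-peak map as a ring homomorphism to power series. -/
def thetaHom : QSym →+* Series where
  toFun := thetaFun
  map_one' := thetaFun_one
  map_mul' := thetaFun_mul
  map_zero' := thetaFun_zero
  map_add' := thetaFun_add

theorem thetaHom_apply (f : QSym) : thetaHom f = thetaFun f := rfl

theorem constantCoeff_psiSer (k : ℕ) (f : Series) :
    MvPowerSeries.constantCoeff (psiSer k f) = MvPowerSeries.constantCoeff f := by
  rcases Nat.eq_zero_or_pos k with rfl | hk
  · simp [psiSer]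
  · rw [psiSer_of_pos hk, MvPowerSeries.constantCoeff_expand]

/-- For odd `k`, the map `ϑ` commutes with `x_i ↦ x_i^k`. -/
theorem thetaHom_psi_of_odd {k : ℕ} (hk : Odd k) (f : QSym) :
    thetaHom (adamsQSym.psi k f) = psiSer k (thetaHom f) := by
  rw [thetaHom_apply, thetaHom_apply]
  ext d
  induction d using consE_induction generalizing f with
  | h0 =>
    rw [coeff_zero_thetaFun, MvPowerSeries.coeff_zero_eq_constantCoeff_apply, constantCoeff_psiSer,
      ← MvPowerSeries.coeff_zero_eq_constantCoeff_apply (thetaFun f), coeff_zero_thetaFun]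
    exact constantCoeff_psiSer k f
  | h n d ih =>
    rw [coeff_consE_thetaFun, ← coeff_shift, shift_psiSer hk.pos, peakDer,
      superDer_of_odd _ hk (shiftQ_psi hk.pos)]
    split_ifs with h
    · rw [ih, shift_thetaFun]
      rfl
    · rw [thetaFun_zero]

/-- For even `k`, the map `ϑ` sends everything in the image of `x_i ↦ x_i^k` to its constant term. -/
theorem thetaHom_psi_of_even {k : ℕ} (hk0 : 0 < k) (hk : Even k) (f : QSym) :
    thetaHom (adamsQSym.psi k f) = MvPowerSeries.C (MvPowerSeries.constantCoeff (f : Series)) := by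
  classical
  rw [thetaHom_apply]
  ext d
  induction d using consE_induction with
  | h0 =>
    rw [coeff_zero_thetaFun, MvPowerSeries.coeff_zero_C]
    exact constantCoeff_psiSer k f
  | h n d ih =>
    rw [coeff_consE_thetaFun, peakDer, superDer_of_even _ hk0 hk (shiftQ_psi hk0)]
    rw [MvPowerSeries.coeff_C] at ih ⊢
    split_ifs with hn hd hd
    · rw [ih, if_pos]
      rw [← consE_zero_zero, consE_inj] at hd
      exact hd.2
    · rw [ih, if_neg]
      rintro rfl
      exact hd (by rw [hn, consE_zero_zero])
    · exact absurd (by rw [← consE_zero_apply n d, hd, Finsupp.zero_apply]) hn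
    · rw [thetaFun_zero, map_zero]

/-! ### Compositions, descent sets and the bases `M` and `F` -/

theorem mem_D {n : ℕ} {α : Composition n} {k : ℕ} :
    k ∈ D α ↔ 0 < k ∧ k < n ∧ ∃ i, α.sizeUpTo i = k := by
  simp only [D, Finset.mem_image, Finset.mem_Ico]
  constructor
  · rintro ⟨i, ⟨h1, h2⟩, rfl⟩
    refine ⟨?_, ?_, i, rfl⟩
    · have h := α.sizeUpTo_strict_mono (i := 0) (by omega)
      rw [α.sizeUpTo_zero] at h
      exact h.trans_le (α.monotone_sizeUpTo h1)
    · have h := α.sizeUpTo_strict_mono h2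
      exact h.trans_le (α.sizeUpTo_le _)
  · rintro ⟨h1, h2, i, rfl⟩
    refine ⟨i, ⟨?_, ?_⟩, rfl⟩
    · rcases Nat.eq_zero_or_pos i with rfl | h
      · rw [α.sizeUpTo_zero] at h1
        exact absurd h1 (lt_irrefl _)
      · exact h
    · by_contra h
      rw [α.sizeUpTo_ofLength_le i (not_lt.1 h)] at h2
      exact lt_irrefl _ h2

theorem mem_boundaries_iff {n : ℕ} {α : Composition n} {j : Fin (n + 1)} :
    j ∈ α.boundaries ↔ (j : ℕ) = 0 ∨ (j : ℕ) = n ∨ (j : ℕ) ∈ D α := by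
  have h : j ∈ α.boundaries ↔ ∃ i, α.sizeUpTo i = j := by
    simp only [Composition.boundaries, Finset.mem_map, Finset.mem_univ, true_and]
    constructor
    · rintro ⟨i, rfl⟩
      exact ⟨i, rfl⟩
    · rintro ⟨i, hi⟩
      by_cases hl : i ≤ α.length
      · exact ⟨⟨i, Nat.lt_succ_of_le hl⟩, Fin.ext hi⟩
      · refine ⟨Fin.last _, Fin.ext ?_⟩
        rw [← hi, α.sizeUpTo_ofLength_le i (not_le.1 hl).le]
        exact α.sizeUpTo_length
  rw [h, mem_D]
  have hj := j.2
  constructor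
  · intro hi
    by_cases h0 : (j : ℕ) = 0
    · exact Or.inl h0
    by_cases hn : (j : ℕ) = n
    · exact Or.inr (Or.inl hn)
    exact Or.inr (Or.inr ⟨by omega, by omega, hi⟩)
  · rintro (h0 | hn | h)
    · exact ⟨0, by rw [α.sizeUpTo_zero, h0]⟩
    · exact ⟨α.length, by rw [α.sizeUpTo_length, hn]⟩
    · exact h.2.2

theorem D_injective {n : ℕ} : Function.Injective (D : Composition n → Finset ℕ) := by
  intro α β h
  apply (compositionEquiv n).injective
  apply CompositionAsSet.ext
  change α.boundaries = β.boundaries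
  ext j
  rw [mem_boundaries_iff, mem_boundaries_iff, h]

theorem exists_D_eq {n : ℕ} {S : Finset ℕ} (hS : ∀ k ∈ S, 0 < k ∧ k < n) :
    ∃ α : Composition n, D α = S := by
  let c : CompositionAsSet n :=
    { boundaries := {j : Fin (n + 1) | (j : ℕ) = 0 ∨ (j : ℕ) = n ∨ (j : ℕ) ∈ S}
      zero_mem := by simp
      getLast_mem := by simp }
  refine ⟨c.toComposition, ?_⟩
  have hb : c.toComposition.boundaries = c.boundaries := c.toComposition_boundaries
  ext k
  by_cases hk : 0 < k ∧ k < n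
  · have h : (⟨k, by omega⟩ : Fin (n + 1)) ∈ c.toComposition.boundaries ↔
        (⟨k, by omega⟩ : Fin (n + 1)) ∈ c.boundaries := by rw [hb]
    rw [mem_boundaries_iff] at h
    simp only [c, Finset.mem_filter, Finset.mem_univ, true_and] at h
    simp only [hk.1.ne', hk.2.ne, false_or] at h
    exact h
  · refine iff_of_false (fun h => hk ⟨(mem_D.1 h).1, (mem_D.1 h).2.1⟩) (fun h => hk (hS k h))

/-- The partial sums `d_0 + ⋯ + d_{i-1}` of an exponent vector. -/
def partialSums (d : ℕ →₀ ℕ) : Set ℕ := {s | ∃ t, ∑ j ∈ Finset.range t, d j = s}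

theorem degree_expo {n : ℕ} (α : Composition n) (i : Fin α.length ↪o ℕ) :
    (expo α i).degree = n := by
  rw [expo, map_sum]
  simp [α.sum_blocksFun]

theorem sum_range_expo {n : ℕ} (α : Composition n) (i : Fin α.length ↪o ℕ) {t s : ℕ}
    (h : ∀ k, i k < t ↔ (k : ℕ) < s) : ∑ j ∈ Finset.range t, expo α i j = α.sizeUpTo s := by
  have e : α.sizeUpTo s = ∑ k with k.val < s, α.blocksFun k := by
    rw [← List.sum_take_ofFn, α.ofFn_blocksFun]
    rfl
  simp only [expo, Finsupp.finsetSum_apply]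
  rw [Finset.sum_comm, e, Finset.sum_filter]
  refine Finset.sum_congr rfl fun k _ => ?_
  rw [← if_congr (h k) rfl rfl]
  split_ifs with hk
  · rw [Finset.sum_eq_single (i k)]
    · simp
    · intro j _ hj
      exact Finsupp.single_eq_of_ne hj
    · intro hn
      exact absurd (Finset.mem_range.2 hk) hn
  · refine Finset.sum_eq_zero fun j hj => Finsupp.single_eq_of_ne ?_
    rintro rfl
    exact hk (Finset.mem_range.1 hj)

theorem mem_partialSums_expo {n : ℕ} (α : Composition n) (i : Fin α.length ↪o ℕ) {k : ℕ}
    (h0 : 0 < k) (hn : k < n) : k ∈ partialSums (expo α i) ↔ k ∈ D α := by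
  rw [mem_D]
  constructor
  · rintro ⟨t, rfl⟩
    refine ⟨h0, hn, ?_⟩
    by_cases h : ∃ l, t ≤ i l
    · obtain ⟨m, hm, hmin⟩ := WellFounded.has_min (wellFounded_lt (α := Fin α.length))
        {l | t ≤ i l} h
      refine ⟨m, (sum_range_expo α i fun l => ?_).symm⟩
      constructor
      · intro hl
        by_contra hlm
        exact absurd hl (not_lt.2 (le_trans hm (i.monotone (Fin.le_def.2 (not_lt.1 hlm)))))
      · intro hl
        by_contra hlt
        exact hmin l (not_lt.1 hlt) (Fin.lt_def.2 hl)
    · refine ⟨α.length, (sum_range_expo α i fun l => ?_).symm⟩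
      exact iff_of_true (not_le.1 fun hl => h ⟨l, hl⟩) l.2
  · rintro ⟨-, -, s, hs⟩
    have hlt : s < α.length := by
      by_contra h
      rw [α.sizeUpTo_ofLength_le s (not_lt.1 h)] at hs
      omega
    refine ⟨i ⟨s, hlt⟩, ?_⟩
    rw [sum_range_expo α i (s := s) fun l => ?_, hs]
    rw [i.lt_iff_lt, Fin.lt_def]

theorem exists_eq_expo (d : ℕ →₀ ℕ) :
    ∃ (α : Composition d.degree) (i : Fin α.length ↪o ℕ), d = expo α i := by
  let s := d.support
  let f := s.orderEmbOfFin rfl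
  let α : Composition d.degree :=
    { blocks := List.ofFn fun k => d (f k)
      blocks_pos := by
        intro b hb
        obtain ⟨k, rfl⟩ := (List.mem_ofFn' _ _).1 hb
        exact Nat.pos_of_ne_zero (Finsupp.mem_support_iff.1 (s.orderEmbOfFin_mem rfl k))
      blocks_sum := by
        rw [List.sum_ofFn, Finsupp.degree_apply, ← Finset.sum_coe_sort d.support]
        exact (s.orderIsoOfFin rfl).toEquiv.sum_comp fun x : s => d x }
  have hl : s.card = α.length := (List.length_ofFn ..).symm
  refine ⟨α, s.orderEmbOfFin hl, ?_⟩
  have hb : ∀ k, α.blocksFun k = d (s.orderEmbOfFin hl k) := by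
    intro k
    simp only [Composition.blocksFun, α, List.get_ofFn, f]
    rfl
  rw [expo]
  simp only [hb]
  rw [← Finset.sum_image (f := fun x => Finsupp.single x (d x))
    (fun a _ b _ h => (s.orderEmbOfFin hl).injective h), Finset.image_orderEmbOfFin_univ]
  exact (Finsupp.sum_single d).symm

/-- The monomials of `M_α` are those whose exponents have the partial sums `D(α)`. -/
theorem exists_expo_iff {n : ℕ} (α : Composition n) (d : ℕ →₀ ℕ) : (∃ i, d = expo α i) ↔
    d.degree = n ∧ ∀ k, 0 < k → k < n → (k ∈ partialSums d ↔ k ∈ D α) := by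
  constructor
  · rintro ⟨i, rfl⟩
    exact ⟨degree_expo α i, fun k h0 hn => mem_partialSums_expo α i h0 hn⟩
  · rintro ⟨rfl, h⟩
    obtain ⟨β, i, hd⟩ := exists_eq_expo d
    have hβ : β = α := by
      apply D_injective
      ext k
      by_cases hk : 0 < k ∧ k < d.degree
      · rw [← h k hk.1 hk.2, ← mem_partialSums_expo β i hk.1 hk.2, ← hd]
      · exact iff_of_false (fun hm => hk ⟨(mem_D.1 hm).1, (mem_D.1 hm).2.1⟩)
          (fun hm => hk ⟨(mem_D.1 hm).1, (mem_D.1 hm).2.1⟩)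
    subst hβ
    exact ⟨i, hd⟩

theorem eq_of_expo_eq {n : ℕ} {α β : Composition n} {i : Fin α.length ↪o ℕ}
    {j : Fin β.length ↪o ℕ} (h : expo α i = expo β j) : α = β := by
  apply D_injective
  ext k
  by_cases hk : 0 < k ∧ k < n
  · rw [← mem_partialSums_expo α i hk.1 hk.2, ← mem_partialSums_expo β j hk.1 hk.2, h]
  · exact iff_of_false (fun hm => hk ⟨(mem_D.1 hm).1, (mem_D.1 hm).2.1⟩)
      (fun hm => hk ⟨(mem_D.1 hm).1, (mem_D.1 hm).2.1⟩)

theorem coeff_expo_eq {f : Series} (hf : IsQuasisymmetric f) {n : ℕ} (α : Composition n)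
    (i j : Fin α.length ↪o ℕ) :
    MvPowerSeries.coeff (expo α i) f = MvPowerSeries.coeff (expo α j) f := by
  have h : ∀ i : Fin α.length ↪o ℕ,
      expo α i = (∑ k, Finsupp.single k (α.blocksFun k)).mapDomain i := by
    intro i
    rw [expo, Finsupp.mapDomain_finsetSum]
    simp only [Finsupp.mapDomain_single]
  rw [h, h]
  exact hf _ _ i j

/-- The composition whose descents are the partial sums of `d`. -/
theorem exists_D_eq_partialSums (n : ℕ) (d : ℕ →₀ ℕ) : ∃ β : Composition n,
    ∀ k, k ∈ D β ↔ 0 < k ∧ k < n ∧ k ∈ partialSums d := by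
  classical
  obtain ⟨β, hβ⟩ := exists_D_eq (n := n)
    (S := {k ∈ Finset.Ioo 0 n | k ∈ partialSums d}) (fun k hk => by simpa using (Finset.mem_filter.1 hk).1)
  refine ⟨β, fun k => ?_⟩
  rw [hβ, Finset.mem_filter, Finset.mem_Ioo, and_assoc]

open Classical in
theorem coeff_F {n : ℕ} (α : Composition n) (d : ℕ →₀ ℕ) :
    MvPowerSeries.coeff d (F α) =
      if d.degree = n ∧ ∀ k ∈ D α, k ∈ partialSums d then 1 else 0 := by
  rw [F, map_sum]
  simp only [coeff_M]
  obtain ⟨β, hβ⟩ := exists_D_eq_partialSums n d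
  have hiff : ∀ γ : Composition n, (∃ i, d = expo γ i) ↔ d.degree = n ∧ γ = β := by
    intro γ
    rw [exists_expo_iff]
    refine and_congr_right fun _ => ⟨fun h => D_injective ?_, ?_⟩
    · ext k
      rw [hβ]
      constructor
      · intro hk
        exact ⟨(mem_D.1 hk).1, (mem_D.1 hk).2.1, (h k (mem_D.1 hk).1 (mem_D.1 hk).2.1).2 hk⟩
      · rintro ⟨h0, hn, hk⟩
        exact (h k h0 hn).1 hk
    · rintro rfl k h0 hn
      rw [hβ]
      exact ⟨fun hk => ⟨h0, hn, hk⟩, fun hk => hk.2.2⟩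
  simp only [hiff]
  by_cases hd : d.degree = n
  · simp only [hd, true_and]
    rw [Finset.sum_ite_eq']
    refine if_congr ?_ rfl rfl
    simp only [Finset.mem_filter, Finset.mem_univ, true_and]
    refine ⟨fun h k hk => ((hβ k).1 (h hk)).2.2, fun h k hk => ?_⟩
    exact (hβ k).2 ⟨(mem_D.1 hk).1, (mem_D.1 hk).2.1, h k hk⟩
  · simp [hd]

/-- The matrix expressing the `F_α` through the `M_β` is unitriangular for the order given by inclusion
of descent sets. -/
theorem MQ_mem_closure_FQ {n : ℕ} (α : Composition n) :
    MQ α ∈ AddSubgroup.closure {f : QSym | ∃ (n : ℕ) (α : Composition n), f = FQ α} := by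
  induction h : n - (D α).card using Nat.strong_induction_on generalizing α with
  | _ m ih =>
    classical
    subst h
    have hcard : ∀ β : Composition n, D β ⊆ Finset.range n := fun β k hk =>
      Finset.mem_range.2 (mem_D.1 hk).2.1
    have e : MQ α = FQ α - ∑ β : Composition n with D α ⊂ D β, MQ β := by
      rw [eq_sub_iff_add_eq]
      apply Subtype.ext
      rw [Subring.coe_add, AddSubmonoidClass.coe_finsetSum]
      change M α + ∑ β : Composition n with D α ⊂ D β, M β = ∑ β : Composition n with D α ⊆ D β, M β
      rw [← Finset.sum_insert (by simp)]
      refine Finset.sum_congr ?_ fun _ _ => rfl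
      ext β
      simp only [Finset.mem_insert, Finset.mem_filter, Finset.mem_univ, true_and]
      rw [Finset.ssubset_iff_subset_ne]
      constructor
      · rintro (rfl | h)
        · exact Finset.Subset.refl _
        · exact h.1
      · intro h
        by_cases hβ : D α = D β
        · exact Or.inl (D_injective hβ.symm)
        · exact Or.inr ⟨h, hβ⟩
    rw [e]
    refine sub_mem (AddSubgroup.subset_closure ⟨n, α, rfl⟩) (sum_mem fun β hβ => ih _ ?_ β rfl)
    have h1 := Finset.card_lt_card (Finset.mem_filter.1 hβ).2
    have h2 := Finset.card_le_card (hcard β)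
    rw [Finset.card_range] at h2
    omega

/-- The fundamental quasisymmetric functions span `QSym`. -/
theorem closure_FQ :
    AddSubgroup.closure {f : QSym | ∃ (n : ℕ) (α : Composition n), f = FQ α} = ⊤ := by
  classical
  rw [eq_top_iff]
  rintro f -
  obtain ⟨N, hN⟩ := f.2.1
  let c : ∀ n, Composition n → ℤ := fun n α =>
    MvPowerSeries.coeff (expo α (Fin.valOrderEmb _)) (f : Series)
  have e : f = ∑ n ∈ Finset.range (N + 1), ∑ α : Composition n, c n α • MQ α := by
    apply Subtype.ext
    ext d
    rw [AddSubmonoidClass.coe_finsetSum, map_sum]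
    have hterm : ∀ n (α : Composition n), MvPowerSeries.coeff d ((c n α • MQ α : QSym) : Series) =
        c n α * if ∃ i, d = expo α i then 1 else 0 := by
      intro n α
      rw [AddSubgroupClass.coe_zsmul, map_zsmul, smul_eq_mul]
      exact congrArg _ (coeff_M α d)
    simp only [AddSubmonoidClass.coe_finsetSum, map_sum, hterm]
    obtain ⟨β, i, hd⟩ := exists_eq_expo d
    have hinner : ∑ α : Composition d.degree, c d.degree α * (if ∃ i, d = expo α i then 1 else 0) =
        MvPowerSeries.coeff d (f : Series) := by
      rw [Finset.sum_eq_single β]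
      · rw [if_pos ⟨i, hd⟩, mul_one]
        conv_rhs => rw [hd]
        exact coeff_expo_eq f.2.2 β _ _
      · intro α _ hα
        rw [if_neg, mul_zero]
        rintro ⟨j, hj⟩
        exact hα (eq_of_expo_eq (hj.symm.trans hd))
      · intro h
        exact absurd (Finset.mem_univ _) h
    by_cases hdN : d.degree ∈ Finset.range (N + 1)
    · rw [Finset.sum_eq_single_of_mem _ hdN, hinner]
      intro n _ hn
      refine Finset.sum_eq_zero fun α _ => ?_
      rw [if_neg, mul_zero]
      rintro ⟨j, rfl⟩
      exact hn (degree_expo α j).symm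
    · rw [hN d (by simpa using hdN)]
      symm
      refine Finset.sum_eq_zero fun n hn => Finset.sum_eq_zero fun α _ => ?_
      rw [if_neg, mul_zero]
      rintro ⟨j, rfl⟩
      rw [degree_expo] at hdN
      exact hdN hn
  rw [e]
  exact sum_mem fun n _ => sum_mem fun α _ => zsmul_mem (MQ_mem_closure_FQ α) _

theorem exists_expo_dilate_iff {k : ℕ} (hk : 0 < k) {n : ℕ} (α : Composition n) (d : ℕ →₀ ℕ) :
    (∃ i, d = expo (dilate k hk α) i) ↔ ∃ i, d = k • expo α i := by
  have hl : α.length = (dilate k hk α).length := (List.length_map _).symm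
  have hb : ∀ t, (dilate k hk α).blocksFun (Fin.cast hl t) = k * α.blocksFun t := by
    intro t
    simp only [Composition.blocksFun, dilate, List.get_eq_getElem, List.getElem_map]
    rfl
  have key : ∀ i : Fin (dilate k hk α).length ↪o ℕ, expo (dilate k hk α) i =
      k • expo α ((Fin.castOrderIso hl).toOrderEmbedding.trans i) := by
    intro i
    rw [expo, expo, Finset.smul_sum, ← (Fin.castOrderIso hl).toEquiv.sum_comp]
    refine Finset.sum_congr rfl fun t _ => ?_
    rw [Finsupp.smul_single, smul_eq_mul, ← hb]
    rfl
  constructor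
  · rintro ⟨i, rfl⟩
    exact ⟨_, key i⟩
  · rintro ⟨i, rfl⟩
    refine ⟨(Fin.castOrderIso hl.symm).toOrderEmbedding.trans i, ?_⟩
    rw [key]
    rfl

theorem psi_MQ {k : ℕ} (hk : 0 < k) {n : ℕ} (α : Composition n) :
    adamsQSym.psi k (MQ α) = MQ (dilate k hk α) := by
  classical
  apply Subtype.ext
  change psiSer k (M α) = M (dilate k hk α)
  ext d
  rw [coeff_M]
  simp only [exists_expo_dilate_iff hk]
  by_cases hd : ∀ i, k ∣ d i
  · obtain ⟨d, rfl⟩ := exists_eq_smul_of_dvd hd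
    rw [coeff_smul_psiSer hk, coeff_M]
    refine if_congr (exists_congr fun i => ?_) rfl rfl
    exact (nsmul_right_injective hk.ne').eq_iff.symm
  · obtain ⟨i, hi⟩ := not_forall.1 hd
    rw [coeff_psiSer_of_not_dvd hk hi, if_neg]
    rintro ⟨j, rfl⟩
    exact hi ⟨expo α j i, by simp⟩

/-! ### The image of the fundamental basis -/

open Classical in
/-- The series whose coefficient at an exponent `d` of degree `m` is `1` if the elements of `S`
strictly between `0` and `m` are partial sums of `d`, and `0` otherwise. For `S = D(α)` this is
`F_α`. -/
def descSer (S : Set ℕ) (m : ℕ) : Series := fun d =>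
  if d.degree = m ∧ ∀ k ∈ S, 0 < k → k < m → k ∈ partialSums d then 1 else 0

open Classical in
theorem coeff_descSer (S : Set ℕ) (m : ℕ) (d : ℕ →₀ ℕ) :
    MvPowerSeries.coeff d (descSer S m) =
      if d.degree = m ∧ ∀ k ∈ S, 0 < k → k < m → k ∈ partialSums d then 1 else 0 := rfl

theorem descSer_eq_F {n : ℕ} (α : Composition n) {S : Set ℕ}
    (hS : ∀ k, 0 < k → k < n → (k ∈ S ↔ k ∈ D α)) : descSer S n = F α := by
  classical
  ext d
  rw [coeff_descSer, coeff_F]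
  refine if_congr (and_congr_right fun _ => ⟨fun h k hk => ?_, fun h k hk h0 hn => ?_⟩) rfl rfl
  · have := mem_D.1 hk
    exact h k ((hS k this.1 this.2.1).2 hk) this.1 this.2.1
  · exact h k ((hS k h0 hn).1 hk)

theorem descSer_mem (S : Set ℕ) (m : ℕ) : descSer S m ∈ QSym := by
  classical
  obtain ⟨α, hα⟩ := exists_D_eq (n := m) (S := {k ∈ Finset.Ioo 0 m | k ∈ S})
    (fun k hk => by simpa using (Finset.mem_filter.1 hk).1)
  rw [descSer_eq_F α fun k h0 hm => by simp [hα, h0, hm]]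
  exact F_mem α

/-- `descSer` as an element of `QSym`. -/
def descQ (S : Set ℕ) (m : ℕ) : QSym := ⟨descSer S m, descSer_mem S m⟩

/-- The set `S - n`. -/
def translate (n : ℕ) (S : Set ℕ) : Set ℕ := {k | k + n ∈ S}

theorem mem_translate {n k : ℕ} {S : Set ℕ} : k ∈ translate n S ↔ k + n ∈ S := Iff.rfl

theorem translate_zero (S : Set ℕ) : translate 0 S = S := rfl

theorem translate_translate (i j : ℕ) (S : Set ℕ) :
    translate j (translate i S) = translate (i + j) S := by
  ext k
  rw [mem_translate, mem_translate, mem_translate, add_assoc, add_comm j i]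

theorem mem_partialSums_consE {n k : ℕ} {d : ℕ →₀ ℕ} :
    k ∈ partialSums (consE n d) ↔ k = 0 ∨ ∃ s ∈ partialSums d, k = n + s := by
  have h : ∀ t, ∑ j ∈ Finset.range (t + 1), consE n d j = n + ∑ j ∈ Finset.range t, d j := by
    intro t
    rw [Finset.sum_range_succ', consE_zero_apply, add_comm]
    simp only [consE_succ_apply]
  constructor
  · rintro ⟨t, rfl⟩
    cases t with
    | zero => exact Or.inl (Finset.sum_range_zero _)
    | succ t => exact Or.inr ⟨_, ⟨t, rfl⟩, h t⟩
  · rintro (rfl | ⟨_, ⟨t, rfl⟩, rfl⟩)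
    · exact ⟨0, Finset.sum_range_zero _⟩
    · exact ⟨t + 1, h t⟩

theorem zero_mem_partialSums (d : ℕ →₀ ℕ) : 0 ∈ partialSums d := ⟨0, Finset.sum_range_zero _⟩

open Classical in
theorem shiftQ_descQ (n : ℕ) (S : Set ℕ) (m : ℕ) : shiftQ n (descQ S m) =
    if n ≤ m ∧ ∀ k, 0 < k → k < n → k ∉ S then descQ (translate n S) (m - n) else 0 := by
  apply Subtype.ext
  ext d
  rw [coe_shiftQ, coeff_shift]
  change MvPowerSeries.coeff _ (descSer S m) = _
  rw [coeff_descSer, degree_consE]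
  split_ifs with h1 h2 h2
  · symm
    change MvPowerSeries.coeff _ (descSer _ _) = _
    rw [coeff_descSer, if_pos]
    refine ⟨by omega, fun k hk h0 hm => ?_⟩
    rcases mem_partialSums_consE.1 (h1.2 _ hk (by omega) (by omega)) with h | ⟨s, hs, h⟩
    · omega
    · rwa [show k = s by omega]
  · exfalso
    refine h2 ⟨by omega, fun k h0 hn hk => ?_⟩
    rcases mem_partialSums_consE.1 (h1.2 _ hk h0 (by omega)) with h | ⟨s, hs, h⟩ <;> omega
  · symm
    change MvPowerSeries.coeff _ (descSer _ _) = _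
    rw [coeff_descSer, if_neg]
    rintro ⟨h3, h4⟩
    refine h1 ⟨by omega, fun k hk h0 hm => ?_⟩
    rw [mem_partialSums_consE]
    rcases lt_or_ge k n with hkn | hkn
    · exact absurd hk (h2.2 k h0 hkn)
    · refine Or.inr ⟨k - n, ?_, by omega⟩
      rcases Nat.eq_zero_or_pos (k - n) with h5 | h5
      · rw [h5]
        exact zero_mem_partialSums d
      · refine h4 _ ?_ h5 (by omega)
        rwa [mem_translate, Nat.sub_add_cancel hkn]
  · rfl

/-- The descents strictly between `0` and `n` form an initial segment of `{1, …, n - 1}`, i.e. they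
have no peak there. -/
def NoPeak (S : Set ℕ) (n : ℕ) : Prop := ∀ k, 0 < k → k + 1 < n → k + 1 ∈ S → k ∈ S

open Classical in
/-- The number of ways to cut `{1, …, n - 1}` at some `i ≤ n` such that all elements below `i` and none
of those above `i` belong to `S`, each counted with the weight `z^i`; there is no condition at `i`. -/
def splitSum (S : Set ℕ) (z : ℤ) (n : ℕ) : ℤ :=
  ∑ i ∈ Finset.range (n + 1),
    if (∀ k, 0 < k → k < i → k ∈ S) ∧ (∀ k, i < k → k < n → k ∉ S) then z ^ i else 0

theorem splitSum_one (S : Set ℕ) (z : ℤ) : splitSum S z 1 = 1 + z := by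
  rw [splitSum, Finset.sum_range_succ, Finset.sum_range_one, if_pos, if_pos]
  · simp
  · exact ⟨fun k h1 h2 => by omega, fun k h1 h2 => by omega⟩
  · exact ⟨fun k h1 h2 => by omega, fun k h1 h2 => by omega⟩

open Classical in
theorem splitSum_of_notMem {S : Set ℕ} {n : ℕ} (h : n + 1 ∉ S) (z : ℤ) :
    splitSum S z (n + 2) = splitSum S z (n + 1) := by
  rw [splitSum, Finset.sum_range_succ, if_neg fun h' => h (h'.1 _ (by omega) (by omega)), add_zero,
    splitSum]
  refine Finset.sum_congr rfl fun i _ => if_congr (and_congr_right fun _ => ?_) rfl rfl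
  refine ⟨fun h' k hk hn => h' k hk (by omega), fun h' k hk hn => ?_⟩
  rcases Nat.lt_or_ge k (n + 1) with h1 | h1
  · exact h' k hk h1
  · rwa [show k = n + 1 by omega]

open Classical in
theorem splitSum_of_mem {S : Set ℕ} {n : ℕ} (h : n + 1 ∈ S) (z : ℤ) :
    splitSum S z (n + 2) =
      if ∀ k, 0 < k → k < n + 1 → k ∈ S then z ^ (n + 1) + z ^ (n + 2) else 0 := by
  rw [splitSum, Finset.sum_range_succ, Finset.sum_range_succ, Finset.sum_eq_zero, zero_add]
  · have h1 : ((∀ k, 0 < k → k < n + 1 → k ∈ S) ∧ ∀ k, n + 1 < k → k < n + 2 → k ∉ S) ↔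
        ∀ k, 0 < k → k < n + 1 → k ∈ S :=
      and_iff_left fun k h1 h2 => by omega
    have h2 : ((∀ k, 0 < k → k < n + 2 → k ∈ S) ∧ ∀ k, n + 2 < k → k < n + 2 → k ∉ S) ↔
        ∀ k, 0 < k → k < n + 1 → k ∈ S := by
      refine ⟨fun h' k h0 hk => h'.1 k h0 (by omega), fun h' => ⟨fun k h0 hk => ?_, fun k h1 h2 => by
        omega⟩⟩
      rcases Nat.lt_or_ge k (n + 1) with h1 | h1
      · exact h' k h0 h1
      · rwa [show k = n + 1 by omega]
    rw [if_congr h1 rfl rfl, if_congr h2 rfl rfl]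
    split_ifs <;> simp
  · intro i hi
    rw [if_neg]
    intro h'
    have := Finset.mem_range.1 hi
    exact h'.2 (n + 1) (by omega) (by omega) h

/-- The cut points come in pairs of neighbours. -/
theorem splitSum_neg_one (S : Set ℕ) (n : ℕ) : splitSum S (-1) (n + 1) = 0 := by
  induction n with
  | zero => rw [splitSum_one]; norm_num
  | succ n ih =>
    by_cases h : n + 1 ∈ S
    · rw [splitSum_of_mem h]
      split_ifs
      · ring
      · rfl
    · rw [splitSum_of_notMem h, ih]

open Classical in
theorem splitSum_one_eq (S : Set ℕ) (n : ℕ) :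
    splitSum S 1 (n + 1) = if NoPeak S (n + 1) then 2 else 0 := by
  induction n with
  | zero =>
    rw [splitSum_one, if_pos (show NoPeak S (0 + 1) from fun k h0 h1 => by omega)]
    norm_num
  | succ n ih =>
    by_cases h : n + 1 ∈ S
    · rw [splitSum_of_mem h]
      refine if_congr ⟨fun h' k h0 h1 _ => h' k h0 (by omega), fun h' => ?_⟩ (by norm_num) rfl
      have key : ∀ j, j ≤ n → n + 1 - j ∈ S := by
        intro j
        induction j with
        | zero => intro _; exact h
        | succ j ihj =>
          intro hj
          refine h' _ (by omega) (by omega) ?_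
          rw [show n + 1 - (j + 1) + 1 = n + 1 - j by omega]
          exact ihj (by omega)
      intro k h0 hk
      rw [show k = n + 1 - (n + 1 - k) by omega]
      exact key _ (by omega)
    · rw [splitSum_of_notMem h, ih]
      refine if_congr ⟨fun h' k h0 h1 hk => ?_, fun h' k h0 h1 hk => h' k h0 (by omega) hk⟩ rfl rfl
      rcases Nat.lt_or_ge (k + 1) (n + 1) with h2 | h2
      · exact h' k h0 h2 hk
      · exact absurd (show n + 1 ∈ S by rwa [show n + 1 = k + 1 by omega]) h

open Classical in
/-- The coefficient of `t^i` in `D(-t)⁻¹ F`, where `D(t) = ∑_n shiftQ n t^n` and `F = descQ S m`. While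
`shiftQ i` is nonzero on `F` if there are no descents below `i`, here all positions below `i` must be
descents. -/
def antiDesc (S : Set ℕ) (m i : ℕ) : QSym :=
  if i ≤ m ∧ ∀ k, 0 < k → k < i → k ∈ S then descQ (translate i S) (m - i) else 0

open Classical in
theorem sum_shiftQ_antiDesc (S : Set ℕ) (m : ℕ) (z : ℤ) (n : ℕ) :
    ∑ ij ∈ antidiagonal n, z ^ ij.2 • shiftQ ij.1 (antiDesc S m ij.2) =
      splitSum S z n • if n ≤ m then descQ (translate n S) (m - n) else 0 := by
  rw [Finset.Nat.sum_antidiagonal_eq_sum_range_succ_mk, ← Finset.sum_range_reflect, splitSum,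
    Finset.sum_smul]
  refine Finset.sum_congr rfl fun i hi => ?_
  have hi' := Finset.mem_range.1 hi
  simp only [show n + 1 - 1 - i = n - i by omega, show n - (n - i) = i by omega]
  rw [antiDesc]
  by_cases h1 : i ≤ m ∧ ∀ k, 0 < k → k < i → k ∈ S
  · rw [if_pos h1, shiftQ_descQ, translate_translate, show i + (n - i) = n by omega,
      show m - i - (n - i) = m - n by omega]
    by_cases h2 : ∀ k, i < k → k < n → k ∉ S
    · rw [if_pos (⟨h1.2, h2⟩ : (∀ k, 0 < k → k < i → k ∈ S) ∧ ∀ k, i < k → k < n → k ∉ S)]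
      congr 1
      refine if_congr ⟨fun h => by omega, fun h => ⟨by omega, fun k h0 hk => ?_⟩⟩ rfl rfl
      rw [mem_translate]
      exact h2 _ (by omega) (by omega)
    · rw [if_neg fun h : (∀ k, 0 < k → k < i → k ∈ S) ∧ _ => h2 h.2, zero_smul, if_neg, smul_zero]
      rintro ⟨-, h⟩
      refine h2 fun k hk hkn hkS => h (k - i) (by omega) (by omega) ?_
      rwa [mem_translate, Nat.sub_add_cancel hk.le]
  · rw [if_neg h1, map_zero, smul_zero]
    by_cases h3 : n ≤ m
    · rw [if_neg fun h : (∀ k, 0 < k → k < i → k ∈ S) ∧ (∀ k, i < k → k < n → k ∉ S) =>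
        h1 ⟨by omega, h.1⟩, zero_smul]
    · rw [if_neg h3, smul_zero]

open Classical in
theorem peakDer_descQ (n : ℕ) (S : Set ℕ) (m : ℕ) : peakDer n (descQ S m) =
    if n ≤ m ∧ NoPeak S n then (if n = 0 then (1 : ℤ) else 2) • descQ (translate n S) (m - n)
    else 0 := by
  have h0 : antiDesc S m 0 = descQ S m := by
    rw [antiDesc, if_pos ⟨Nat.zero_le m, fun k h1 h2 => by omega⟩, translate_zero, Nat.sub_zero]
  have key : peakDer n (descQ S m) =
      splitSum S 1 n • if n ≤ m then descQ (translate n S) (m - n) else 0 := by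
    rw [peakDer, superDer_eq_sum isHigherDerivation_shiftQ h0, ← sum_shiftQ_antiDesc]
    · simp
    · intro n
      have h := sum_shiftQ_antiDesc S m (-1) (n + 1)
      rw [splitSum_neg_one, zero_smul] at h
      rw [← h]
      refine Finset.sum_congr rfl fun ij _ => ?_
      rw [zsmul_eq_mul]
      push_cast
      rfl
  rw [key]
  cases n with
  | zero =>
    have hs : splitSum S 1 0 = 1 := by
      rw [splitSum, Finset.sum_range_one, if_pos, pow_zero]
      exact ⟨fun k h1 h2 => by omega, fun k h1 h2 => by omega⟩
    rw [hs, if_pos (Nat.zero_le m), if_pos ⟨Nat.zero_le m, fun k h1 h2 => by omega⟩, if_pos rfl]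
  | succ n =>
    rw [splitSum_one_eq, if_neg (Nat.succ_ne_zero n)]
    by_cases h1 : n + 1 ≤ m <;> by_cases h2 : NoPeak S (n + 1) <;> simp [h1, h2]

/-- The peaks of `S` strictly between `0` and `m` all are partial sums of `d` or successors of partial
sums of `d`. -/
def PeaksCovered (S : Set ℕ) (m : ℕ) (d : ℕ →₀ ℕ) : Prop :=
  ∀ k, 0 < k → k + 1 < m → k + 1 ∈ S → k ∉ S → k ∈ partialSums d ∨ k + 1 ∈ partialSums d

theorem peaksCovered_consE_iff {S : Set ℕ} {m n : ℕ} {d : ℕ →₀ ℕ} (hn : n ≤ m) :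
    PeaksCovered S m (consE n d) ↔ NoPeak S n ∧ PeaksCovered (translate n S) (m - n) d := by
  constructor
  · intro h
    refine ⟨fun k h0 h1 hk => ?_, fun k h0 h1 hk hk' => ?_⟩
    · by_contra hkS
      rcases h k h0 (by omega) hk hkS with h2 | h2 <;>
        rcases mem_partialSums_consE.1 h2 with h3 | ⟨s, -, h3⟩ <;> omega
    · rw [mem_translate] at hk hk'
      rw [add_right_comm] at hk
      rcases h (k + n) (by omega) (by omega) hk hk' with h2 | h2 <;>
        rcases mem_partialSums_consE.1 h2 with h3 | ⟨s, hs, h3⟩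
      · omega
      · exact Or.inl (by rwa [show k = s by omega])
      · omega
      · exact Or.inr (by rwa [show k + 1 = s by omega])
  · rintro ⟨h1, h2⟩ k h0 hkm hk hk'
    simp only [mem_partialSums_consE]
    rcases lt_trichotomy (k + 1) n with h3 | h3 | h3
    · exact absurd (h1 k h0 h3 hk) hk'
    · exact Or.inr (Or.inr ⟨0, zero_mem_partialSums d, by omega⟩)
    rcases Nat.eq_or_lt_of_le (Nat.le_of_lt_succ h3) with h4 | h4
    · exact Or.inl (Or.inr ⟨0, zero_mem_partialSums d, by omega⟩)
    · obtain ⟨j, rfl⟩ : ∃ j, k = j + n := ⟨k - n, by omega⟩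
      rcases h2 j (by omega) (by omega) (by rwa [mem_translate, add_right_comm])
        (by rwa [mem_translate]) with h5 | h5
      · exact Or.inl (Or.inr ⟨j, h5, by omega⟩)
      · exact Or.inr (Or.inr ⟨j + 1, h5, by omega⟩)

theorem card_support_consE (n : ℕ) (d : ℕ →₀ ℕ) :
    (consE n d).support.card = (if n = 0 then 0 else 1) + d.support.card := by
  classical
  have h : (consE n d).support =
      (if n = 0 then ∅ else {0}) ∪ d.support.map ⟨Nat.succ, Nat.succ_injective⟩ := by
    ext k
    cases k with
    | zero => by_cases hn : n = 0 <;> simp [consE_zero_apply, hn]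
    | succ k => by_cases hn : n = 0 <;> simp [consE_succ_apply, hn]
  rw [h, Finset.card_union_of_disjoint, Finset.card_map]
  · split_ifs <;> simp
  · rw [Finset.disjoint_left]
    intro k hk
    split_ifs at hk with hn
    · simp at hk
    · simp only [Finset.mem_singleton] at hk
      simp [hk]

open Classical in
/-- By induction on the number of variables: each nonzero exponent contributes a factor `2`, provided
that no peak lies strictly inside the interval of positions which it occupies. -/
theorem coeff_thetaFun_descQ (S : Set ℕ) (m : ℕ) (d : ℕ →₀ ℕ) :
    MvPowerSeries.coeff d (thetaFun (descQ S m)) =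
      if d.degree = m ∧ PeaksCovered S m d then 2 ^ d.support.card else 0 := by
  induction d using consE_induction generalizing S m with
  | h0 =>
    rw [coeff_zero_thetaFun, ← MvPowerSeries.coeff_zero_eq_constantCoeff_apply]
    change MvPowerSeries.coeff 0 (descSer S m) = _
    rw [coeff_descSer]
    refine if_congr (and_congr_right ?_) (by simp) rfl
    intro h
    rw [map_zero] at h
    subst h
    exact iff_of_true (fun k _ _ h => absurd h (Nat.not_lt_zero k))
      (fun k _ h => absurd h (Nat.not_lt_zero _))
  | h n d ih =>
    rw [coeff_consE_thetaFun, peakDer_descQ, degree_consE, card_support_consE]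
    by_cases hn : n ≤ m
    · have hcov := peaksCovered_consE_iff (S := S) (d := d) hn
      by_cases h1 : NoPeak S n
      · rw [if_pos ⟨hn, h1⟩]
        have hs : ∀ (c : ℤ) (f : QSym), thetaFun (c • f) = c • thetaFun f := fun c f =>
          map_zsmul thetaHom c f
        rw [hs, map_zsmul, ih, smul_eq_mul, mul_ite, mul_zero]
        refine if_congr ?_ ?_ rfl
        · exact and_congr (by omega) (hcov.trans (and_iff_right h1)).symm
        · rw [pow_add]
          split_ifs <;> simp
      · rw [if_neg fun h => h1 h.2, if_neg fun h => h1 (hcov.1 h.2).1, thetaFun_zero, map_zero]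
    · rw [if_neg fun h => hn h.1, if_neg, thetaFun_zero, map_zero]
      rintro ⟨h, -⟩
      omega

/-- The image of `F_α` under the descent-to-peak map. -/
theorem coeff_thetaFun_FQ {n : ℕ} (α : Composition n) (d : ℕ →₀ ℕ)
    [Decidable (d.degree = n ∧ ∀ p ∈ peakSet α, p ∈ partialSums d ∨ p - 1 ∈ partialSums d)] :
    MvPowerSeries.coeff d (thetaFun (FQ α)) =
      if d.degree = n ∧ ∀ p ∈ peakSet α, p ∈ partialSums d ∨ p - 1 ∈ partialSums d
      then 2 ^ d.support.card else 0 := by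
  classical
  have h : FQ α = descQ (D α : Set ℕ) n :=
    Subtype.ext (descSer_eq_F α fun k _ _ => Finset.mem_coe).symm
  rw [h, coeff_thetaFun_descQ]
  refine if_congr (and_congr_right fun _ => ?_) rfl rfl
  constructor
  · intro h' p hp
    simp only [peakSet, Finset.mem_filter, Finset.mem_inter, Finset.mem_Icc] at hp
    obtain ⟨⟨h1, h2, h3⟩, h4⟩ := hp
    obtain ⟨k, rfl⟩ : ∃ k, p = k + 1 := ⟨p - 1, by omega⟩
    exact (h' k (by omega) (by omega) h1 h4).symm
  · intro h' k h0 hk h1 h2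
    refine (h' (k + 1) ?_).symm
    simp only [peakSet, Finset.mem_filter, Finset.mem_inter, Finset.mem_Icc]
    exact ⟨⟨h1, by omega, by omega⟩, h2⟩

/-! ### The peak functions -/

/-- `T` chooses exactly one element from each of the pairs `{p - 1, p}`, for `p ∈ P`. -/
def Chooses (P T : Finset ℕ) : Prop := ∀ p ∈ P, ¬ (p ∈ T ↔ p - 1 ∈ T)

open Classical in
/-- The pairs `{p - 1, p}` for `p` in a peak set are disjoint, so each of them halves the number of
subsets choosing exactly one of its elements. -/
theorem card_chooses_mul {P : Finset ℕ} (h1 : ∀ p ∈ P, 1 ≤ p) (hP : ∀ p ∈ P, p - 1 ∉ P)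
    {T : Finset ℕ} (hT : ∀ p ∈ P, p ∈ T ∨ p - 1 ∈ T) :
    ({S ∈ T.powerset | Chooses P S} : Finset (Finset ℕ)).card * 2 ^ P.card = 2 ^ T.card := by
  induction P using Finset.induction_on with
  | empty => simp [Chooses]
  | insert q P hq ih =>
    have hq1 := h1 q (Finset.mem_insert_self q P)
    have ih' := ih (fun p hp => h1 p (Finset.mem_insert_of_mem hp))
      (fun p hp hp' => hP p (Finset.mem_insert_of_mem hp) (Finset.mem_insert_of_mem hp'))
      (fun p hp => hT p (Finset.mem_insert_of_mem hp))
    -- toggling an element `t ∈ T` of the pair of `q` only affects the condition at `q`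
    obtain ⟨t, htT, ht⟩ : ∃ t ∈ T, t = q ∨ t = q - 1 := by
      rcases hT q (Finset.mem_insert_self q P) with h | h
      · exact ⟨q, h, Or.inl rfl⟩
      · exact ⟨q - 1, h, Or.inr rfl⟩
    have htP : ∀ p ∈ P, p ≠ t ∧ p - 1 ≠ t := by
      intro p hp
      have e1 := hP q (Finset.mem_insert_self q P)
      have e2 := hP p (Finset.mem_insert_of_mem hp)
      have e3 : p ≠ q := fun h => hq (h ▸ hp)
      have e4 : p ≠ q - 1 := fun h => e1 (h ▸ Finset.mem_insert_of_mem hp)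
      have e5 : p - 1 ≠ q := fun h => e2 (h ▸ Finset.mem_insert_self q P)
      have e6 := h1 p (Finset.mem_insert_of_mem hp)
      rcases ht with rfl | rfl
      · exact ⟨e3, e5⟩
      · exact ⟨e4, by omega⟩
    have hmem : ∀ S : Finset ℕ, ∀ x, x ∈ symmDiff S {t} ↔ (x ∈ S ↔ x ≠ t) := by
      intro S x
      rw [Finset.mem_symmDiff, Finset.mem_singleton]
      by_cases hx : x = t <;> by_cases hS : x ∈ S <;> simp [hx, hS]
    have hcongr : ∀ S, Chooses P (symmDiff S {t}) ↔ Chooses P S := by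
      intro S
      refine forall₂_congr fun p hp => ?_
      rw [hmem, hmem]
      simp [htP p hp]
    have hsplit : ∀ S, Chooses (insert q P) S ↔ Chooses P S ∧ ¬ (q ∈ S ↔ q - 1 ∈ S) := by
      intro S
      rw [Chooses, Finset.forall_mem_insert, and_comm]
      rfl
    have hflip : ∀ S : Finset ℕ, (q ∈ symmDiff S {t} ↔ q - 1 ∈ symmDiff S {t}) ↔
        ¬ (q ∈ S ↔ q - 1 ∈ S) := by
      intro S
      rw [hmem, hmem]
      have : q ≠ q - 1 := by omega
      rcases ht with rfl | rfl
      · simp only [ne_eq, not_true_eq_false, iff_false, this.symm, not_false_eq_true, iff_true]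
        tauto
      · simp only [ne_eq, not_true_eq_false, iff_false, this, not_false_eq_true, iff_true]
        tauto
    have hsub : ∀ S, S ⊆ T → symmDiff S {t} ⊆ T := by
      intro S hS x hx
      rw [Finset.mem_symmDiff, Finset.mem_singleton] at hx
      rcases hx with ⟨h, -⟩ | ⟨rfl, -⟩
      · exact hS h
      · exact htT
    have hcard : ({S ∈ T.powerset | Chooses (insert q P) S} : Finset (Finset ℕ)).card =
        ({S ∈ T.powerset | Chooses P S ∧ (q ∈ S ↔ q - 1 ∈ S)} : Finset (Finset ℕ)).card := by
      refine Finset.card_nbij' (fun S => symmDiff S {t}) (fun S => symmDiff S {t}) ?_ ?_ ?_ ?_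
      · intro S hS
        simp only [Finset.coe_filter, Finset.mem_powerset, Set.mem_ofPred_eq, hsplit] at hS ⊢
        exact ⟨hsub S hS.1, (hcongr S).2 hS.2.1, (hflip S).2 hS.2.2⟩
      · intro S hS
        simp only [Finset.coe_filter, Finset.mem_powerset, Set.mem_ofPred_eq, hsplit] at hS ⊢
        refine ⟨hsub S hS.1, (hcongr S).2 hS.2.1, ?_⟩
        rw [hflip]
        exact not_not.2 hS.2.2
      · intro S _
        exact symmDiff_symmDiff_cancel_right _ _
      · intro S _
        exact symmDiff_symmDiff_cancel_right _ _
    have htot : ({S ∈ T.powerset | Chooses P S} : Finset (Finset ℕ)).card =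
        2 * ({S ∈ T.powerset | Chooses (insert q P) S} : Finset (Finset ℕ)).card := by
      rw [two_mul]
      nth_rw 1 [hcard]
      rw [← Finset.card_filter_add_card_filter_not (s := {S ∈ T.powerset | Chooses P S})
        (fun S => q ∈ S ↔ q - 1 ∈ S), Finset.filter_filter, Finset.filter_filter]
      simp only [hsplit]
    rw [Finset.card_insert_of_notMem hq, pow_succ, ← ih', htot]
    ring

theorem card_D_add_one {n : ℕ} (hn : 1 ≤ n) (α : Composition n) : (D α).card + 1 = α.length := by
  have hlt : ∀ a b, a < b → b < α.length → α.sizeUpTo a < α.sizeUpTo b := fun a b hab hb =>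
    (α.sizeUpTo_strict_mono (hab.trans hb)).trans_le (α.monotone_sizeUpTo hab)
  rw [D, Finset.card_image_of_injOn, Nat.card_Ico]
  · have := α.length_pos_of_pos hn
    omega
  · intro a ha b hb hab
    rw [Finset.coe_Ico, Set.mem_Ico] at ha hb
    change α.sizeUpTo a = α.sizeUpTo b at hab
    rcases lt_trichotomy a b with h | h | h
    · exact absurd hab (hlt a b h hb.2).ne
    · exact h
    · exact absurd hab (hlt b a h ha.2).ne'

theorem card_support_expo {n : ℕ} (α : Composition n) (i : Fin α.length ↪o ℕ) :
    (expo α i).support.card = α.length := by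
  classical
  have h : (expo α i).support = Finset.univ.map i.toEmbedding := by
    ext k
    rw [Finsupp.mem_support_iff, expo, Finsupp.finsetSum_apply, Finset.mem_map, ne_eq,
      Finset.sum_eq_zero_iff, not_forall]
    refine exists_congr fun l => ?_
    have := α.one_le_blocksFun l
    by_cases hl : i l = k
    · simp [hl, (show α.blocksFun l ≠ 0 by omega)]
    · simp [hl]
  rw [h, Finset.card_map, Finset.card_fin]

theorem subset_symmDiff_iff_chooses {P S : Finset ℕ} (hP : ∀ p ∈ P, 1 ≤ p) :
    P ⊆ symmDiff S (S.image (· + 1)) ↔ Chooses P S := by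
  refine forall₂_congr fun p hp => ?_
  have h : p ∈ S.image (· + 1) ↔ p - 1 ∈ S := by
    have h1 := hP p hp
    rw [Finset.mem_image]
    constructor
    · rintro ⟨q, hq, rfl⟩
      exact hq
    · exact fun hq => ⟨p - 1, hq, by omega⟩
  rw [Finset.mem_symmDiff, h]
  tauto

/-- The coefficients of Stembridge's peak functions. The sum over `α` counts the `S = D(α)` among the
partial sums of `d` which choose one element from each pair `{p - 1, p}`; see `card_chooses_mul`. -/
theorem coeff_K {n : ℕ} (hn : 1 ≤ n) {P : Finset ℕ} (hP : IsPeakSubset n P) (d : ℕ →₀ ℕ)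
    [Decidable (d.degree = n ∧ ∀ p ∈ P, p ∈ partialSums d ∨ p - 1 ∈ partialSums d)] :
    MvPowerSeries.coeff d (K n P) =
      if d.degree = n ∧ ∀ p ∈ P, p ∈ partialSums d ∨ p - 1 ∈ partialSums d
      then 2 ^ d.support.card else 0 := by
  classical
  have hP1 : ∀ p ∈ P, 2 ≤ p ∧ p ≤ n - 1 := fun p hp => Finset.mem_Icc.1 (hP.1 hp)
  have hK : MvPowerSeries.coeff d (K n P) = 2 ^ (P.card + 1) *
      ∑ α : Composition n with P ⊆ symmDiff (D α) ((D α).image (· + 1)),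
        MvPowerSeries.coeff d (F α) := by
    have h := coeff_natCast_mul (2 ^ (P.card + 1)) d
      (∑ α : Composition n with P ⊆ symmDiff (D α) ((D α).image (· + 1)), F α)
    push_cast at h
    rw [K, h, map_sum]
  rw [hK]
  simp only [coeff_F]
  by_cases hd : d.degree = n
  swap
  · simp [hd]
  simp only [hd, true_and]
  obtain ⟨β, i, hβ⟩ := exists_eq_expo d
  subst hd
  have hD : ∀ k, k ∈ D β ↔ 0 < k ∧ k < d.degree ∧ k ∈ partialSums d := by
    intro k
    constructor
    · intro hk
      have h0 := (mem_D.1 hk).1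
      have h1 := (mem_D.1 hk).2.1
      refine ⟨h0, h1, ?_⟩
      rw [hβ]
      exact (mem_partialSums_expo β i h0 h1).2 hk
    · rintro ⟨h0, h1, h2⟩
      rw [hβ] at h2
      exact (mem_partialSums_expo β i h0 h1).1 h2
  have hcard : (D β).card + 1 = d.support.card := by
    rw [card_D_add_one hn]
    conv_rhs => rw [hβ]
    exact (card_support_expo β i).symm
  have hsum : (∑ α : Composition d.degree with P ⊆ symmDiff (D α) ((D α).image (· + 1)),
      if ∀ k ∈ D α, k ∈ partialSums d then (1 : ℤ) else 0) =
      (({S ∈ (D β).powerset | Chooses P S} : Finset (Finset ℕ)).card : ℤ) := by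
    rw [← Finset.sum_filter, Finset.filter_filter, Finset.sum_const, nsmul_one]
    congr 1
    refine Finset.card_bij (fun α _ => D α) ?_ (fun α _ γ _ h => D_injective h) ?_
    · intro α hα
      obtain ⟨h1, h2⟩ := (Finset.mem_filter.1 hα).2
      refine Finset.mem_filter.2 ⟨Finset.mem_powerset.2 fun k hk => ?_,
        (subset_symmDiff_iff_chooses fun p hp => by have := hP1 p hp; omega).1 h1⟩
      exact (hD k).2 ⟨(mem_D.1 hk).1, (mem_D.1 hk).2.1, h2 k hk⟩
    · intro S hS
      obtain ⟨h1, h2⟩ := Finset.mem_filter.1 hS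
      rw [Finset.mem_powerset] at h1
      obtain ⟨α, rfl⟩ := exists_D_eq (n := d.degree) (S := S)
        fun k hk => ⟨((hD k).1 (h1 hk)).1, ((hD k).1 (h1 hk)).2.1⟩
      refine ⟨α, Finset.mem_filter.2 ⟨Finset.mem_univ α,
        (subset_symmDiff_iff_chooses fun p hp => by have := hP1 p hp; omega).2 h2,
        fun k hk => ((hD k).1 (h1 hk)).2.2⟩, rfl⟩
  rw [hsum]
  have hmem : ∀ p ∈ P, (p ∈ D β ∨ p - 1 ∈ D β ↔ p ∈ partialSums d ∨ p - 1 ∈ partialSums d) := by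
    intro p hp
    have := hP1 p hp
    refine or_congr ?_ ?_
    · rw [hD]
      exact ⟨fun h => h.2.2, fun h => ⟨by omega, by omega, h⟩⟩
    · rw [hD]
      exact ⟨fun h => h.2.2, fun h => ⟨by omega, by omega, h⟩⟩
  split_ifs with hc
  · have h := card_chooses_mul (fun p hp => by have := hP1 p hp; omega) hP.2
      (fun p hp => (hmem p hp).2 (hc p hp))
    rw [← hcard, pow_succ, pow_succ, mul_right_comm, mul_comm (2 ^ P.card : ℤ)]
    congr 1
    exact_mod_cast h
  · rw [not_forall] at hc
    obtain ⟨p, hc⟩ := hc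
    rw [Classical.not_imp] at hc
    rw [Finset.filter_false_of_mem, Finset.card_empty, Nat.cast_zero, mul_zero]
    intro S hS hch
    have hS' := Finset.mem_powerset.1 hS
    refine hch p hc.1 (iff_of_false (fun h => hc.2 ?_) (fun h => hc.2 ?_))
    · exact (hmem p hc.1).1 (Or.inl (hS' h))
    · exact (hmem p hc.1).1 (Or.inr (hS' h))

theorem isPeakSubset_peakSet {n : ℕ} (α : Composition n) : IsPeakSubset n (peakSet α) := by
  constructor
  · intro p hp
    exact (Finset.mem_inter.1 (Finset.mem_filter.1 hp).1).2
  · intro p hp hp'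
    exact (Finset.mem_filter.1 hp).2 (Finset.mem_inter.1 (Finset.mem_filter.1 hp').1).1

theorem exists_peakSet_eq {n : ℕ} {P : Finset ℕ} (hP : IsPeakSubset n P) :
    ∃ α : Composition n, peakSet α = P := by
  have h1 : ∀ p ∈ P, 2 ≤ p ∧ p ≤ n - 1 := fun p hp => Finset.mem_Icc.1 (hP.1 hp)
  obtain ⟨α, hα⟩ := exists_D_eq (n := n) (S := P) fun p hp => by
    have := h1 p hp
    omega
  refine ⟨α, ?_⟩
  rw [peakSet, hα, Finset.inter_eq_left.2 hP.1, Finset.filter_true_of_mem hP.2]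

theorem thetaHom_FQ {n : ℕ} (hn : 1 ≤ n) (α : Composition n) :
    thetaHom (FQ α) = K n (peakSet α) := by
  classical
  ext d
  rw [thetaHom_apply, coeff_thetaFun_FQ, coeff_K hn (isPeakSubset_peakSet α)]

/-- The empty composition indexes the constant `1`, which is not one of the `K_P`. -/
theorem FQ_of_zero (α : Composition 0) : FQ α = 1 := by
  classical
  apply Subtype.ext
  ext d
  change MvPowerSeries.coeff d (F α) = MvPowerSeries.coeff d 1
  rw [coeff_F, MvPowerSeries.coeff_one]
  refine if_congr ?_ rfl rfl
  rw [Finsupp.degree_eq_zero_iff]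
  refine and_iff_left_of_imp fun _ k hk => ?_
  exact absurd (mem_D.1 hk).2.1 (Nat.not_lt_zero k)

theorem thetaHom_mem_PQSym (f : QSym) : thetaHom f ∈ PQSym := by
  have h : f ∈ AddSubgroup.closure {f : QSym | ∃ (n : ℕ) (α : Composition n), f = FQ α} := by
    rw [closure_FQ]
    exact AddSubgroup.mem_top f
  induction h using AddSubgroup.closure_induction with
  | mem f hf =>
    obtain ⟨n, α, rfl⟩ := hf
    rcases Nat.eq_zero_or_pos n with rfl | hn
    · rw [FQ_of_zero, map_one]
      exact one_mem _
    · rw [thetaHom_FQ hn]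
      exact Subring.subset_closure ⟨n, _, hn, isPeakSubset_peakSet α, rfl⟩
  | zero => rw [map_zero]; exact zero_mem _
  | add f g _ _ hf hg => rw [map_add]; exact add_mem hf hg
  | neg f _ hf => rw [map_neg]; exact neg_mem hf

/-- Stembridge's descent-to-peak map `ϑ : QSym → PQSym`. -/
def theta : QSym →+* PQSym := thetaHom.codRestrict PQSym thetaHom_mem_PQSym

theorem coe_theta (f : QSym) : (theta f : Series) = thetaHom f := rfl

theorem theta_surjective : Function.Surjective theta := by
  have h : PQSym ≤ thetaHom.range := by
    rw [PQSym, Subring.closure_le]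
    rintro _ ⟨n, P, hn, hP, rfl⟩
    obtain ⟨α, rfl⟩ := exists_peakSet_eq hP
    exact ⟨FQ α, thetaHom_FQ hn α⟩
  rintro ⟨g, hg⟩
  obtain ⟨f, hf⟩ := h hg
  exact ⟨f, Subtype.ext hf⟩

/-! ### The λ-ring of peak quasisymmetric functions -/

namespace AdamsStructure

variable {R S : Type*} [CommRing R] [CommRing S]

/-- Adams operations preserving the kernel of a surjective homomorphism descend to its target. -/
def ofSurjective (A : AdamsStructure R) (f : R →+* S) (hf : Function.Surjective f)
    (h : ∀ k x, f x = 0 → f (A.psi k x) = 0) : AdamsStructure S :=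
  have hpsi : ∀ k x, f.liftOfSurjective hf ⟨f.comp (A.psi k), h k⟩ (f x) = f (A.psi k x) :=
    fun k x => f.liftOfRightInverse_comp_apply _ _ ⟨f.comp (A.psi k), h k⟩ x
  { psi := fun k => f.liftOfSurjective hf ⟨f.comp (A.psi k), h k⟩
    psi_one := by
      intro y
      obtain ⟨x, rfl⟩ := hf y
      rw [hpsi, A.psi_one]
    psi_psi := by
      intro k l hk hl y
      obtain ⟨x, rfl⟩ := hf y
      rw [hpsi, hpsi, hpsi, A.psi_psi k l hk hl]
    lam := fun n y => f (A.lam n (Function.surjInv hf y))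
    newton := by
      intro N y
      refine ((A.newton N (Function.surjInv hf y)).map f).congr (fun k _ _ => ?_) fun _ _ => rfl
      rw [← hpsi, Function.surjInv_eq hf] }

theorem ofSurjective_psi (A : AdamsStructure R) (f : R →+* S) (hf : Function.Surjective f)
    (h : ∀ k x, f x = 0 → f (A.psi k x) = 0) (k : ℕ) (x : R) :
    (A.ofSurjective f hf h).psi k (f x) = f (A.psi k x) :=
  f.liftOfRightInverse_comp_apply _ _ ⟨f.comp (A.psi k), h k⟩ x

theorem ofSurjective_lam [IsAddTorsionFree S] (A : AdamsStructure R) (f : R →+* S)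
    (hf : Function.Surjective f) (h : ∀ k x, f x = 0 → f (A.psi k x) = 0) (n : ℕ) (x : R) :
    (A.ofSurjective f hf h).lam n (f x) = f (A.lam n x) :=
  IsNewton.unique ((A.ofSurjective f hf h).newton n (f x)) ((A.newton n x).map f)
    (fun k _ _ => A.ofSurjective_psi f hf h k x) n le_rfl

end AdamsStructure

theorem constantCoeff_thetaHom (f : QSym) :
    MvPowerSeries.constantCoeff (thetaHom f) = MvPowerSeries.constantCoeff (f : Series) := by
  rw [← MvPowerSeries.coeff_zero_eq_constantCoeff_apply, thetaHom_apply, coeff_zero_thetaFun]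

/-- The Adams operations preserve the kernel of `ϑ`: `ϑ(Ψ^k(f))` depends only on `ϑ(f)`. -/
theorem theta_psi_eq_zero (k : ℕ) (f : QSym) (h : theta f = 0) :
    theta (adamsQSym.psi k f) = 0 := by
  have h' : thetaHom f = 0 := congrArg Subtype.val h
  apply Subtype.ext
  rw [coe_theta]
  rcases Nat.even_or_odd k with hk | hk
  · rcases Nat.eq_zero_or_pos k with rfl | hk0
    · have e : adamsQSym.psi 0 f = f := Subtype.ext rfl
      rw [e, h']
      rfl
    · rw [thetaHom_psi_of_even hk0 hk, ← constantCoeff_thetaHom, h', map_zero, map_zero]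
      rfl
  · rw [thetaHom_psi_of_odd hk, h', map_zero]
    rfl

/-- The Adams operations and λ-operations of `PQSym`. -/
def adamsPQSym : AdamsStructure PQSym :=
  adamsQSym.ofSurjective theta theta_surjective theta_psi_eq_zero

theorem adamsPQSym_psi (k : ℕ) (f : QSym) : adamsPQSym.psi k (theta f) = theta (adamsQSym.psi k f) :=
  adamsQSym.ofSurjective_psi _ _ _ k f

theorem adamsPQSym_lam (n : ℕ) (f : QSym) : adamsPQSym.lam n (theta f) = theta (adamsQSym.lam n f) :=
  adamsQSym.ofSurjective_lam _ _ _ n f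

theorem constantCoeff_MQ {n : ℕ} (hn : 1 ≤ n) (α : Composition n) :
    MvPowerSeries.constantCoeff (MQ α : Series) = 0 := by
  classical
  rw [← MvPowerSeries.coeff_zero_eq_constantCoeff_apply]
  change MvPowerSeries.coeff 0 (M α) = 0
  rw [coeff_M, if_neg]
  rintro ⟨i, hi⟩
  have h := degree_expo α i
  rw [← hi, map_zero] at h
  omega

theorem adamsPQSym_psi_MQ_of_even {k : ℕ} (hk0 : 0 < k) (hk : Even k) {n : ℕ} (hn : 1 ≤ n)
    (α : Composition n) : adamsPQSym.psi k (theta (MQ α)) = 0 := by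
  rw [adamsPQSym_psi]
  apply Subtype.ext
  rw [coe_theta, thetaHom_psi_of_even hk0 hk, constantCoeff_MQ hn, map_zero]
  rfl

/-! ### Schur's `Q`-functions -/

/-- A term of `q_n = ∑ h_i e_j` at `x^d` is the choice of the support of the monomial of `e_j`, which
may be any subset of the support of `d`. -/
theorem coeff_schurq (n : ℕ) (d : ℕ →₀ ℕ) :
    MvPowerSeries.coeff d (schurq n) = if d.degree = n then 2 ^ d.support.card else 0 := by
  classical
  have hterm : ∀ ij : ℕ × ℕ, MvPowerSeries.coeff d (complSym ij.1 * elemSym ij.2) =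
      ∑ p ∈ antidiagonal d, if p.1.degree = ij.1 ∧ p.2.degree = ij.2 ∧
        ∀ i, p.2 i ≤ 1 then 1 else 0 := by
    intro ij
    rw [MvPowerSeries.coeff_mul]
    refine Finset.sum_congr rfl fun p _ => ?_
    rw [MvPowerSeries.coeff_apply, MvPowerSeries.coeff_apply, complSym, elemSym, mul_ite, mul_one,
      mul_zero, ← ite_and]
    exact if_congr and_comm rfl rfl
  have hswap : MvPowerSeries.coeff d (schurq n) = ∑ p ∈ antidiagonal d,
      if d.degree = n ∧ ∀ i, p.2 i ≤ 1 then (1 : ℤ) else 0 := by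
    rw [schurq, map_sum]
    simp only [hterm]
    rw [Finset.sum_comm]
    refine Finset.sum_congr rfl fun p hp => ?_
    have hdeg : p.1.degree + p.2.degree = d.degree := by rw [← mem_antidiagonal.1 hp, map_add]
    by_cases hd : d.degree = n
    · rw [Finset.sum_eq_single_of_mem (p.1.degree, p.2.degree)
        (mem_antidiagonal.2 (hdeg.trans hd))]
      · simp [hd]
      · intro ij _ hij
        rw [if_neg]
        rintro ⟨h1, h2, -⟩
        exact hij (Prod.ext h1.symm h2.symm)
    · rw [if_neg fun h => hd h.1]
      refine Finset.sum_eq_zero fun ij hij => if_neg ?_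
      rintro ⟨h1, h2, -⟩
      rw [mem_antidiagonal] at hij
      omega
  rw [hswap]
  by_cases hd : d.degree = n
  swap
  · simp [hd]
  simp only [hd, true_and, if_true]
  rw [← Finset.sum_filter, Finset.sum_const, nsmul_one]
  have hcard : ({p ∈ antidiagonal d | ∀ i, p.2 i ≤ 1} : Finset _).card = d.support.powerset.card := by
    refine Finset.card_bij (fun p _ => p.2.support) ?_ ?_ ?_
    · intro p hp
      rw [Finset.mem_powerset, ← mem_antidiagonal.1 (Finset.mem_filter.1 hp).1]
      exact Finsupp.support_mono le_add_self
    · intro p hp q hq h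
      obtain ⟨hp1, hp2⟩ := Finset.mem_filter.1 hp
      obtain ⟨hq1, hq2⟩ := Finset.mem_filter.1 hq
      have e : p.2 = q.2 := by
        ext i
        have h1 := hp2 i
        have h2 := hq2 i
        have h3 : p.2 i ≠ 0 ↔ q.2 i ≠ 0 := by
          rw [← Finsupp.mem_support_iff, ← Finsupp.mem_support_iff]
          exact iff_of_eq (congrArg (i ∈ ·) h)
        omega
      refine Prod.ext ?_ e
      have h4 := (mem_antidiagonal.1 hp1).trans (mem_antidiagonal.1 hq1).symm
      rw [e] at h4
      exact add_right_cancel h4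
    · intro S hS
      rw [Finset.mem_powerset] at hS
      have hi : ∀ i, Finsupp.indicator S (fun _ _ => 1) i = if i ∈ S then 1 else 0 := fun i => by
        rw [Finsupp.indicator_apply]
        split_ifs <;> rfl
      refine ⟨(d - Finsupp.indicator S fun _ _ => 1, Finsupp.indicator S fun _ _ => 1),
        Finset.mem_filter.2 ⟨mem_antidiagonal.2 (tsub_add_cancel_of_le fun i => ?_), fun i => ?_⟩, ?_⟩
      · rw [hi]
        split_ifs with h
        · exact Nat.one_le_iff_ne_zero.2 (Finsupp.mem_support_iff.1 (hS h))
        · exact Nat.zero_le _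
      · change Finsupp.indicator S (fun _ _ => 1) i ≤ 1
        rw [hi]
        split_ifs <;> simp
      · ext i
        rw [Finsupp.mem_support_iff, hi]
        simp
  rw [hcard, Finset.card_powerset]
  push_cast
  rfl

open Classical in
/-- The power sum `p_k = ∑ x_i^k`. -/
def powerSum (k : ℕ) : Series := fun d => if ∃ v, d = Finsupp.single v k then 1 else 0

theorem coeff_mul_powerSum {k : ℕ} (hk : 0 < k) (f : Series) (d : ℕ →₀ ℕ) :
    MvPowerSeries.coeff d (f * powerSum k) = ∑ v ∈ d.support,
      if k ≤ d v then MvPowerSeries.coeff (d - Finsupp.single v k) f else 0 := by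
  classical
  rw [MvPowerSeries.coeff_mul]
  have hterm : ∀ p : (ℕ →₀ ℕ) × (ℕ →₀ ℕ), MvPowerSeries.coeff p.1 f * MvPowerSeries.coeff p.2 (powerSum k)
      = if ∃ v, p.2 = Finsupp.single v k then MvPowerSeries.coeff p.1 f else 0 := by
    intro p
    rw [MvPowerSeries.coeff_apply (f := powerSum k), powerSum, mul_ite, mul_one, mul_zero]
  simp only [hterm]
  rw [← Finset.sum_filter, ← Finset.sum_filter]
  symm
  refine Finset.sum_bij (fun v _ => (d - Finsupp.single v k, Finsupp.single v k)) ?_ ?_ ?_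
    (fun _ _ => rfl)
  · intro v hv
    refine Finset.mem_filter.2 ⟨mem_antidiagonal.2 (tsub_add_cancel_of_le ?_), v, rfl⟩
    rw [Finsupp.single_le_iff]
    exact (Finset.mem_filter.1 hv).2
  · intro v _ w _ h
    exact Finsupp.single_left_injective hk.ne' (Prod.mk.inj h).2
  · intro p hp
    obtain ⟨hp, v, hv⟩ := Finset.mem_filter.1 hp
    rw [mem_antidiagonal] at hp
    have hle : k ≤ d v := by
      rw [← hp, hv, Finsupp.add_apply, Finsupp.single_eq_same]
      exact Nat.le_add_left _ _
    refine ⟨v, Finset.mem_filter.2 ⟨Finsupp.mem_support_iff.2 (by omega), hle⟩, Prod.ext ?_ hv.symm⟩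
    change d - Finsupp.single v k = p.1
    rw [← hp, hv, add_tsub_cancel_right]

/-- The contribution of one variable with exponent `m` to Newton's recursion for `q_n`. -/
theorem sum_range_even (m N : ℕ) (hm : 0 < m) (h : m ≤ N) :
    ∑ j ∈ Finset.range N, (if Even j ∧ j + 1 ≤ m then (if j + 1 = m then 1 else 2) else 0 : ℤ) = m := by
  have h2 : ∀ m : ℕ, ∑ j ∈ Finset.range m, (if Even j then 2 else 0 : ℤ) =
      m + if Even m then 0 else 1 := by
    intro m
    induction m with
    | zero => simp
    | succ m ih =>
      rw [Finset.sum_range_succ, ih]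
      by_cases hm : Even m
      · simp only [hm, Nat.even_add_one, not_true_eq_false, if_true, if_false]
        push_cast
        ring
      · simp [hm, Nat.even_add_one]
  obtain ⟨m, rfl⟩ := Nat.exists_eq_succ_of_ne_zero hm.ne'
  rw [← Finset.sum_subset (Finset.range_mono h), Finset.sum_range_succ]
  · rw [Finset.sum_congr rfl (g := fun j => if Even j then (2 : ℤ) else 0), h2]
    · by_cases hm : Even m <;> simp [hm]
    · intro j hj
      rw [Finset.mem_range] at hj
      by_cases hj' : Even j
      · rw [if_pos ⟨hj', by omega⟩, if_neg (by omega), if_pos hj']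
      · rw [if_neg fun h => hj' h.1, if_neg hj']
  · intro j _ hj
    rw [Finset.mem_range] at hj
    exact if_neg fun h => by omega

theorem card_support_sub_single {d : ℕ →₀ ℕ} {v k : ℕ} (hv : v ∈ d.support) (hk : 0 < k)
    (hkd : k ≤ d v) : 2 * 2 ^ (d - Finsupp.single v k).support.card =
      (if k = d v then 1 else 2 : ℤ) * 2 ^ d.support.card := by
  classical
  have happ : ∀ i, (d - Finsupp.single v k) i = if i = v then d v - k else d i := by
    intro i
    rw [Finsupp.tsub_apply, Finsupp.single_apply]
    by_cases hi : v = i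
    · subst hi
      simp
    · simp [hi, Ne.symm hi]
  split_ifs with h
  · have e : (d - Finsupp.single v k).support = d.support.erase v := by
      ext i
      rw [Finsupp.mem_support_iff, happ, Finset.mem_erase, Finsupp.mem_support_iff]
      by_cases hi : i = v <;> simp [hi, h]
    rw [e, ← pow_succ', Finset.card_erase_add_one hv, one_mul]
  · have e : (d - Finsupp.single v k).support = d.support := by
      ext i
      rw [Finsupp.mem_support_iff, happ, Finsupp.mem_support_iff]
      by_cases hi : i = v
      · subst hi
        simp only [if_true]
        omega
      · simp [hi]
    rw [e]

/-- Newton's recursion `n q_n = ∑_{i odd} 2 p_i q_{n-i}`, the logarithmic derivative of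
`∏ (1 + x_i z) / (1 - x_i z)`. -/
theorem isNewton_schurq (N : ℕ) :
    IsNewton N (fun k => if Odd k then 2 * powerSum k else 0) schurq := by
  classical
  constructor
  · ext d
    rw [coeff_schurq, MvPowerSeries.coeff_one]
    by_cases h : d = 0
    · simp [h]
    · rw [if_neg h, if_neg (mt (Finsupp.degree_eq_zero_iff d).1 h)]
  intro n _
  ext d
  rw [coeff_natCast_mul, coeff_schurq, map_sum]
  have hterm : ∀ ij : ℕ × ℕ, ij ∈ antidiagonal n →
      MvPowerSeries.coeff d ((-1) ^ ij.2 * schurq ij.1 *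
        if Odd (ij.2 + 1) then 2 * powerSum (ij.2 + 1) else 0) =
      ∑ v ∈ d.support, if d.degree = n + 1 then
        (if Even ij.2 ∧ ij.2 + 1 ≤ d v then (if ij.2 + 1 = d v then 1 else 2 : ℤ) else 0) *
          2 ^ d.support.card else 0 := by
    rintro ⟨i, j⟩ hij
    have hij' : i + j = n := mem_antidiagonal.1 hij
    simp only
    by_cases hj : Even j
    · have e : (-1) ^ j * schurq i * (if Odd (j + 1) then 2 * powerSum (j + 1) else 0) =
          ((2 : ℕ) : Series) * (schurq i * powerSum (j + 1)) := by
        rw [hj.neg_one_pow, if_pos hj.add_one]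
        push_cast
        ring
      rw [e, coeff_natCast_mul, coeff_mul_powerSum j.succ_pos, Finset.mul_sum]
      refine Finset.sum_congr rfl fun v hv => ?_
      by_cases hle : j + 1 ≤ d v
      · rw [if_pos hle, if_pos (⟨hj, hle⟩ : Even j ∧ j + 1 ≤ d v),
          ← card_support_sub_single hv (Nat.succ_pos j) hle, coeff_schurq]
        have hdeg : (d - Finsupp.single v j.succ).degree + (j + 1) = d.degree := by
          conv_rhs => rw [← tsub_add_cancel_of_le (Finsupp.single_le_iff.2 hle), map_add,
            Finsupp.degree_single]
        rw [mul_ite, mul_zero]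
        exact if_congr (by omega) rfl rfl
      · rw [if_neg hle, if_neg fun h : Even j ∧ j + 1 ≤ d v => hle h.2]
        simp
    · have hodd : ¬ Odd (j + 1) := by
        rwa [Nat.odd_add_one, not_not, ← Nat.not_even_iff_odd]
      rw [if_neg hodd, mul_zero, map_zero]
      symm
      refine Finset.sum_eq_zero fun v _ => ?_
      rw [if_neg fun h : Even j ∧ j + 1 ≤ d v => hj h.1]
      simp
  rw [Finset.sum_congr rfl hterm, Finset.sum_comm]
  by_cases hd : d.degree = n + 1
  swap
  · simp [hd]
  simp only [hd, if_true]
  have hinner : ∀ v ∈ d.support, ∑ ij ∈ antidiagonal n,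
      (if Even ij.2 ∧ ij.2 + 1 ≤ d v then (if ij.2 + 1 = d v then 1 else 2 : ℤ) else 0) *
        2 ^ d.support.card = d v * 2 ^ d.support.card := by
    intro v hv
    rw [← Finset.sum_mul, Finset.Nat.sum_antidiagonal_eq_sum_range_succ_mk, ← Finset.sum_range_reflect]
    congr 1
    rw [← sum_range_even (d v) (n + 1) (Nat.pos_of_ne_zero (Finsupp.mem_support_iff.1 hv))
      (hd ▸ Finsupp.le_degree v d)]
    refine Finset.sum_congr rfl fun j hj => ?_
    have := Finset.mem_range.1 hj
    simp only [show n - (n + 1 - 1 - j) = j by omega]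
  rw [Finset.sum_congr rfl hinner, ← Finset.sum_mul, ← hd, Finsupp.degree_apply]
  push_cast
  rfl

theorem psiSer_schurq_one {k : ℕ} (hk : 0 < k) : psiSer k (schurq 1) = 2 * powerSum k := by
  classical
  ext d
  have e : MvPowerSeries.coeff d (2 * powerSum k) = 2 * if ∃ v, d = Finsupp.single v k then 1 else 0 := by
    have h := coeff_natCast_mul 2 d (powerSum k)
    push_cast at h
    rw [h, MvPowerSeries.coeff_apply, powerSum]
  rw [e]
  by_cases h : ∀ i, k ∣ d i
  · obtain ⟨d, rfl⟩ := exists_eq_smul_of_dvd h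
    rw [coeff_smul_psiSer hk, coeff_schurq]
    by_cases hd : d.degree = 1
    · obtain ⟨v, rfl⟩ := (Finsupp.sum_eq_one_iff d).1 hd
      rw [if_pos hd, if_pos ⟨v, by simp⟩, Finsupp.support_single (hb := one_ne_zero)]
      simp
    · rw [if_neg hd, if_neg, mul_zero]
      rintro ⟨v, hv⟩
      have h2 := congrArg Finsupp.degree hv
      rw [map_nsmul, Finsupp.degree_single, smul_eq_mul] at h2
      exact hd (Nat.eq_of_mul_eq_mul_left hk (by omega))
  · obtain ⟨i, hi⟩ := not_forall.1 h
    rw [coeff_psiSer_of_not_dvd hk hi, if_neg, mul_zero]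
    rintro ⟨v, rfl⟩
    refine h fun i => ?_
    rw [Finsupp.single_apply]
    split_ifs
    · exact dvd_rfl
    · exact dvd_zero k

theorem thetaHom_FQ_ones : thetaHom (FQ (Composition.ones 1)) = schurq 1 := by
  classical
  ext d
  rw [thetaHom_apply, coeff_thetaFun_FQ, coeff_schurq]
  refine if_congr (and_iff_left fun p hp => ?_) rfl rfl
  have h := Finset.mem_Icc.1 ((isPeakSubset_peakSet _).1 hp)
  omega

/-- The generator `q_n` of `Γ` is `λ^n(q_1)`, where `q_1 = ϑ(F_1)`. -/
theorem coe_lam_theta_FQ_ones (n : ℕ) :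
    (adamsPQSym.lam n (theta (FQ (Composition.ones 1))) : Series) = schurq n := by
  refine IsNewton.unique ((adamsPQSym.newton n _).map PQSym.subtype) (isNewton_schurq n) ?_ n le_rfl
  intro k hk _
  simp only [adamsPQSym_psi]
  change thetaHom (adamsQSym.psi k _) = _
  split_ifs with h
  · rw [thetaHom_psi_of_odd h, thetaHom_FQ_ones, psiSer_schurq_one hk]
  · rw [thetaHom_psi_of_even hk (Nat.not_odd_iff_even.1 h), ← constantCoeff_thetaHom, thetaHom_FQ_ones,
      ← MvPowerSeries.coeff_zero_eq_constantCoeff_apply, coeff_schurq]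
    simp

theorem Γ_eq_map : Γ = (Subring.closure {y | ∃ n, 1 ≤ n ∧
    y = adamsPQSym.toLambda.lam n (theta (FQ (Composition.ones 1)))}).map PQSym.subtype := by
  rw [RingHom.map_closure, Γ]
  congr 1
  ext f
  constructor
  · rintro ⟨n, hn, rfl⟩
    exact ⟨_, ⟨n, hn, rfl⟩, coe_lam_theta_FQ_ones n⟩
  · rintro ⟨_, ⟨n, hn, rfl⟩, rfl⟩
    exact ⟨n, hn, coe_lam_theta_FQ_ones n⟩

theorem Γ_le_PQSym : Γ ≤ PQSym := by
  rw [Γ_eq_map]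
  rintro _ ⟨y, -, rfl⟩
  exact y.2

theorem isLambdaSubring_Γ : adamsPQSym.toLambda.IsLambdaSubring (Γ.comap PQSym.subtype) := by
  rw [Γ_eq_map, Subring.comap_map_eq_self_of_injective Subtype.val_injective]
  exact LambdaStructure.isLambdaSubring_closure_range _ _

end PeakQSym

end

open PeakQSym in
theorem theorem3p2 :
    -- the λ-ring structure of `QSym`, with Adams operations `M_α ↦ M_{k·α}`
    ∃ LQ : LambdaStructure QSym,
      (∀ (k : ℕ) (hk : 0 < k) (n : ℕ) (α : Composition n),
        LQ.adams k (MQ α) = MQ (dilate k hk α)) ∧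
    -- the descent-to-peak map
    ∃ θ : QSym →+* PQSym,
      (∀ (n : ℕ) (α : Composition n), 1 ≤ n → (θ (FQ α) : Series) = K n (peakSet α)) ∧
      Function.Surjective θ ∧
    -- the λ-ring structure of `PQSym` and its Adams operations, on `L_α = θ(M_α)`, `α` odd
    ∃ LP : LambdaStructure PQSym,
      LQ.IsLambdaHom LP θ ∧
      (∃ Φ : ℕ → (PQSym →+* PQSym),
        (∀ k, 0 < k → ∀ f, LP.adams k f = Φ k f) ∧
        ∀ (k : ℕ) (hk : 0 < k) (n : ℕ) (α : Composition n), 1 ≤ n → IsOdd α →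
          (Odd k → Φ k (θ (MQ α)) = θ (MQ (dilate k hk α))) ∧
          (Even k → Φ k (θ (MQ α)) = 0)) ∧
    -- `Γ` is a λ-subring of `PQSym`
      Γ ≤ PQSym ∧ LP.IsLambdaSubring (Γ.comap PQSym.subtype) := by
  refine ⟨adamsQSym.toLambda, fun k hk n α => ?_, theta, fun n α hn => thetaHom_FQ hn α,
    theta_surjective, adamsPQSym.toLambda, fun n f => (adamsPQSym_lam n f).symm,
    ⟨adamsPQSym.psi, fun k hk f => AdamsStructure.adams_toLambda _ k hk f,
      fun k hk n α hn _ => ⟨fun _ => ?_, fun h => adamsPQSym_psi_MQ_of_even hk h hn α⟩⟩,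
    Γ_le_PQSym, isLambdaSubring_Γ⟩
  · rw [AdamsStructure.adams_toLambda _ k hk, psi_MQ hk]
  · rw [adamsPQSym_psi, psi_MQ hk]
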